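/- Let $\xi=e^{2\pi i/8}$ and $\lambda=1+\xi+\xi^{-1}=1+\sqrt2$; let $\star$ be the automorphism of $\mathbb Q(\xi)$ with $\xi^\star=\xi^3$, and let it act on maps $x\mapsto ax+b$ and $x\mapsto a\overline{x}+b$ with $a,b\in\mathbb Q(\xi)$ through $a,b$. Put $f^\sharp=(f^{-1})^\star$. The prototiles of the Ammann–Beenker substitution are the triangle $S$ with vertices $0,i,1+i$ and the rhomb $L$ with vertices $0,1,1+\xi,\xi$, and its iterated function system is $$L=\bigcup_{i\in\{1,2,3\}}f_i(L)\cup\bigcup_{i\in\{6,7,8,9\}}f_i(S),\qquad S=\bigcup_{i\in\{4,5\}}f_i(L)\cup\bigcup_{i\in\{10,11,12\}}f_i(S),$$ where $f_i(x)=\lambda^{-1}g_i(x)$ and $$\begin{aligned} g_1(x)&=\xi^4x+1+\xi, & g_2(x)&=\xi\overline x+1+\xi+\xi^2+\xi^7, & g_3(x)&=\xi^7\overline x+1+\xi+\xi^2,\\ g_4(x)&=x+\xi+\xi^2, & g_5(x)&=\xi^2x+\xi, & g_6(x)&=\xi^2\overline x+\xi,\\ g_7(x)&=\xi^3x+1+2\xi+\xi^2+\xi^7,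 & g_8(x)&=\xi^6\overline x+2+\xi+\xi^2+\xi^7, & g_9(x)&=\xi^7x+1,\\ g_{10}(x)&=\xi^5x+\xi+\xi^3, & g_{11}(x)&=\xi^6\overline x+1+\xi+\xi^2, & g_{12}(x)&=\xi^3x+2\xi+\xi^2. \end{aligned}$$ The unions are non-overlapping. So this is a self-similar tile-substitution: $\lambda T$ is dissected into the congruent copies of $S$ and $L$ given by the maps $g_i=\lambda f_i$. The $\star$-dual substitution is given by the dual system $$L^\star=\bigcup_{i\in\{1,2,3\}}f_i^\sharp(L^\star)\cup\bigcup_{i\in\{4,5\}}f_i^\sharp(S^\star),\qquad S^\star=\bigcup_{i\in\{6,7,8,9\}}f_i^\sharp(L^\star)\cup\bigcup_{i\in\{10,11,12\}}f_i^\sharp(S^\star)$$ and the expansion factor $(\lambda^\star)^{-1}=(1-\sqrt2)^{-1}$. For each of the two substitutions, a tiling (a set of compact tiles, without decoration) belongs to its tiling space if each finite subset of it is a translate of a subset of some $\sigma^k(\rho T)$, where $k\ge0$, $T$ is a prototile and $\rho$ is one of the sixteen maps $z\mapsto\xi^mz$, $z\mapsto\xi^m\overline z$. A tiling $\mathcal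 T'$ is locally derivable from $\mathcal T$ if, for some compact set $C$, the tiles of $\mathcal T'$ that contain a point $x$ are determined, up to translation by $x$, by the tiles of $\mathcal T$ that meet $x+C$. Two tilings are mutually locally derivable (MLD) if each of them is locally derivable from the other. **Theorem.** The dual system has exactly one solution $(S^\star,L^\star)$ in nonempty compact sets, and it defines a tile-substitution (its unions are non-overlapping). $S^\star$ is an isosceles right triangle with legs $\sqrt2/2$, and $L^\star$ is a thin right triangle with legs $\cos(\pi/8)$ and $\sin(\pi/8)$. The diagonals of $L$ dissect $L$ into four congruent copies of $L^\star$, and the axis of symmetry of $S$ dissects $S$ into two congruent copies of $S^\star$. Dissecting in this way every tile of a tiling is a bijection from the Ammann–Beenker tilings onto the tilings of the $\star$-dual substitution, and each Ammann–Beenker tiling is mutually locally derivable with its image, with local rules in both directions that are the same for all Ammann–Beenker tilings. -/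

import Mathlib

open scoped Pointwise

namespace AmmannBeenker

noncomputable section

/-! ### The cyclotomic field and its Galois automorphisms -/

/-- The primitive eighth root of unity `ξ = exp (2πi/8)`. -/
def xi : ℂ := Complex.exp (2 * Real.pi * Complex.I / (8 : ℕ))

/-- The cyclotomic field `ℚ(ξ)`, as a subfield of `ℂ`. -/
abbrev K : IntermediateField ℚ ℂ := IntermediateField.adjoin ℚ {xi}

/-- `ξ` as an element of `ℚ(ξ)`. -/
def xiK : K := IntermediateField.AdjoinSimple.gen ℚ xi

theorem xi_primitive : IsPrimitiveRoot xi 8 :=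
  Complex.isPrimitiveRoot_exp 8 (by norm_num)

theorem xiK_primitive : IsPrimitiveRoot xiK 8 := by
  refine IsPrimitiveRoot.of_map_of_injective (f := K.val) ?_ K.val.injective
  exact xi_primitive

theorem xi_isIntegral : IsIntegral ℚ xi :=
  (xi_primitive.isIntegral (by norm_num)).tower_top

theorem xiK_pow_mem_aroots (n : ℕ) (hn : n.Coprime 8) :
    xiK ^ n ∈ (minpoly ℚ xi).aroots K := by
  rw [Polynomial.mem_aroots,
    ← Polynomial.cyclotomic_eq_minpoly_rat xi_primitive (by norm_num)]
  refine ⟨Polynomial.cyclotomic_ne_zero 8 ℚ, ?_⟩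
  have h := (xiK_primitive.pow_of_coprime n hn).isRoot_cyclotomic (by norm_num)
  rw [Polynomial.IsRoot, ← Polynomial.map_cyclotomic 8 (algebraMap ℚ K)] at h
  rwa [Polynomial.aeval_def, Polynomial.eval₂_eq_eval_map]

/-- The element of the Galois group of `ℚ(ξ)` that sends `ξ` to `ξ ^ n`, for `n` coprime to `8`. -/
def galois (n : ℕ) (hn : n.Coprime 8) : K →ₐ[ℚ] K :=
  (IntermediateField.algHomAdjoinIntegralEquiv ℚ xi_isIntegral).symm
    ⟨xiK ^ n, xiK_pow_mem_aroots n hn⟩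

theorem galois_xiK (n : ℕ) (hn : n.Coprime 8) : galois n hn xiK = xiK ^ n :=
  IntermediateField.algHomAdjoinIntegralEquiv_symm_apply_gen ℚ xi_isIntegral _

/-- The star map: the Galois automorphism with `ξ ↦ ξ ^ 3`. -/
def starMap : K →ₐ[ℚ] K := galois 3 (by norm_num)

/-- Complex conjugation on `ℚ(ξ)`: the Galois automorphism with `ξ ↦ ξ ^ 7 = ξ⁻¹`. -/
def conjK : K →ₐ[ℚ] K := galois 7 (by norm_num)

/-- `conjK` is the restriction of complex conjugation. -/
theorem coe_conjK (x : K) : ((conjK x : K) : ℂ) = (starRingEnd ℂ) (x : ℂ) := by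
  have h : (K.val.comp conjK) =
      ((Complex.conjAe.toAlgHom.restrictScalars ℚ).comp K.val) := by
    apply (IntermediateField.algHomAdjoinIntegralEquiv ℚ xi_isIntegral).injective
    apply Subtype.ext
    change ((conjK xiK : K) : ℂ) = (starRingEnd ℂ) xi
    rw [conjK, galois_xiK]
    change xi ^ 7 = (starRingEnd ℂ) xi
    have h8 : xi ^ 7 * xi = 1 := by rw [← pow_succ]; exact xi_primitive.pow_eq_one
    have hn : (starRingEnd ℂ) xi * xi = 1 := by
      rw [mul_comm, Complex.mul_conj, Complex.normSq_eq_norm_sq,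
        xi_primitive.norm'_eq_one (by norm_num)]
      norm_num
    exact mul_right_cancel₀ (xi_primitive.ne_zero (by norm_num)) (h8.trans hn.symm)
  exact DFunLike.congr_fun h x

/-! ### Similarities of the plane with coefficients in `ℚ(ξ)`, and their star-duals -/

/-- The similarity `x ↦ lin * x + trans` (if `refl = false`) or `x ↦ lin * conj x + trans`
(if `refl = true`) of `ℂ`, with coefficients in `ℚ(ξ)`. -/
structure SimMap where
  refl : Bool
  lin : K
  trans : K

/-- The map `ℂ → ℂ` that the coefficients describe. -/
def SimMap.eval (f : SimMap) (z : ℂ) : ℂ :=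
  (f.lin : ℂ) * (if f.refl then (starRingEnd ℂ) z else z) + (f.trans : ℂ)

/-- The inverse map (for `f.lin ≠ 0`). -/
def SimMap.inv (f : SimMap) : SimMap :=
  if f.refl then ⟨true, conjK f.lin⁻¹, -conjK (f.lin⁻¹ * f.trans)⟩
  else ⟨false, f.lin⁻¹, -(f.lin⁻¹ * f.trans)⟩

theorem SimMap.eval_inv_eval (f : SimMap) (hf : f.lin ≠ 0) (z : ℂ) :
    f.inv.eval (f.eval z) = z := by
  obtain ⟨b, a, d⟩ := f
  have h0 : (a : ℂ) ≠ 0 := fun h => hf (Subtype.ext h)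
  have h1 : (starRingEnd ℂ) (a : ℂ) ≠ 0 := by simpa using h0
  cases b
  · simp [SimMap.inv, SimMap.eval, mul_add, h0]
  · simp [SimMap.inv, SimMap.eval, coe_conjK, mul_add, h1]

/-- The star map acts on a map with coefficients in `ℚ(ξ)` through the coefficients. -/
def SimMap.star (f : SimMap) : SimMap := ⟨f.refl, starMap f.lin, starMap f.trans⟩

/-- `f♯ = (f⁻¹)⋆`. -/
def SimMap.sharp (f : SimMap) : SimMap := f.inv.star

/-! ### Matrix function systems and tile-substitutions -/

/-- A matrix function system: the entry `F i j` is the set of the maps `f` for which a copy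
`f (T i)` of the prototile `T i` occurs in the dissection of `T j`. -/
abbrev MatrixSystem (ι : Type) : Type := ι → ι → Set SimMap

/-- The star-dual system: transpose the matrix and replace each map `f` by `f♯`. -/
def MatrixSystem.starDual {ι : Type} (F : MatrixSystem ι) : MatrixSystem ι :=
  fun i j => SimMap.sharp '' F j i

/-- `T` is a nonempty compact solution of the iterated function system of `F`:
`T j = ⋃ i, ⋃ f ∈ F i j, f (T i)` for all `j`. -/
def IsSolution {ι : Type} (F : MatrixSystem ι) (T : ι → Set ℂ) : Prop :=
  (∀ j, IsCompact (T j) ∧ (T j).Nonempty) ∧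
    ∀ j, T j = ⋃ i, ⋃ f ∈ F i j, f.eval '' T i

/-- The matrix function system `F` defines a self-similar tile-substitution with prototiles `T` and
expanding homothety `z ↦ q * z`: each prototile is a tile, and `q T j` is a finite non-overlapping
union of the congruent copies `q f (T i)`, `f ∈ F i j`, of prototiles. -/
structure IsTileSubstitution {ι : Type} (F : MatrixSystem ι) (q : ℂ) (T : ι → Set ℂ) : Prop where
  expanding : 1 < ‖q‖
  finite : ∀ i j, (F i j).Finite
  isometric : ∀ i j, ∀ f ∈ F i j, ‖q * (f.lin : ℂ)‖ = 1
  solution : IsSolution F T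
  regular : ∀ j, closure (interior (T j)) = T j
  nonoverlapping : ∀ j i i' f f', f ∈ F i j → f' ∈ F i' j → (i, f) ≠ (i', f') →
    Disjoint (interior (f.eval '' T i)) (interior (f'.eval '' T i'))

/-- A placed prototile: the copy `g (T i)` is given by the index `i` and the isometry `g`. -/
abbrev PlacedTile (ι : Type) : Type := ι × (ℂ → ℂ)

/-- The substitution `σ` on placed prototiles, extended to sets of them: `σ` sends the placed tile
`g (T j)` to the tiles `q g (f (T i))`, `f ∈ F i j`, which dissect `q g (T j)`. -/
def substitute {ι : Type} (F : MatrixSystem ι) (q : ℂ) (P : Set (PlacedTile ι)) :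
    Set (PlacedTile ι) :=
  {t | ∃ s ∈ P, ∃ f ∈ F t.1 s.1, t.2 = fun z => q * s.2 (f.eval z)}

/-- The orthogonal maps generated by multiplication by `ξ` and by complex conjugation. The prototiles
up to translation are the images of the given ones under these sixteen maps. -/
def orientations : Set (ℂ → ℂ) :=
  {ρ | ∃ k : ℕ, (ρ = fun z => xi ^ k * z) ∨ (ρ = fun z => xi ^ k * (starRingEnd ℂ) z)}

/-- The rigid motions of the plane whose linear part belongs to `orientations`. -/
def motions : Set (ℂ → ℂ) :=
  {g | ∃ ρ ∈ orientations, ∃ b : ℂ, g = fun z => ρ z + b}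

/-- `σᵏ (ρ (T j))`, as a set of tiles. -/
def superPatch {ι : Type} (F : MatrixSystem ι) (q : ℂ) (T : ι → Set ℂ) (k : ℕ) (j : ι)
    (ρ : ℂ → ℂ) : Set (Set ℂ) :=
  (fun t : PlacedTile ι => t.2 '' T t.1) '' ((substitute F q)^[k] {(j, ρ)})

/-- A tiling of the plane is a set of tiles (nonempty compact sets that are the closure of their
interior) that covers the plane and is non-overlapping. -/
structure IsTiling (𝒯 : Set (Set ℂ)) : Prop where
  tile : ∀ t ∈ 𝒯, t.Nonempty ∧ IsCompact t ∧ closure (interior t) = t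
  cover : ⋃₀ 𝒯 = Set.univ
  nonoverlapping : ∀ t ∈ 𝒯, ∀ t' ∈ 𝒯, t ≠ t' → Disjoint (interior t) (interior t')

/-- The translate of a set of tiles by `v`. -/
def translate (v : ℂ) (P : Set (Set ℂ)) : Set (Set ℂ) := (fun t => v +ᵥ t) '' P

/-- The tiling space of the substitution: all tilings each finite subset of which is a translate of
a subset of some `σᵏ` of a prototile. -/
def tilingSpace {ι : Type} (F : MatrixSystem ι) (q : ℂ) (T : ι → Set ℂ) : Set (Set (Set ℂ)) :=
  {𝒯 | IsTiling 𝒯 ∧ ∀ P ⊆ 𝒯, P.Finite →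
    ∃ (k : ℕ) (j : ι), ∃ ρ ∈ orientations, ∃ v : ℂ, P ⊆ translate v (superPatch F q T k j ρ)}

/-! ### Local derivability -/

/-- The tiles of `𝒯` that meet the set `A`. -/
def patchAt (𝒯 : Set (Set ℂ)) (A : Set ℂ) : Set (Set ℂ) := {t ∈ 𝒯 | (t ∩ A).Nonempty}

/-- For all pairs `(𝒯, 𝒯')` in `R`, the tiling `𝒯'` is locally derivable from `𝒯`, by one common
local rule: the tiles of `𝒯'` at a point `x` are determined, up to the translation by `x`, by the
tiles of `𝒯` that meet `x + C`, for a fixed compact set `C`. If `R` consists of one pair, this is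
local derivability of one tiling from another. -/
def LocallyDerivable (R : Set (Set (Set ℂ) × Set (Set ℂ))) : Prop :=
  ∃ C : Set ℂ, IsCompact C ∧ ∀ p ∈ R, ∀ p' ∈ R, ∀ x y : ℂ,
    translate (-x) (patchAt p.1 (x +ᵥ C)) = translate (-y) (patchAt p'.1 (y +ᵥ C)) →
    translate (-x) (patchAt p.2 {x}) = translate (-y) (patchAt p'.2 {y})

/-- The members of each pair in `R` are mutually locally derivable, by common local rules. -/
def MutuallyLocallyDerivable (R : Set (Set (Set ℂ) × Set (Set ℂ))) : Prop :=
  LocallyDerivable R ∧ LocallyDerivable (Prod.swap '' R)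

/-! ### The Ammann–Beenker substitution -/

/-- The two prototiles: the triangle `S` and the rhomb `L`. -/
inductive Proto
  | S
  | L

/-- `S` is the triangle with vertices `0, i, 1 + i`; `L` is the rhomb with vertices
`0, 1, 1 + ξ, ξ`. -/
def tile : Proto → Set ℂ
  | .S => convexHull ℝ {0, Complex.I, 1 + Complex.I}
  | .L => convexHull ℝ {0, 1, 1 + xi, xi}

/-- The substitution factor `λ = 1 + ξ + ξ⁻¹ = 1 + √2`. -/
def lam : K := 1 + xiK + xiK⁻¹

/-- The map `x ↦ λ⁻¹ (ξᵏ x + d)`. -/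
def rot (k : ℕ) (d : K) : SimMap := ⟨false, lam⁻¹ * xiK ^ k, lam⁻¹ * d⟩

/-- The map `x ↦ λ⁻¹ (ξᵏ conj x + d)`. -/
def ref (k : ℕ) (d : K) : SimMap := ⟨true, lam⁻¹ * xiK ^ k, lam⁻¹ * d⟩

/-- The matrix function system of the Ammann–Beenker substitution. -/
def system : MatrixSystem Proto
  | .L, .L => {rot 4 (1 + xiK), ref 1 (1 + xiK + xiK ^ 2 + xiK ^ 7), ref 7 (1 + xiK + xiK ^ 2)}
  | .S, .L => {ref 2 xiK, rot 3 (1 + 2 * xiK + xiK ^ 2 + xiK ^ 7),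
      ref 6 (2 + xiK + xiK ^ 2 + xiK ^ 7), rot 7 1}
  | .L, .S => {rot 0 (xiK + xiK ^ 2), rot 2 xiK}
  | .S, .S => {rot 5 (xiK + xiK ^ 3), ref 6 (1 + xiK + xiK ^ 2), rot 3 (2 * xiK + xiK ^ 2)}

/-- The Ammann–Beenker tilings. -/
def tilings : Set (Set (Set ℂ)) := tilingSpace system (lam : ℂ) tile

/-- The expansion factor of the star-dual substitution: the inverse of the contraction
`λ⋆ = 1 - √2` by which the star map turns the expansion by `λ`. -/
def dualFactor : ℂ := ((starMap lam : K) : ℂ)⁻¹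

/-- The pieces into which the prototiles are split: `S` by its axis of symmetry into two triangles,
and `L` by its diagonals into four triangles. -/
def pieces : Proto → Set (Set ℂ)
  | .S => {convexHull ℝ {0, Complex.I, (1 + Complex.I) / 2},
      convexHull ℝ {Complex.I, 1 + Complex.I, (1 + Complex.I) / 2}}
  | .L => {convexHull ℝ {0, 1, (1 + xi) / 2}, convexHull ℝ {1, 1 + xi, (1 + xi) / 2},
      convexHull ℝ {1 + xi, xi, (1 + xi) / 2}, convexHull ℝ {xi, 0, (1 + xi) / 2}}

/-- Split every tile of a tiling by copies of `S` and `L` into its pieces. -/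
def split (𝒯 : Set (Set ℂ)) : Set (Set ℂ) :=
  {t | ∃ j : Proto, ∃ g ∈ motions, g '' tile j ∈ 𝒯 ∧ ∃ p ∈ pieces j, t = g '' p}

/-- `P` is a dissection of `A` into `n` copies of `B`. -/
def IsDissection (A : Set ℂ) (P : Set (Set ℂ)) (n : ℕ) (B : Set ℂ) : Prop :=
  P.ncard = n ∧ (∀ p ∈ P, ∃ g ∈ motions, p = g '' B) ∧ ⋃₀ P = A ∧
    ∀ p ∈ P, ∀ p' ∈ P, p ≠ p' → Disjoint (interior p) (interior p')

/-- `A` is a right triangle whose legs have the lengths `p` and `q`. -/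
def IsRightTriangle (A : Set ℂ) (p q : ℝ) : Prop :=
  ∃ a b c : ℂ, EuclideanGeometry.angle a c b = Real.pi / 2 ∧ dist a c = p ∧ dist b c = q ∧
    A = convexHull ℝ {a, b, c}

end

end AmmannBeenker

/-!
The dual prototiles are written down as explicit right triangles, and the theorem rests on four
facts about them.

*The triangles solve the dual system.* All motions involved have coefficients in `½ ℤ[ξ]`, so
incidences and separations of the polygons are decided by exact integer arithmetic (`Cyc`, `Code`).
This shows that the copies of the prototiles lie in the inflated prototile and do not overlap
(`IsPacking`). That they cover it follows from the areas: non-overlap gives two inequalities between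
the areas of the two prototiles, and `λ²` is the Perron eigenvalue of the substitution matrix, so
both are equalities (`perron`). Uniqueness of the solution holds since the maps are contractions
(`IsTileSubstitution.isSolution_iff`).

*The dissection commutes with the substitutions.* The pieces of the children of a tile are the
children, under the dual substitution, of the pieces of the tile, up to a rotation by `π` which
comes from the sign in `(λ⋆)⁻¹ = -λ` (`substitute_splitPlaced`). As every dual prototile is a piece
of a prototile, and all pieces of each prototile occur together in the dual substitution of `S`,
dissected patches and patches of the dual substitution contain each other
(`exists_dualPatch_subset`, `exists_split_subset_dualPatch`).

*The dissection of a second order patch determines its tiles* (`patch_subset_of_split_subset`). A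
piece determines the tile that it belongs to up to one ambiguity: each half of a triangle `S` is
also a half of another copy of `S`, because its union with its mirror image in either of its legs is
a copy of `S` (`flips`). The star map excludes the wrong choice. If the tiles of a patch are
`G (T i)`, then the windows `G⋆ (dualTile i)` of all of them have a common interior point
(`exists_window`), because the dual system maps the dual tile of a parent into those of its
children. In `σ² (T j)`, however, the window of each flipped triangle is separated from the window
of some rhomb (`separated_flip`).

*Each tile of a tiling belongs to a second order patch of the tiling of bounded size*
(`exists_patch_subset_tiling`, `exists_split_patch_subset_tiling`). So the dissection is injective,
a tiling of the dual substitution is the dissection of the union of all second order patches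
whose dissections it contains, and the tile at a point is determined by the pieces within a fixed
distance, which is the local rule for reassembling the tiles.
-/

open scoped Pointwise

namespace AmmannBeenker

noncomputable section

/-! ### Exact arithmetic in `ℤ[ξ]` -/

theorem xi_eq : xi = (√2 / 2 : ℝ) * (1 + Complex.I) := by
  rw [xi, show (2 * Real.pi * Complex.I / (8 : ℕ) : ℂ) = ((Real.pi / 4 : ℝ) : ℂ) * Complex.I by
    push_cast; ring, Complex.exp_mul_I, ← Complex.ofReal_cos, ← Complex.ofReal_sin,
    Real.cos_pi_div_four, Real.sin_pi_div_four]
  push_cast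
  ring

theorem xi_sq : xi ^ 2 = Complex.I := by
  have h2 : ((√2 : ℝ) : ℂ) ^ 2 = 2 := by
    rw [← Complex.ofReal_pow, Real.sq_sqrt (by norm_num)]; norm_num
  rw [xi_eq]
  push_cast
  linear_combination ((1 + Complex.I) ^ 2 / 4) * h2 + (1 / 2 : ℂ) * Complex.I_sq

theorem xi_pow_four : xi ^ 4 = -1 := by
  rw [show 4 = 2 * 2 from rfl, pow_mul, xi_sq, Complex.I_sq]

theorem xiK_pow_four : xiK ^ 4 = -1 := by
  apply Subtype.ext
  exact xi_pow_four

@[simp] theorem coe_two : ((2 : K) : ℂ) = 2 := rfl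

theorem xiK_ne_zero : xiK ≠ 0 := xiK_primitive.ne_zero (by norm_num)

theorem norm_xi_pow (k : ℕ) : ‖xi ^ k‖ = 1 := by
  rw [norm_pow, xi_primitive.norm'_eq_one (by norm_num), one_pow]

theorem xiK_pow_mod (k : ℕ) : xiK ^ (k % 8) = xiK ^ k := by
  conv_rhs => rw [← Nat.mod_add_div k 8, pow_add, pow_mul, xiK_primitive.pow_eq_one, one_pow,
    mul_one]

theorem starMap_xiK : starMap xiK = xiK ^ 3 := galois_xiK _ _

theorem conjK_xiK : conjK xiK = xiK ^ 7 := galois_xiK _ _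

/-- An element of `ℤ[ξ]`, given by its coordinates in the basis `1, ξ, ξ², ξ³`. -/
structure Cyc where
  c0 : ℤ
  c1 : ℤ
  c2 : ℤ
  c3 : ℤ
deriving DecidableEq

namespace Cyc

instance : Zero Cyc := ⟨⟨0, 0, 0, 0⟩⟩

instance : Add Cyc := ⟨fun x y => ⟨x.c0 + y.c0, x.c1 + y.c1, x.c2 + y.c2, x.c3 + y.c3⟩⟩

instance : Sub Cyc := ⟨fun x y => ⟨x.c0 - y.c0, x.c1 - y.c1, x.c2 - y.c2, x.c3 - y.c3⟩⟩

instance : Mul Cyc := ⟨fun x y =>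
  ⟨x.c0 * y.c0 - x.c1 * y.c3 - x.c2 * y.c2 - x.c3 * y.c1,
    x.c0 * y.c1 + x.c1 * y.c0 - x.c2 * y.c3 - x.c3 * y.c2,
    x.c0 * y.c2 + x.c1 * y.c1 + x.c2 * y.c0 - x.c3 * y.c3,
    x.c0 * y.c3 + x.c1 * y.c2 + x.c2 * y.c1 + x.c3 * y.c0⟩⟩

/-- Multiplication by `ξ ^ k`. -/
def rot (k : ℕ) (x : Cyc) : Cyc := (fun y : Cyc => ⟨-y.c3, y.c0, y.c1, y.c2⟩)^[k] x

/-- Complex conjugation `ξ ↦ ξ⁻¹`. -/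
def conj (x : Cyc) : Cyc := ⟨x.c0, -x.c3, -x.c2, -x.c1⟩

/-- The star map `ξ ↦ ξ³`. -/
def star (x : Cyc) : Cyc := ⟨x.c0, x.c3, -x.c2, x.c1⟩

/-- Multiplication by `λ = 1 + ξ - ξ³`. -/
def lamMul (x : Cyc) : Cyc := ⟨1, 1, 0, -1⟩ * x

/-- The element of `ℚ(ξ)` with the given coordinates. -/
def toK (x : Cyc) : K := x.c0 + x.c1 * xiK + x.c2 * xiK ^ 2 + x.c3 * xiK ^ 3

@[simp] theorem toK_zero : toK 0 = 0 := by
  change ((0 : ℤ) : K) + (0 : ℤ) * xiK + (0 : ℤ) * xiK ^ 2 + (0 : ℤ) * xiK ^ 3 = 0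
  simp

theorem toK_add (x y : Cyc) : toK (x + y) = toK x + toK y := by
  change ((x.c0 + y.c0 : ℤ) : K) + (x.c1 + y.c1 : ℤ) * xiK + (x.c2 + y.c2 : ℤ) * xiK ^ 2
    + (x.c3 + y.c3 : ℤ) * xiK ^ 3 = _
  simp only [toK]
  push_cast
  ring

theorem toK_sub (x y : Cyc) : toK (x - y) = toK x - toK y := by
  change ((x.c0 - y.c0 : ℤ) : K) + (x.c1 - y.c1 : ℤ) * xiK + (x.c2 - y.c2 : ℤ) * xiK ^ 2
    + (x.c3 - y.c3 : ℤ) * xiK ^ 3 = _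
  simp only [toK]
  push_cast
  ring

theorem toK_mul (x y : Cyc) : toK (x * y) = toK x * toK y := by
  change ((x.c0 * y.c0 - x.c1 * y.c3 - x.c2 * y.c2 - x.c3 * y.c1 : ℤ) : K)
    + (x.c0 * y.c1 + x.c1 * y.c0 - x.c2 * y.c3 - x.c3 * y.c2 : ℤ) * xiK
    + (x.c0 * y.c2 + x.c1 * y.c1 + x.c2 * y.c0 - x.c3 * y.c3 : ℤ) * xiK ^ 2
    + (x.c0 * y.c3 + x.c1 * y.c2 + x.c2 * y.c1 + x.c3 * y.c0 : ℤ) * xiK ^ 3 = _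
  simp only [toK]
  push_cast
  linear_combination (-(x.c1 * y.c3 + x.c2 * y.c2 + x.c3 * y.c1 : K)
    - (x.c2 * y.c3 + x.c3 * y.c2 : K) * xiK - (x.c3 * y.c3 : K) * xiK ^ 2) * xiK_pow_four

theorem toK_rot (k : ℕ) (x : Cyc) : toK (rot k x) = xiK ^ k * toK x := by
  induction k with
  | zero => simp [rot]
  | succ k ih =>
    have h : rot (k + 1) x = ⟨-(rot k x).c3, (rot k x).c0, (rot k x).c1, (rot k x).c2⟩ :=
      Function.iterate_succ_apply' _ _ _
    rw [h, pow_succ', mul_assoc, ← ih]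
    simp only [toK]
    push_cast
    linear_combination (-((rot k x).c3 : K)) * xiK_pow_four

theorem conjK_toK (x : Cyc) : conjK (toK x) = toK x.conj := by
  simp only [toK, conj, map_add, map_mul, map_pow, map_intCast, conjK_xiK]
  push_cast
  linear_combination ((x.c1 : K) * xiK ^ 3 + x.c2 * xiK ^ 2 * (xiK ^ 8 - xiK ^ 4 + 1)
    + x.c3 * xiK * (xiK ^ 16 - xiK ^ 12 + xiK ^ 8 - xiK ^ 4 + 1)) * xiK_pow_four

theorem starMap_toK (x : Cyc) : starMap (toK x) = toK x.star := by
  simp only [toK, star, map_add, map_mul, map_pow, map_intCast, starMap_xiK]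
  push_cast
  linear_combination ((x.c2 : K) * xiK ^ 2 + x.c3 * xiK * (xiK ^ 4 - 1)) * xiK_pow_four

theorem lam_eq : lam = toK ⟨1, 1, 0, -1⟩ := by
  have h : xiK⁻¹ = -xiK ^ 3 := by
    refine inv_eq_of_mul_eq_one_right ?_
    linear_combination -xiK_pow_four
  simp only [lam, h, toK]
  push_cast
  ring

theorem toK_lamMul (x : Cyc) : toK (lamMul x) = lam * toK x := by
  rw [lamMul, toK_mul, lam_eq]

theorem starMap_lam_mul_lam : starMap lam * lam = -1 := by
  rw [lam_eq, starMap_toK, ← toK_mul]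
  change toK ⟨-1, 0, 0, 0⟩ = -1
  simp [toK]

theorem lam_ne_zero : lam ≠ 0 := fun h => by
  have := starMap_lam_mul_lam
  rw [h] at this
  simp at this

theorem starMap_lam : starMap lam = -lam⁻¹ := by
  rw [eq_neg_iff_add_eq_zero, ← mul_left_inj' lam_ne_zero, add_mul, starMap_lam_mul_lam,
    inv_mul_cancel₀ lam_ne_zero]
  simp

theorem conjK_lam : conjK lam = lam := by
  rw [lam_eq, conjK_toK]
  rfl

/-- The complex number `x`. -/
def toC (x : Cyc) : ℂ := (toK x : ℂ)

theorem toC_eq (x : Cyc) : toC x = x.c0 + x.c1 * xi + x.c2 * xi ^ 2 + x.c3 * xi ^ 3 := by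
  simp [toC, toK, xiK]

theorem toC_re (x : Cyc) : (toC x).re = x.c0 + (x.c1 - x.c3) * (√2 / 2) := by
  rw [toC_eq, show xi ^ 3 = xi ^ 2 * xi by ring, xi_sq, xi_eq]
  simp
  ring

theorem toC_im (x : Cyc) : (toC x).im = x.c2 + (x.c1 + x.c3) * (√2 / 2) := by
  rw [toC_eq, show xi ^ 3 = xi ^ 2 * xi by ring, xi_sq, xi_eq]
  simp
  ring

theorem toC_add (x y : Cyc) : toC (x + y) = toC x + toC y := by simp [toC, toK_add]

theorem toC_sub (x y : Cyc) : toC (x - y) = toC x - toC y := by simp [toC, toK_sub]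

theorem toC_mul (x y : Cyc) : toC (x * y) = toC x * toC y := by simp [toC, toK_mul]

/-- The point `x / 2` of the plane. -/
def pt (x : Cyc) : ℂ := toC x / 2

/-- A decidable form of `0 ≤ Re x`: the sign of `2 Re x = 2 c₀ + (c₁ - c₃) √2` is found by comparing
squares. -/
def ReNonneg (x : Cyc) : Prop :=
  (0 ≤ x.c0 ∧ 0 ≤ x.c1 - x.c3) ∨ (0 ≤ x.c0 ∧ (x.c1 - x.c3) ^ 2 ≤ 2 * x.c0 ^ 2) ∨
    (0 ≤ x.c1 - x.c3 ∧ 2 * x.c0 ^ 2 ≤ (x.c1 - x.c3) ^ 2)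

instance (x : Cyc) : Decidable x.ReNonneg := by unfold ReNonneg; infer_instance

theorem ReNonneg.re_nonneg {x : Cyc} (h : x.ReNonneg) : 0 ≤ (toC x).re := by
  rw [toC_re]
  have h2 : (√2 / 2 : ℝ) ^ 2 = 1 / 2 := by
    rw [div_pow, Real.sq_sqrt (by norm_num)]; norm_num
  have hs : (0 : ℝ) ≤ √2 / 2 := by positivity
  set s : ℝ := √2 / 2
  rw [← Int.cast_sub]
  have key : ∀ p q : ℝ, 0 ≤ p → q ^ 2 ≤ p ^ 2 → 0 ≤ p + q := fun p q hp hpq => by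
    have := abs_le_of_sq_le_sq' hpq hp
    linarith [this.1]
  rcases h with ⟨h0, h1⟩ | ⟨h0, h1⟩ | ⟨h0, h1⟩
  · have h0' : (0 : ℝ) ≤ x.c0 := by exact_mod_cast h0
    have h1' : (0 : ℝ) ≤ (x.c1 - x.c3 : ℤ) := by exact_mod_cast h1
    positivity
  · have h0' : (0 : ℝ) ≤ x.c0 := by exact_mod_cast h0
    have h1' : (((x.c1 - x.c3 : ℤ) : ℝ)) ^ 2 ≤ 2 * (x.c0 : ℝ) ^ 2 := by exact_mod_cast h1
    refine key _ _ h0' ?_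
    rw [mul_pow, h2]
    linarith
  · have h0' : (0 : ℝ) ≤ (x.c1 - x.c3 : ℤ) := by exact_mod_cast h0
    have h1' : 2 * (x.c0 : ℝ) ^ 2 ≤ (((x.c1 - x.c3 : ℤ) : ℝ)) ^ 2 := by exact_mod_cast h1
    rw [add_comm]
    refine key _ _ (by positivity) ?_
    rw [mul_pow, h2]
    linarith

end Cyc

theorem lam_coe : (lam : ℂ) = ((1 + √2 : ℝ) : ℂ) := by
  have h : (lam : ℂ) = Cyc.toC ⟨1, 1, 0, -1⟩ := by rw [Cyc.toC, ← Cyc.lam_eq]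
  rw [h]
  apply Complex.ext
  · rw [Cyc.toC_re]; simp; ring
  · rw [Cyc.toC_im]; simp

theorem dualFactor_eq : dualFactor = -(lam : ℂ) := by
  rw [dualFactor, Cyc.starMap_lam]
  simp

/-! ### Composition of similarities and the star map -/

namespace SimMap

/-- The composition of two similarities. -/
def comp (f g : SimMap) : SimMap :=
  ⟨f.refl ^^ g.refl, f.lin * (if f.refl then conjK g.lin else g.lin),
    f.lin * (if f.refl then conjK g.trans else g.trans) + f.trans⟩

theorem eval_comp (f g : SimMap) (z : ℂ) : (f.comp g).eval z = f.eval (g.eval z) := by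
  obtain ⟨r, a, b⟩ := f
  obtain ⟨r', a', b'⟩ := g
  cases r <;> cases r' <;> simp [comp, eval, coe_conjK] <;> ring

theorem starMap_conjK (x : K) : starMap (conjK x) = conjK (starMap x) := by
  have h : starMap.comp conjK = conjK.comp starMap := by
    apply (IntermediateField.algHomAdjoinIntegralEquiv ℚ xi_isIntegral).injective
    apply Subtype.ext
    change starMap (conjK xiK) = conjK (starMap xiK)
    rw [conjK_xiK, starMap_xiK, map_pow, map_pow, starMap_xiK, conjK_xiK, ← pow_mul, ← pow_mul]
  exact DFunLike.congr_fun h x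

theorem star_comp (f g : SimMap) : (f.comp g).star = f.star.comp g.star := by
  obtain ⟨r, a, b⟩ := f
  obtain ⟨r', a', b'⟩ := g
  cases r <;> simp [comp, star, starMap_conjK]

/-- A similarity is determined by its values at three points that are not collinear, so its
coefficients are determined by the map. -/
theorem eval_injective {f g : SimMap} (hf : f.lin ≠ 0) (h : f.eval = g.eval) : f = g := by
  obtain ⟨r, a, b⟩ := f
  obtain ⟨r', a', b'⟩ := g
  have h0 := congrFun h 0
  have h1 := congrFun h 1
  have hI := congrFun h Complex.I
  simp only [eval, map_zero, map_one, ite_self, mul_zero, zero_add, mul_one, Complex.conj_I]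
    at h0 h1 hI
  have hb : b = b' := Subtype.ext h0
  subst hb
  have ha : a = a' := Subtype.ext (by simpa using h1)
  subst ha
  have ha0 : (a : ℂ) ≠ 0 := fun h => hf (Subtype.ext h)
  have hne : (a : ℂ) * Complex.I ≠ 0 := mul_ne_zero ha0 Complex.I_ne_zero
  congr 1
  cases r <;> cases r'
  · rfl
  · refine absurd ?_ hne
    simp only [if_true, if_false, Bool.false_eq_true] at hI
    linear_combination hI / 2
  · refine absurd ?_ hne
    simp only [if_true, if_false, Bool.false_eq_true] at hI
    linear_combination -hI / 2
  · rfl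

/-- `f⋆` maps the image under `f♯` back. -/
theorem star_eval_sharp_eval (f : SimMap) (hf : f.lin ≠ 0) (z : ℂ) :
    f.star.eval (f.sharp.eval z) = z := by
  obtain ⟨r, a, b⟩ := f
  have h0 : starMap a ≠ 0 := by simpa using hf
  have h1 : ((starMap a : K) : ℂ) ≠ 0 := fun h => h0 (Subtype.ext h)
  have h2 : (starRingEnd ℂ) ((starMap a : K) : ℂ) ≠ 0 := by simpa using h1
  cases r
  · simp [sharp, inv, star, eval, mul_add, h1]
  · simp [sharp, inv, star, eval, mul_add, h1, starMap_conjK, coe_conjK]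

end SimMap

/-! ### Motions with coefficients in `½ ℤ[ξ]` -/

/-- The motion `z ↦ ξᵏ z + b / 2` (if `refl = false`) or `z ↦ ξᵏ conj z + b / 2` (if `refl = true`).
Translations in `½ ℤ[ξ]` are needed because the pieces of the rhomb meet in its centre. -/
structure Code where
  refl : Bool
  k : ℕ
  b : Cyc
deriving DecidableEq

namespace Code

/-- The action on points, `x ∈ ℤ[ξ]` standing for the point `x / 2`. -/
def act (c : Code) (x : Cyc) : Cyc := Cyc.rot c.k (if c.refl then x.conj else x) + c.b

/-- Composition; exponents are reduced modulo `8` to make the encoding unique. -/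
def comp (c d : Code) : Code :=
  ⟨c.refl ^^ d.refl, (c.k + (if c.refl then 7 * d.k else d.k)) % 8, c.act d.b⟩

/-- The conjugate `z ↦ λ c (λ⁻¹ z)` of a motion `c` by the homothety with factor `λ`. -/
def scale (c : Code) : Code := ⟨c.refl, c.k, c.b.lamMul⟩

/-- The star map on motions. -/
def star (c : Code) : Code := ⟨c.refl, 3 * c.k % 8, c.b.star⟩

/-- The motion `λ f♯`, where `f = λ⁻¹ c`. -/
def flat (c : Code) : Code :=
  if c.refl then ⟨true, (4 + 3 * c.k) % 8, (Cyc.rot (4 + 3 * c.k) c.b.conj.star).lamMul⟩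
  else ⟨false, (4 + 5 * c.k) % 8, (Cyc.rot (4 + 5 * c.k) c.b.star).lamMul⟩

/-- The motion as a similarity with coefficients in `ℚ(ξ)`. -/
def sim (c : Code) : SimMap := ⟨c.refl, xiK ^ c.k, c.b.toK / 2⟩

/-- The contraction `λ⁻¹ c`. -/
def child (c : Code) : SimMap := ⟨c.refl, lam⁻¹ * xiK ^ c.k, lam⁻¹ * (c.b.toK / 2)⟩

theorem sim_eval_pt (c : Code) (x : Cyc) : c.sim.eval x.pt = (c.act x).pt := by
  obtain ⟨r, k, b⟩ := c
  have hx : (starRingEnd ℂ) (Cyc.toC x) = Cyc.toC x.conj := by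
    rw [Cyc.toC, ← coe_conjK, Cyc.conjK_toK, Cyc.toC]
  have h2 : (starRingEnd ℂ) 2 = 2 := Complex.conj_ofNat 2
  have hrot : ∀ y, Cyc.toC (Cyc.rot k y) = xi ^ k * Cyc.toC y := fun y => by
    rw [Cyc.toC, Cyc.toK_rot]
    rfl
  cases r <;>
  simp [sim, SimMap.eval, Cyc.pt, act, hx, h2, Cyc.toC_add, hrot] <;>
  simp [Cyc.toC, xiK] <;> ring

theorem conjK_xiK_pow (k : ℕ) : conjK (xiK ^ k) = xiK ^ (7 * k) := by
  rw [map_pow, conjK_xiK, pow_mul]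

theorem sim_comp (c d : Code) : (c.comp d).sim = c.sim.comp d.sim := by
  obtain ⟨r, k, b⟩ := c
  obtain ⟨r', k', b'⟩ := d
  cases r <;>
  simp [sim, comp, SimMap.comp, act, xiK_pow_mod, pow_add, Cyc.toK_add, Cyc.toK_rot,
    ← Cyc.conjK_toK, conjK_xiK_pow, map_ofNat] <;> ring

theorem star_sim (c : Code) : c.sim.star = c.star.sim := by
  simp [sim, star, SimMap.star, xiK_pow_mod, pow_mul, starMap_xiK, Cyc.starMap_toK, map_ofNat]

theorem child_lin_ne_zero (c : Code) : c.child.lin ≠ 0 :=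
  mul_ne_zero (inv_ne_zero Cyc.lam_ne_zero) (pow_ne_zero _ xiK_ne_zero)

theorem child_eval (c : Code) (z : ℂ) : c.child.eval z = (lam : ℂ)⁻¹ * c.sim.eval z := by
  obtain ⟨r, k, b⟩ := c
  cases r <;> simp [child, sim, SimMap.eval] <;> ring

theorem conj_lam : (starRingEnd ℂ) (lam : ℂ) = lam := by
  rw [← coe_conjK, Cyc.conjK_lam]

theorem lam_coe_ne_zero : (lam : ℂ) ≠ 0 := fun h => Cyc.lam_ne_zero (Subtype.ext h)

/-- Substituting the contraction `λ⁻¹ d` into `λ c`. -/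
theorem scale_comp_sim_eval (c d : Code) (z : ℂ) :
    (c.scale.comp d).sim.eval z = (lam : ℂ) * c.sim.eval (d.child.eval z) := by
  rw [sim_comp, SimMap.eval_comp, child_eval]
  generalize d.sim.eval z = w
  have h := lam_coe_ne_zero
  obtain ⟨r, k, b⟩ := c
  cases r <;>
  simp [sim, scale, SimMap.eval, Cyc.toK_lamMul, conj_lam] <;> field_simp

/-- The map `f♯` for `f = λ⁻¹ c`. Since `λ⋆ = -λ⁻¹`, passing from `f` to `f♯` keeps the ratio `λ⁻¹`
and turns by `π`, which accounts for the term `4` in the exponent of `flat`. -/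
theorem sharp_child (c : Code) : c.child.sharp = c.flat.child := by
  obtain ⟨r, k, b⟩ := c
  have h3 : xiK ^ k * xiK ^ (7 * k) = 1 := by
    rw [← pow_add, show k + 7 * k = 8 * k by ring, pow_mul, xiK_primitive.pow_eq_one, one_pow]
  have hinv : (xiK ^ k)⁻¹ = xiK ^ (7 * k) := inv_eq_of_mul_eq_one_right h3
  have hst : ∀ n, starMap (xiK ^ n) = xiK ^ (3 * n) := fun n => by
    rw [map_pow, starMap_xiK, pow_mul]
  have e1 : xiK ^ (3 * (7 * k)) = xiK ^ (5 * k) := by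
    rw [← xiK_pow_mod (3 * (7 * k)), ← xiK_pow_mod (5 * k)]; congr 1; omega
  have e2 : xiK ^ (3 * (7 * (7 * k))) = xiK ^ (3 * k) := by
    rw [← xiK_pow_mod (3 * (7 * (7 * k))), ← xiK_pow_mod (3 * k)]; congr 1; omega
  have hl := Cyc.lam_ne_zero
  have hc : conjK lam⁻¹ = lam⁻¹ := by rw [map_inv₀, Cyc.conjK_lam]
  cases r
  · simp only [SimMap.sharp, SimMap.inv, SimMap.star, child, flat, Bool.false_eq_true, if_false,
      mul_inv, inv_inv, hinv, map_mul, map_neg, Cyc.starMap_lam, hst, e1, Cyc.toK_lamMul,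
      Cyc.toK_rot, xiK_pow_mod, pow_add, xiK_pow_four, map_div₀, Cyc.starMap_toK,
      map_ofNat, map_inv₀]
    congr 1
    · ring
    · field_simp
  · simp only [SimMap.sharp, SimMap.inv, SimMap.star, child, flat, if_true,
      mul_inv, inv_inv, hinv, map_mul, map_neg, Cyc.starMap_lam, hst, e2, Cyc.toK_lamMul,
      Cyc.toK_rot, xiK_pow_mod, pow_add, xiK_pow_four, map_div₀, Cyc.starMap_toK,
      map_ofNat, map_inv₀,
      conjK_xiK_pow, Cyc.conjK_lam, Cyc.conjK_toK]
    congr 1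
    · ring
    · field_simp

end Code

/-! ### Similarities of the plane -/

/-- The map `z ↦ a z + b` (if `r = false`) or `z ↦ a conj z + b` (if `r = true`). -/
def similarity (r : Bool) (a b z : ℂ) : ℂ :=
  a * (if r then (starRingEnd ℂ) z else z) + b

/-- `g` is a similarity of the plane with ratio `s`. -/
def IsSimilarity (s : ℝ) (g : ℂ → ℂ) : Prop := ∃ r a b, ‖a‖ = s ∧ g = similarity r a b

theorem SimMap.eval_eq_similarity (f : SimMap) : f.eval = similarity f.refl f.lin f.trans := rfl

theorem SimMap.isSimilarity (f : SimMap) : IsSimilarity ‖(f.lin : ℂ)‖ f.eval :=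
  ⟨_, _, _, rfl, rfl⟩

namespace IsSimilarity

variable {s s' : ℝ} {g g' : ℂ → ℂ}

theorem comp (hg : IsSimilarity s g) (hg' : IsSimilarity s' g') :
    IsSimilarity (s * s') (g ∘ g') := by
  obtain ⟨r, a, b, rfl, rfl⟩ := hg
  obtain ⟨r', a', b', rfl, rfl⟩ := hg'
  refine ⟨r ^^ r', a * (if r then (starRingEnd ℂ) a' else a'),
    a * (if r then (starRingEnd ℂ) b' else b') + b, ?_, ?_⟩
  · cases r <;> simp
  · funext z
    cases r <;> cases r' <;> simp [similarity] <;> ring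

theorem dist_map (hg : IsSimilarity s g) (x y : ℂ) : dist (g x) (g y) = s * dist x y := by
  obtain ⟨r, a, b, rfl, rfl⟩ := hg
  cases r
  · simp [similarity, dist_eq_norm, ← mul_sub]
  · simp only [similarity, dist_eq_norm, if_true, add_sub_add_right_eq_sub, ← mul_sub, norm_mul,
      ← map_sub, RCLike.norm_conj]

theorem nonneg (hg : IsSimilarity s g) : 0 ≤ s := by
  obtain ⟨r, a, b, rfl, rfl⟩ := hg
  exact norm_nonneg a

theorem exists_affineMap (hg : IsSimilarity s g) : ∃ A : ℂ →ᵃ[ℝ] ℂ, ⇑A = g := by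
  obtain ⟨r, a, b, -, rfl⟩ := hg
  let l : ℂ →ₗ[ℝ] ℂ := (LinearMap.mulLeft ℝ a).comp
    (if r then (Complex.conjAe.toLinearMap : ℂ →ₗ[ℝ] ℂ) else LinearMap.id)
  refine ⟨l.toAffineMap + AffineMap.const ℝ ℂ b, ?_⟩
  funext z
  cases r <;> simp [l, similarity]

theorem exists_homeomorph (hg : IsSimilarity s g) (hs : 0 < s) : ∃ e : ℂ ≃ₜ ℂ, ⇑e = g := by
  obtain ⟨r, a, b, rfl, rfl⟩ := hg
  have ha : a ≠ 0 := norm_pos_iff.1 hs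
  have ha' : (starRingEnd ℂ) a ≠ 0 := by simpa using ha
  cases r
  · exact ⟨⟨⟨similarity false a b, fun w => (w - b) / a, fun z => by simp [similarity, ha],
      fun w => by simp [similarity]; field_simp; ring⟩,
      (continuous_const.mul continuous_id).add continuous_const,
      by fun_prop⟩, rfl⟩
  · exact ⟨⟨⟨similarity true a b, fun w => (starRingEnd ℂ) ((w - b) / a),
      fun z => by simp [similarity, ha], fun w => by simp [similarity]; field_simp; ring⟩,
      (continuous_const.mul Complex.continuous_conj).add continuous_const,
      Complex.continuous_conj.comp (by fun_prop)⟩, rfl⟩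

theorem continuous (hg : IsSimilarity s g) : Continuous g := by
  obtain ⟨A, rfl⟩ := hg.exists_affineMap
  exact A.continuous_of_finiteDimensional

theorem injective (hg : IsSimilarity s g) (hs : 0 < s) : Function.Injective g := by
  obtain ⟨e, rfl⟩ := hg.exists_homeomorph hs
  exact e.injective

theorem image_interior (hg : IsSimilarity s g) (hs : 0 < s) (A : Set ℂ) :
    g '' interior A = interior (g '' A) := by
  obtain ⟨e, rfl⟩ := hg.exists_homeomorph hs
  exact e.image_interior A

theorem image_closure (hg : IsSimilarity s g) (hs : 0 < s) (A : Set ℂ) :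
    g '' closure A = closure (g '' A) := by
  obtain ⟨e, rfl⟩ := hg.exists_homeomorph hs
  exact e.image_closure A

theorem image_convexHull (hg : IsSimilarity s g) (A : Set ℂ) :
    g '' convexHull ℝ A = convexHull ℝ (g '' A) := by
  obtain ⟨A, rfl⟩ := hg.exists_affineMap
  exact A.image_convexHull _

/-- A similarity with ratio `s` multiplies areas by `s ^ 2`: it is a homothety after an isometry. -/
theorem volume_image (hg : IsSimilarity s g) (hs : 0 < s) (A : Set ℂ) :
    MeasureTheory.volume (g '' A) = ENNReal.ofReal (s ^ 2) * MeasureTheory.volume A := by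
  obtain ⟨r, a, b, rfl, rfl⟩ := hg
  have ha : a ≠ 0 := norm_pos_iff.1 hs
  have hu : ‖a / (‖a‖ : ℂ)‖ = 1 := by
    simp [ha]
  let u : Circle := ⟨a / (‖a‖ : ℂ), mem_sphere_zero_iff_norm.2 hu⟩
  have hu' : (u : ℂ) = a / (‖a‖ : ℂ) := rfl
  let e : ℂ ≃ₗᵢ[ℝ] ℂ :=
    (if r then Complex.conjLIE else LinearIsometryEquiv.refl ℝ ℂ).trans (rotation u)
  have he : ∀ z, similarity r a b z = b + ‖a‖ • e z := fun z => by
    have h0 : (‖a‖ : ℂ) ≠ 0 := by exact_mod_cast hs.ne'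
    cases r <;> simp [e, similarity, rotation_apply, hu'] <;> field_simp <;> ring
  have h1 : similarity r a b '' A = b +ᵥ (‖a‖ • (e '' A)) := by
    ext w
    simp only [Set.mem_image, Set.mem_vadd_set, Set.mem_smul_set, he, vadd_eq_add]
    constructor
    · rintro ⟨z, hz, rfl⟩
      exact ⟨_, ⟨_, ⟨z, hz, rfl⟩, rfl⟩, rfl⟩
    · rintro ⟨_, ⟨_, ⟨z, hz, rfl⟩, rfl⟩, rfl⟩
      exact ⟨z, hz, rfl⟩
  have h2 : MeasureTheory.volume (e '' A) = MeasureTheory.volume A := by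
    rw [LinearIsometryEquiv.image_eq_preimage_symm]
    exact e.symm.measurePreserving.measure_preimage_equiv (f := e.symm.toMeasurableEquiv) A
  rw [h1, MeasureTheory.measure_vadd, MeasureTheory.Measure.addHaar_smul, h2,
    Complex.finrank_real_complex, abs_of_nonneg (by positivity)]

end IsSimilarity

theorem isSimilarity_of_mem_motions {g : ℂ → ℂ} (hg : g ∈ motions) : IsSimilarity 1 g := by
  obtain ⟨ρ, ⟨k, rfl | rfl⟩, b, rfl⟩ := hg
  · exact ⟨false, xi ^ k, b, norm_xi_pow k, rfl⟩
  · exact ⟨true, xi ^ k, b, norm_xi_pow k, rfl⟩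

theorem mem_motions_iff {g : ℂ → ℂ} :
    g ∈ motions ↔ ∃ r k b, g = similarity r (xi ^ k) b := by
  constructor
  · rintro ⟨ρ, ⟨k, rfl | rfl⟩, b, rfl⟩
    · exact ⟨false, k, b, rfl⟩
    · exact ⟨true, k, b, rfl⟩
  · rintro ⟨r, k, b, rfl⟩
    cases r
    · exact ⟨_, ⟨k, Or.inl rfl⟩, b, rfl⟩
    · exact ⟨_, ⟨k, Or.inr rfl⟩, b, rfl⟩

theorem conj_xi_pow (k : ℕ) : (starRingEnd ℂ) (xi ^ k) = xi ^ (7 * k) := by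
  have h := coe_conjK (xiK ^ k)
  rw [Code.conjK_xiK_pow] at h
  exact h.symm

theorem comp_mem_motions {g g' : ℂ → ℂ} (hg : g ∈ motions) (hg' : g' ∈ motions) :
    g ∘ g' ∈ motions := by
  obtain ⟨r, k, b, rfl⟩ := mem_motions_iff.1 hg
  obtain ⟨r', k', b', rfl⟩ := mem_motions_iff.1 hg'
  refine mem_motions_iff.2 ⟨r ^^ r', k + (if r then 7 * k' else k'),
    xi ^ k * (if r then (starRingEnd ℂ) b' else b') + b, ?_⟩
  funext z
  cases r <;> cases r' <;>
    simp [similarity, pow_add, ← conj_xi_pow] <;> ring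

theorem Code.sim_eval_mem_motions (c : Code) : c.sim.eval ∈ motions :=
  mem_motions_iff.2 ⟨c.refl, c.k, (c.b.toK / 2 : K), by
    rw [SimMap.eval_eq_similarity]
    rfl⟩

theorem add_mem_motions (u : ℂ) {g : ℂ → ℂ} (hg : g ∈ motions) :
    (fun z => u + g z) ∈ motions := by
  obtain ⟨r, k, b, rfl⟩ := mem_motions_iff.1 hg
  exact mem_motions_iff.2 ⟨r, k, u + b, by funext z; simp only [similarity]; ring⟩

/-- Similarities that agree at three points that are not collinear are equal. -/
theorem IsSimilarity.ext {s s' : ℝ} {g g' : ℂ → ℂ} (hg : IsSimilarity s g)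
    (hg' : IsSimilarity s' g') (hs : 0 < s) {x y z : ℂ}
    (hxyz : ((y - x) * (starRingEnd ℂ) (z - x)).im ≠ 0)
    (hx : g x = g' x) (hy : g y = g' y) (hz : g z = g' z) : g = g' := by
  obtain ⟨r, a, b, rfl, rfl⟩ := hg
  obtain ⟨r', a', b', rfl, rfl⟩ := hg'
  have ha : a ≠ 0 := norm_pos_iff.1 hs
  have hyx : y - x ≠ 0 := fun h => hxyz (by simp [h])
  have hyx' : (starRingEnd ℂ) (y - x) ≠ 0 := (map_ne_zero _).2 hyx
  simp only [similarity] at hx hy hz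
  cases r <;> cases r' <;> simp only [if_true, if_false, Bool.false_eq_true] at hx hy hz
  · have h1 : a = a' := mul_right_cancel₀ hyx (by linear_combination hy - hx)
    subst h1
    rw [add_right_inj] at hx
    rw [hx]
  · exfalso
    have h1 : a * (y - x) = a' * (starRingEnd ℂ) (y - x) := by
      rw [map_sub]; linear_combination hy - hx
    have h2 : a * (z - x) = a' * (starRingEnd ℂ) (z - x) := by
      rw [map_sub]; linear_combination hz - hx
    have ha' : a' ≠ 0 := by
      rintro rfl
      simp [ha, hyx] at h1
    have h3 : (y - x) * (starRingEnd ℂ) (z - x) = (starRingEnd ℂ) (y - x) * (z - x) := by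
      refine mul_left_cancel₀ (mul_ne_zero ha ha') ?_
      linear_combination (a' * (starRingEnd ℂ) (z - x)) * h1
        - (a' * (starRingEnd ℂ) (y - x)) * h2
    apply hxyz
    rw [← Complex.conj_eq_iff_im, map_mul, Complex.conj_conj, h3]
  · exfalso
    have h1 : a * (starRingEnd ℂ) (y - x) = a' * (y - x) := by
      rw [map_sub]; linear_combination hy - hx
    have h2 : a * (starRingEnd ℂ) (z - x) = a' * (z - x) := by
      rw [map_sub]; linear_combination hz - hx
    have ha' : a' ≠ 0 := by
      rintro rfl
      rw [zero_mul] at h1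
      exact (mul_ne_zero ha hyx') h1
    have h3 : (y - x) * (starRingEnd ℂ) (z - x) = (starRingEnd ℂ) (y - x) * (z - x) := by
      refine mul_left_cancel₀ (mul_ne_zero ha ha') ?_
      linear_combination (a' * (y - x)) * h2 - (a' * (z - x)) * h1
    apply hxyz
    rw [← Complex.conj_eq_iff_im, map_mul, Complex.conj_conj, h3]
  · have h1 : a = a' := mul_right_cancel₀ hyx' (by rw [map_sub]; linear_combination hy - hx)
    subst h1
    rw [add_right_inj] at hx
    rw [hx]

/-! ### Vertices of convex polygons -/

/-- A point of `V` at which a linear functional has its strict maximum over `V` is a vertex of the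
convex hull, so it belongs to each set with the same convex hull. -/
theorem mem_of_convexHull_eq {V V' : Set ℂ} {v : ℂ} (n : ℂ) (hv : v ∈ V)
    (hmax : ∀ x ∈ V, x = v ∨ (n * x).re < (n * v).re)
    (h : convexHull ℝ V = convexHull ℝ V') : v ∈ V' := by
  by_contra hvV
  have key : ∀ a b : ℝ, ∀ x y : ℂ,
      (n * (a • x + b • y)).re = a * (n * x).re + b * (n * y).re := fun a b x y => by
    simp; ring
  have comb : ∀ a b X Y M : ℝ, 0 < a → 0 ≤ b → a + b = 1 → X < M → Y ≤ M →
      a * X + b * Y < M := fun a b X Y M ha hb hab hX hY => by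
    have h1 := mul_lt_mul_of_pos_left hX ha
    have h2 := mul_le_mul_of_nonneg_left hY hb
    have h3 : a * M + b * M = M := by rw [← add_mul, hab, one_mul]
    linarith
  have hlt : Convex ℝ {x : ℂ | (n * x).re < (n * v).re} := by
    intro x hx y hy a b ha hb hab
    simp only [Set.mem_ofPred_eq] at *
    rw [key]
    rcases ha.eq_or_lt with rfl | ha
    · have : b = 1 := by linarith
      subst this
      linarith
    · exact comb _ _ _ _ _ ha hb hab hx hy.le
  have hC : Convex ℝ {x : ℂ | x = v ∨ (n * x).re < (n * v).re} := by
    intro x hx y hy a b ha hb hab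
    rcases ha.eq_or_lt with rfl | ha
    · have : b = 1 := by linarith
      subst this
      simpa using hy
    rcases hb.eq_or_lt with rfl | hb
    · have : a = 1 := by linarith
      subst this
      simpa using hx
    simp only [Set.mem_ofPred_eq] at *
    rcases hx with rfl | hx
    · rcases hy with rfl | hy
      · left
        rw [← add_smul, hab, one_smul]
      · right
        rw [key, add_comm]
        exact comb _ _ _ _ _ hb ha.le (by linarith) hy le_rfl
    · right
      rw [key]
      rcases hy with rfl | hy
      · exact comb _ _ _ _ _ ha hb.le hab hx le_rfl
      · exact comb _ _ _ _ _ ha hb.le hab hx hy.le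
  have h1 : V' ⊆ {x : ℂ | (n * x).re < (n * v).re} := fun x hx => by
    have h2 : x ∈ convexHull ℝ V := h ▸ subset_convexHull ℝ V' hx
    rcases convexHull_min hmax hC h2 with rfl | h3
    · exact absurd hx hvV
    · exact h3
  have h4 : v ∈ convexHull ℝ V' := h ▸ subset_convexHull ℝ V hv
  exact lt_irrefl _ (Set.mem_ofPred_eq .. ▸ convexHull_min h1 hlt h4)

/-- The vertices of a right triangle are determined by the triangle, and the vertex with the right
angle is determined. -/
theorem right_triangle_vertices {a b c a' b' c' : ℂ}
    (h : ((a - c) * (starRingEnd ℂ) (b - c)).re = 0) (hac : a ≠ c) (hbc : b ≠ c)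
    (h' : ((a' - c') * (starRingEnd ℂ) (b' - c')).re = 0) (hac' : a' ≠ c') (hbc' : b' ≠ c')
    (hT : convexHull ℝ {a, b, c} = convexHull ℝ {a', b', c'}) :
    c = c' ∧ (a = a' ∧ b = b' ∨ a = b' ∧ b = a') := by
  have pos : ∀ z w : ℂ, z ≠ w → 0 < (z.re - w.re) ^ 2 + (z.im - w.im) ^ 2 := fun z w hzw => by
    have h1 : 0 < Complex.normSq (z - w) := Complex.normSq_pos.2 (sub_ne_zero.2 hzw)
    rw [Complex.normSq_apply] at h1
    simp only [Complex.sub_re, Complex.sub_im] at h1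
    nlinarith
  have pa := pos _ _ hac
  have pb := pos _ _ hbc
  have pa' := pos _ _ hac'
  have pb' := pos _ _ hbc'
  simp only [Complex.mul_re, Complex.sub_re, Complex.sub_im, Complex.conj_re, Complex.conj_im,
    map_sub] at h h'
  have hab : a ≠ b := by
    rintro rfl
    nlinarith
  have ha : a ∈ ({a', b', c'} : Set ℂ) := by
    refine mem_of_convexHull_eq ((starRingEnd ℂ) (a - c)) (by simp) ?_ hT
    rintro x (rfl | rfl | rfl)
    · exact Or.inl rfl
    · right
      simp only [Complex.mul_re, Complex.sub_re, Complex.sub_im, Complex.conj_re, Complex.conj_im]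
      nlinarith
    · right
      simp only [Complex.mul_re, Complex.sub_re, Complex.sub_im, Complex.conj_re, Complex.conj_im]
      nlinarith
  have hb : b ∈ ({a', b', c'} : Set ℂ) := by
    refine mem_of_convexHull_eq ((starRingEnd ℂ) (b - c)) (by simp) ?_ hT
    rintro x (rfl | rfl | rfl)
    · right
      simp only [Complex.mul_re, Complex.sub_re, Complex.sub_im, Complex.conj_re, Complex.conj_im]
      nlinarith
    · exact Or.inl rfl
    · right
      simp only [Complex.mul_re, Complex.sub_re, Complex.sub_im, Complex.conj_re, Complex.conj_im]
      nlinarith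
  have hc : c ∈ ({a', b', c'} : Set ℂ) := by
    refine mem_of_convexHull_eq ((starRingEnd ℂ) ((c - a) + (c - b))) (by simp) ?_ hT
    rintro x (rfl | rfl | rfl)
    · right
      simp only [Complex.mul_re, Complex.sub_re, Complex.sub_im, Complex.conj_re, Complex.conj_im,
        Complex.add_re, Complex.add_im]
      nlinarith
    · right
      simp only [Complex.mul_re, Complex.sub_re, Complex.sub_im, Complex.conj_re, Complex.conj_im,
        Complex.add_re, Complex.add_im]
      nlinarith
    · exact Or.inl rfl
  rcases hc with rfl | rfl | rfl
  · exfalso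
    rcases ha with rfl | rfl | rfl
    · exact hac rfl
    · rcases hb with rfl | rfl | rfl
      · exact hbc rfl
      · exact hab rfl
      · nlinarith
    · rcases hb with rfl | rfl | rfl
      · exact hbc rfl
      · nlinarith
      · exact hab rfl
  · exfalso
    rcases ha with rfl | rfl | rfl
    · rcases hb with rfl | rfl | rfl
      · exact hab rfl
      · exact hbc rfl
      · nlinarith
    · exact hac rfl
    · rcases hb with rfl | rfl | rfl
      · nlinarith
      · exact hbc rfl
      · exact hab rfl
  · refine ⟨rfl, ?_⟩
    rcases ha with rfl | rfl | rfl
    · rcases hb with rfl | rfl | rfl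
      · exact absurd rfl hab
      · exact Or.inl ⟨rfl, rfl⟩
      · exact absurd rfl hbc
    · rcases hb with rfl | rfl | rfl
      · exact Or.inr ⟨rfl, rfl⟩
      · exact absurd rfl hab
      · exact absurd rfl hbc
    · exact absurd rfl hac

/-! ### Polygons with vertices in `½ ℤ[ξ]` -/

/-- The convex polygon with the vertices `x / 2`, for `x` in the list. -/
def poly (V : List Cyc) : Set ℂ := convexHull ℝ (Cyc.pt '' {x | x ∈ V})

theorem convex_poly (V : List Cyc) : Convex ℝ (poly V) := convex_convexHull ℝ _

theorem isCompact_poly (V : List Cyc) : IsCompact (poly V) :=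
  ((List.finite_toSet V).image _).isCompact_convexHull ℝ

theorem pt_mem_poly {V : List Cyc} {x : Cyc} (hx : x ∈ V) : x.pt ∈ poly V :=
  subset_convexHull ℝ _ ⟨x, hx, rfl⟩

theorem poly_subset {V : List Cyc} {A : Set ℂ} (hA : Convex ℝ A) (h : ∀ x ∈ V, x.pt ∈ A) :
    poly V ⊆ A := by
  refine convexHull_min ?_ hA
  rintro _ ⟨x, hx, rfl⟩
  exact h x hx

theorem poly_triangle (x y z : Cyc) : poly [x, y, z] = convexHull ℝ {x.pt, y.pt, z.pt} := by
  rw [poly]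
  congr 1
  ext w
  simp [eq_comm]

theorem IsSimilarity.image_poly {s : ℝ} {g : ℂ → ℂ} (hg : IsSimilarity s g) {V : List Cyc}
    {f : Cyc → Cyc} (h : ∀ x, g x.pt = (f x).pt) : g '' poly V = poly (V.map f) := by
  rw [poly, hg.image_convexHull, poly, Set.image_image]
  congr 1
  ext w
  simp [h]

theorem Code.image_poly (c : Code) (V : List Cyc) :
    c.sim.eval '' poly V = poly (V.map c.act) :=
  (SimMap.isSimilarity _).image_poly c.sim_eval_pt

theorem norm_lam : ‖(lam : ℂ)‖ = 1 + √2 := by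
  rw [lam_coe, Complex.norm_real, Real.norm_of_nonneg (by positivity)]

theorem norm_lam_pos : 0 < ‖(lam : ℂ)‖ := by
  rw [norm_lam]
  positivity

theorem isSimilarity_lam : IsSimilarity ‖(lam : ℂ)‖ fun z => (lam : ℂ) * z :=
  ⟨false, lam, 0, rfl, by funext z; simp [similarity]⟩

theorem lam_image_poly (V : List Cyc) :
    (fun z => (lam : ℂ) * z) '' poly V = poly (V.map Cyc.lamMul) :=
  isSimilarity_lam.image_poly fun x => by
    simp [Cyc.pt, Cyc.toC, Cyc.toK_lamMul, mul_div_assoc]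

theorem re_mul_pt_le {n x y : Cyc} (h : (n * (y - x)).ReNonneg) :
    (n.toC * x.pt).re ≤ (n.toC * y.pt).re := by
  have h1 := h.re_nonneg
  rw [Cyc.toC_mul, Cyc.toC_sub] at h1
  have h2 : n.toC * (y.toC - x.toC) = 2 * (n.toC * y.pt - n.toC * x.pt) := by
    simp only [Cyc.pt]; ring
  rw [h2] at h1
  simp only [Complex.mul_re, Complex.re_ofNat, Complex.im_ofNat, zero_mul, sub_zero,
    Complex.sub_re] at h1
  linarith [Complex.mul_re n.toC y.pt, Complex.mul_re n.toC x.pt]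

/-- The normal directions used to separate polygons: all multiples of `π / 8`. -/
def directions : List Cyc :=
  (List.range 8).map (fun m => Cyc.rot m ⟨1, 0, 0, 0⟩) ++
    (List.range 8).map (fun m => Cyc.rot m ⟨1, 1, 0, 0⟩)

/-- The polygons with the vertices `A` and `B` lie on different sides of a line. -/
def Separated (A B : List Cyc) : Prop :=
  ∃ n ∈ directions, ∀ a ∈ A, ∀ b ∈ B, (n * (b - a)).ReNonneg

instance (A B : List Cyc) : Decidable (Separated A B) := by unfold Separated; infer_instance

theorem toC_ne_zero_of_mem_directions {n : Cyc} (hn : n ∈ directions) : n.toC ≠ 0 := by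
  have h : ∀ n ∈ directions,
      ∃ m ∈ (directions ++ (List.range 8).map fun m => Cyc.rot m ⟨1, -1, 1, -1⟩),
        n * m = ⟨2, 0, 0, 0⟩ ∨ n * m = ⟨1, 0, 0, 0⟩ := by decide +kernel
  obtain ⟨m, -, hm⟩ := h n hn
  intro h0
  have h1 : (n * m).toC = 0 := by rw [Cyc.toC_mul, h0, zero_mul]
  rcases hm with hm | hm <;> rw [hm, Cyc.toC_eq] at h1 <;> simp at h1

theorem convex_re_le (n : ℂ) (t : ℝ) : Convex ℝ {z : ℂ | (n * z).re ≤ t} := by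
  intro x hx y hy a b ha hb hab
  simp only [Set.mem_ofPred_eq] at *
  have h1 := mul_le_mul_of_nonneg_left hx ha
  have h2 := mul_le_mul_of_nonneg_left hy hb
  have h3 : a * t + b * t = t := by rw [← add_mul, hab, one_mul]
  have h4 : (n * (a • x + b • y)).re = a * (n * x).re + b * (n * y).re := by
    simp; ring
  linarith

theorem Separated.disjoint {A B : List Cyc} (h : Separated A B) :
    Disjoint (interior (poly A)) (interior (poly B)) := by
  obtain ⟨n, hn, hAB⟩ := h
  have hn0 := toC_ne_zero_of_mem_directions hn
  have key : ∀ x ∈ poly A, ∀ y ∈ poly B, (n.toC * x).re ≤ (n.toC * y).re := by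
    intro x hx y hy
    refine poly_subset (convex_re_le _ _) (fun a ha => ?_) hx
    change (n.toC * a.pt).re ≤ _
    have := poly_subset (convex_re_le (-n.toC) (-(n.toC * a.pt).re)) (fun b hb => ?_) hy
    · simp only [Set.mem_ofPred_eq, neg_mul, Complex.neg_re, neg_le_neg_iff] at this
      exact this
    · simp only [Set.mem_ofPred_eq, neg_mul, Complex.neg_re, neg_le_neg_iff]
      exact re_mul_pt_le (hAB a ha b hb)
  rw [Set.disjoint_left]
  intro z hzA hzB
  have hU : interior (poly A) ∩ interior (poly B) ∈ nhds z :=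
    Filter.inter_mem (isOpen_interior.mem_nhds hzA) (isOpen_interior.mem_nhds hzB)
  have hc : Filter.Tendsto (fun t : ℝ => z + t * (starRingEnd ℂ) n.toC)
      (nhdsWithin 0 (Set.Ioi 0)) (nhds z) := by
    have : Continuous (fun t : ℝ => z + t * (starRingEnd ℂ) n.toC) := by fun_prop
    have h0 := this.tendsto 0
    simp only [Complex.ofReal_zero, zero_mul, add_zero] at h0
    exact h0.mono_left nhdsWithin_le_nhds
  obtain ⟨t, ht, ht0⟩ := ((hc.eventually hU).and self_mem_nhdsWithin).exists
  have h1 := key _ (interior_subset ht.1) z (interior_subset hzB)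
  have h2 : n.toC * (z + t * (starRingEnd ℂ) n.toC) =
      n.toC * z + ((t * Complex.normSq n.toC : ℝ) : ℂ) := by
    rw [Complex.ofReal_mul, ← Complex.mul_conj]; ring
  rw [h2, Complex.add_re, Complex.ofReal_re] at h1
  have h3 : 0 < t * Complex.normSq n.toC := mul_pos ht0 (Complex.normSq_pos.2 hn0)
  linarith

/-- Four times the signed area of the parallelogram spanned by `u / 2` and `v / 2`, as the real part
of an element of `ℤ[ξ]`. -/
def cross (u v : Cyc) : Cyc := Cyc.rot 6 (u.conj * v)

theorem toC_conj (x : Cyc) : x.conj.toC = (starRingEnd ℂ) x.toC := by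
  rw [Cyc.toC, ← Cyc.conjK_toK, coe_conjK, Cyc.toC]

theorem cross_re (u v : Cyc) :
    (cross u v).toC.re = u.toC.re * v.toC.im - u.toC.im * v.toC.re := by
  have h : (cross u v).toC = -Complex.I * ((starRingEnd ℂ) u.toC * v.toC) := by
    rw [← toC_conj, ← Cyc.toC_mul, cross, Cyc.toC, Cyc.toK_rot, Cyc.toC, ← xi_sq]
    have : xi ^ 6 = -xi ^ 2 := by linear_combination xi ^ 2 * xi_pow_four
    simp [xiK, this]
  rw [h]
  simp
  ring

/-- A decidable form of membership in a triangle `[a, b, c]` with positive orientation. -/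
def InTriangle (a b c x : Cyc) : Prop :=
  (cross (b - a) (c - a) - ⟨1, 0, 0, 0⟩).ReNonneg ∧ (cross (b - a) (x - a)).ReNonneg ∧
    (cross (c - b) (x - b)).ReNonneg ∧ (cross (a - c) (x - c)).ReNonneg

instance (a b c x : Cyc) : Decidable (InTriangle a b c x) := by
  unfold InTriangle; infer_instance

theorem combination_mem_triangle (x y z : ℂ) (p r s : ℝ) (hp : 0 ≤ p) (hr : 0 ≤ r)
    (hs : 0 ≤ s) (hsum : p + r + s = 1) :
    (p * x + r * y + s * z : ℂ) ∈ convexHull ℝ ({x, y, z} : Set ℂ) := by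
  have e : (p * x + r * y + s * z : ℂ) = ∑ i : Fin 3, (![p, r, s] i) • (![x, y, z] i) := by
    simp [Fin.sum_univ_three]
  rw [e]
  refine (convex_convexHull ℝ _).sum_mem ?_ ?_ ?_
  · intro i _
    fin_cases i <;> simpa
  · simpa [Fin.sum_univ_three] using hsum
  · intro i _
    apply subset_convexHull
    fin_cases i <;> simp

/-- A point of a triangle in barycentric coordinates. -/
theorem mem_triangle {a b c x : ℂ}
    (h : 0 < (b.re - a.re) * (c.im - a.im) - (b.im - a.im) * (c.re - a.re))
    (h1 : 0 ≤ (b.re - a.re) * (x.im - a.im) - (b.im - a.im) * (x.re - a.re))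
    (h2 : 0 ≤ (c.re - b.re) * (x.im - b.im) - (c.im - b.im) * (x.re - b.re))
    (h3 : 0 ≤ (a.re - c.re) * (x.im - c.im) - (a.im - c.im) * (x.re - c.re)) :
    x ∈ convexHull ℝ {a, b, c} := by
  set d := (b.re - a.re) * (c.im - a.im) - (b.im - a.im) * (c.re - a.re) with hd
  set p1 := (b.re - a.re) * (x.im - a.im) - (b.im - a.im) * (x.re - a.re) with hp1
  set p2 := (c.re - b.re) * (x.im - b.im) - (c.im - b.im) * (x.re - b.re) with hp2
  set p3 := (a.re - c.re) * (x.im - c.im) - (a.im - c.im) * (x.re - c.re) with hp3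
  have hx : x = ((p2 / d : ℝ) : ℂ) * a + (p3 / d : ℝ) * b + (p1 / d : ℝ) * c := by
    apply Complex.ext <;>
      simp only [Complex.add_re, Complex.add_im, Complex.re_ofReal_mul, Complex.im_ofReal_mul] <;>
      field_simp <;> rw [hd, hp1, hp2, hp3] <;> ring
  rw [hx]
  refine combination_mem_triangle a b c _ _ _ (by positivity) (by positivity) (by positivity) ?_
  field_simp
  rw [hd, hp1, hp2, hp3]
  ring

theorem InTriangle.mem {a b c x : Cyc} (h : InTriangle a b c x) : x.pt ∈ poly [a, b, c] := by
  obtain ⟨h0, h1, h2, h3⟩ := h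
  have h0 := h0.re_nonneg
  have h1 := h1.re_nonneg
  have h2 := h2.re_nonneg
  have h3 := h3.re_nonneg
  have e : (⟨1, 0, 0, 0⟩ : Cyc).toC = 1 := by simp [Cyc.toC_eq]
  rw [Cyc.toC_sub, e, Complex.sub_re, Complex.one_re] at h0
  rw [cross_re] at h0 h1 h2 h3
  simp only [Cyc.toC_sub, Complex.sub_re, Complex.sub_im] at h0 h1 h2 h3
  rw [poly_triangle]
  have hr : ∀ y : Cyc, y.pt.re = y.toC.re / 2 := fun y => by simp [Cyc.pt]
  have hi : ∀ y : Cyc, y.pt.im = y.toC.im / 2 := fun y => by simp [Cyc.pt]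
  apply mem_triangle <;> simp only [hr, hi] <;> nlinarith

theorem interior_triangle_nonempty {a b c : ℂ}
    (h : 0 < (b.re - a.re) * (c.im - a.im) - (b.im - a.im) * (c.re - a.re)) :
    (interior (convexHull ℝ {a, b, c})).Nonempty := by
  refine ⟨(a + b + c) / 3, ?_⟩
  rw [mem_interior]
  refine ⟨{x | 0 < (b.re - a.re) * (x.im - a.im) - (b.im - a.im) * (x.re - a.re)} ∩
    ({x | 0 < (c.re - b.re) * (x.im - b.im) - (c.im - b.im) * (x.re - b.re)} ∩
    {x | 0 < (a.re - c.re) * (x.im - c.im) - (a.im - c.im) * (x.re - c.re)}),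
    fun x hx => mem_triangle h (le_of_lt hx.1) (le_of_lt hx.2.1) (le_of_lt hx.2.2), ?_, ?_⟩
  · refine (isOpen_lt continuous_const ?_).inter
      ((isOpen_lt continuous_const ?_).inter (isOpen_lt continuous_const ?_)) <;> fun_prop
  · have hr : ((a + b + c) / 3).re = (a.re + b.re + c.re) / 3 := by simp
    have hi : ((a + b + c) / 3).im = (a.im + b.im + c.im) / 3 := by simp
    refine ⟨?_, ?_, ?_⟩ <;> simp only [Set.mem_ofPred_eq, hr, hi] <;> nlinarith

/-- The triangles with apex `a` over the edges of the path with the given vertices. -/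
def fan (a : Cyc) : List Cyc → List (Cyc × Cyc)
  | b :: c :: l => (b, c) :: fan a (c :: l)
  | _ => []

theorem mem_of_mem_fan {a b c : Cyc} : ∀ {l : List Cyc}, (b, c) ∈ fan a l → b ∈ l ∧ c ∈ l
  | [], h => by simp [fan] at h
  | [_], h => by simp [fan] at h
  | b' :: c' :: l, h => by
    rw [fan, List.mem_cons] at h
    rcases h with h | h
    · obtain ⟨rfl, rfl⟩ := Prod.mk.inj h
      simp
    · have := mem_of_mem_fan h
      exact ⟨List.mem_cons_of_mem _ this.1, List.mem_cons_of_mem _ this.2⟩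

/-- A decidable sufficient condition for membership in a polygon: `x` is in a triangle of the fan
with apex the first vertex. -/
def InPoly (V : List Cyc) (x : Cyc) : Prop :=
  ∃ a ∈ V.head?, ∃ t ∈ fan a V, InTriangle a t.1 t.2 x

instance (V : List Cyc) (x : Cyc) : Decidable (InPoly V x) :=
  match V with
  | [] => isFalse (by rintro ⟨a, ha, -⟩; simp at ha)
  | a :: l =>
    if h : ∃ t ∈ fan a (a :: l), InTriangle a t.1 t.2 x then isTrue ⟨a, by simp, h⟩
    else isFalse (by
      rintro ⟨b, hb, h'⟩
      simp only [List.head?_cons, Option.mem_def, Option.some.injEq] at hb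
      exact h (hb ▸ h'))

theorem InPoly.mem {V : List Cyc} {x : Cyc} (h : InPoly V x) : x.pt ∈ poly V := by
  obtain ⟨a, ha, ⟨b, c⟩, ht, h⟩ := h
  have := mem_of_mem_fan ht
  refine poly_subset (convex_poly V) (fun y hy => pt_mem_poly ?_) h.mem
  simp only [List.mem_cons, List.not_mem_nil, or_false] at hy
  rcases hy with rfl | rfl | rfl
  · exact List.mem_of_mem_head? ha
  · exact this.1
  · exact this.2

/-! ### Dissections and area -/

open MeasureTheory

theorem aedisjoint_of_disjoint_interior {A B : Set ℂ} (hA : Convex ℝ A) (hB : Convex ℝ B)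
    (h : Disjoint (interior A) (interior B)) : AEDisjoint volume A B := by
  have hfr : volume (frontier A ∪ frontier B) = 0 :=
    measure_union_null (hA.addHaar_frontier _) (hB.addHaar_frontier _)
  refine measure_mono_null (fun z hz => ?_) hfr
  by_contra hz'
  rw [Set.mem_union, not_or] at hz'
  have h1 : ∀ {C : Set ℂ}, z ∈ C → z ∉ frontier C → z ∈ interior C := fun {C} hC hf => by
    by_contra hi
    exact hf ⟨subset_closure hC, hi⟩
  exact Set.disjoint_left.1 h (h1 hz.1 hz'.1) (h1 hz.2 hz'.2)

theorem volume_iUnion_eq_sum {n : ℕ} {A : Fin n → Set ℂ} (hA : ∀ k, Convex ℝ (A k))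
    (hd : ∀ k l, k ≠ l → Disjoint (interior (A k)) (interior (A l))) :
    volume (⋃ k, A k) = ∑ k, volume (A k) := by
  rw [measure_iUnion₀ (fun k l hkl => aedisjoint_of_disjoint_interior (hA k) (hA l) (hd k l hkl))
    (fun k => (hA k).nullMeasurableSet _), tsum_fintype]

/-- Compact sets that do not overlap cover a set that contains them and has no larger area. -/
theorem iUnion_eq_of_volume_le {n : ℕ} {A : Fin n → Set ℂ} {B : Set ℂ}
    (hA : ∀ k, Convex ℝ (A k)) (hAc : ∀ k, IsCompact (A k))
    (hd : ∀ k l, k ≠ l → Disjoint (interior (A k)) (interior (A l)))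
    (hsub : ∀ k, A k ⊆ B) (hB : closure (interior B) = B) (hBf : volume B ≠ ⊤)
    (hvol : volume B ≤ ∑ k, volume (A k)) : ⋃ k, A k = B := by
  refine subset_antisymm (Set.iUnion_subset hsub) ?_
  have hcl : IsClosed (⋃ k, A k) := isClosed_iUnion_of_finite fun k => (hAc k).isClosed
  have hopen : IsOpen (interior B \ ⋃ k, A k) := isOpen_interior.sdiff hcl
  have hzero : volume (interior B \ ⋃ k, A k) = 0 := by
    have h1 : volume (B \ ⋃ k, A k) = volume B - volume (⋃ k, A k) :=
      measure_sdiff (Set.iUnion_subset hsub) hcl.measurableSet.nullMeasurableSet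
        (ne_top_of_le_ne_top hBf (measure_mono (Set.iUnion_subset hsub)))
    rw [volume_iUnion_eq_sum hA hd, tsub_eq_zero_of_le hvol] at h1
    exact measure_mono_null (Set.sdiff_subset_sdiff_left interior_subset) h1
  have hempty := (hopen.measure_eq_zero_iff volume).1 hzero
  rw [← hB]
  exact closure_minimal (Set.sdiff_eq_empty.1 hempty) hcl

/-! ### Substitutions given by lists of motions -/

/-- The tiles of the dissection of `λ T j`, for each `j`: the entry `(i, c)` stands for the tile
`c (T i)`. -/
abbrev ChildList : Type := Proto → List (Proto × Code)

/-- The matrix function system `F` consists of the contractions `λ⁻¹ c` for the motions `c` in the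
list `ch`. -/
def Encodes (ch : ChildList) (F : MatrixSystem Proto) : Prop :=
  ∀ i j, F i j = {f | ∃ c, (i, c) ∈ ch j ∧ f = c.child}

/-- Decidable conditions on the vertices that imply that the tiles in the list do not overlap and
lie in `λ T j`. -/
structure IsPacking (ch : ChildList) (V : Proto → List Cyc) : Prop where
  subset : ∀ j, ∀ t ∈ ch j, ∀ v ∈ V t.1, InPoly ((V j).map Cyc.lamMul) (t.2.act v)
  separated : ∀ j, (ch j).Pairwise fun t t' =>
    Separated ((V t.1).map t.2.act) ((V t'.1).map t'.2.act)

/-- The area of a polygon. -/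
def area (V : List Cyc) : ℝ := (volume (poly V)).toReal

theorem area_nonneg (V : List Cyc) : 0 ≤ area V := ENNReal.toReal_nonneg

theorem ofReal_area (V : List Cyc) : ENNReal.ofReal (area V) = volume (poly V) :=
  ENNReal.ofReal_toReal (isCompact_poly V).measure_lt_top.ne

theorem volume_lam_image (V : List Cyc) :
    volume (poly (V.map Cyc.lamMul)) = ENNReal.ofReal (‖(lam : ℂ)‖ ^ 2 * area V) := by
  rw [← lam_image_poly, isSimilarity_lam.volume_image norm_lam_pos,
    ENNReal.ofReal_mul (by positivity), ofReal_area]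

theorem Code.isSimilarity (c : Code) : IsSimilarity 1 c.sim.eval :=
  isSimilarity_of_mem_motions c.sim_eval_mem_motions

theorem volume_code_image (c : Code) (V : List Cyc) :
    volume (poly (V.map c.act)) = ENNReal.ofReal (area V) := by
  rw [← c.image_poly, c.isSimilarity.volume_image one_pos, ofReal_area]
  simp

namespace IsPacking

variable {ch : ChildList} {V : Proto → List Cyc}

/-- The `k`-th tile of the dissection of `λ T j`. -/
def childTile (ch : ChildList) (V : Proto → List Cyc) (j : Proto) (k : Fin (ch j).length) :
    Set ℂ :=
  poly ((V (ch j)[k].1).map (ch j)[k].2.act)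

theorem disjoint (h : IsPacking ch V) (j : Proto) (k l : Fin (ch j).length) (hkl : k ≠ l) :
    Disjoint (interior (childTile ch V j k)) (interior (childTile ch V j l)) := by
  have hp := List.pairwise_iff_getElem.1 (h.separated j)
  rcases lt_or_gt_of_ne (fun e => hkl (Fin.ext e) : (k : ℕ) ≠ l) with hlt | hlt
  · exact (hp _ _ k.2 l.2 hlt).disjoint
  · exact (hp _ _ l.2 k.2 hlt).disjoint.symm

theorem childTile_subset (h : IsPacking ch V) (j : Proto) (k : Fin (ch j).length) :
    childTile ch V j k ⊆ poly ((V j).map Cyc.lamMul) := by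
  refine poly_subset (convex_poly _) fun x hx => ?_
  obtain ⟨v, hv, rfl⟩ := List.mem_map.1 hx
  exact (h.subset j _ (List.getElem_mem k.2) v hv).mem

theorem sum_volume (j : Proto) :
    ∑ k, volume (childTile ch V j k) =
      ENNReal.ofReal ((ch j).map fun t => area (V t.1)).sum := by
  have h1 : ∀ k : Fin (ch j).length, volume (childTile ch V j k) =
      ENNReal.ofReal (area (V (ch j)[(k : ℕ)].1)) := fun k => volume_code_image _ _
  have h2 := Fin.sum_univ_fun_getElem (ch j) fun t => area (V t.1)
  rw [← h2, ENNReal.ofReal_sum_of_nonneg fun k _ => area_nonneg _]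
  exact Finset.sum_congr rfl fun k _ => h1 k

theorem sum_area_le (h : IsPacking ch V) (j : Proto) :
    ((ch j).map fun t => area (V t.1)).sum ≤ ‖(lam : ℂ)‖ ^ 2 * area (V j) := by
  have h1 : volume (⋃ k, childTile ch V j k) ≤ volume (poly ((V j).map Cyc.lamMul)) :=
    measure_mono (Set.iUnion_subset (h.childTile_subset j))
  rw [volume_iUnion_eq_sum (A := childTile ch V j) (fun k => convex_poly _) (h.disjoint j),
    sum_volume, volume_lam_image] at h1
  exact (ENNReal.ofReal_le_ofReal_iff (mul_nonneg (by positivity) (area_nonneg _))).1 h1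

theorem closure_interior_poly {W : List Cyc} (h : (interior (poly W)).Nonempty) :
    closure (interior (poly W)) = poly W := by
  rw [(convex_poly W).closure_interior_eq_closure_of_nonempty_interior h,
    (isCompact_poly W).isClosed.closure_eq]

theorem iUnion_eq (h : IsPacking ch V) (j : Proto) (hint : (interior (poly (V j))).Nonempty)
    (hsum : ‖(lam : ℂ)‖ ^ 2 * area (V j) ≤ ((ch j).map fun t => area (V t.1)).sum) :
    ⋃ k, childTile ch V j k = poly ((V j).map Cyc.lamMul) := by
  refine iUnion_eq_of_volume_le (fun k => convex_poly _) (fun k => isCompact_poly _)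
    (h.disjoint j) (h.childTile_subset j) ?_ (isCompact_poly _).measure_lt_top.ne ?_
  · rw [← lam_image_poly, ← isSimilarity_lam.image_interior norm_lam_pos,
      ← isSimilarity_lam.image_closure norm_lam_pos, closure_interior_poly hint]
  · rw [sum_volume, volume_lam_image]
    exact ENNReal.ofReal_le_ofReal hsum

end IsPacking

theorem Code.child_eval_image (c : Code) (A : Set ℂ) :
    c.child.eval '' A = (fun z => (lam : ℂ)⁻¹ * z) '' (c.sim.eval '' A) := by
  rw [Set.image_image]
  exact Set.image_congr fun z _ => c.child_eval z

theorem isSimilarity_lam_inv : IsSimilarity ‖(lam : ℂ)‖⁻¹ fun z => (lam : ℂ)⁻¹ * z :=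
  ⟨false, (lam : ℂ)⁻¹, 0, norm_inv _, by funext z; simp [similarity]⟩

/-- If the packing is as dense as the areas permit, the list describes a tile-substitution. -/
theorem IsPacking.isTileSubstitution {ch : ChildList} {V : Proto → List Cyc}
    {F : MatrixSystem Proto} {q : ℂ} (h : IsPacking ch V) (hF : Encodes ch F)
    (hq : q = lam ∨ q = -lam) (hint : ∀ j, (interior (poly (V j))).Nonempty)
    (hsum : ∀ j, ‖(lam : ℂ)‖ ^ 2 * area (V j) ≤ ((ch j).map fun t => area (V t.1)).sum) :
    IsTileSubstitution F q fun j => poly (V j) := by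
  have hqn : ‖q‖ = ‖(lam : ℂ)‖ := by rcases hq with rfl | rfl <;> simp
  have hl0 := Code.lam_coe_ne_zero
  have hinv : ∀ A : Set ℂ, (fun z => (lam : ℂ)⁻¹ * z) '' ((fun z => (lam : ℂ) * z) '' A) = A :=
    fun A => by rw [Set.image_image]; simp [hl0]
  have hchild : ∀ j (k : Fin (ch j).length),
      (ch j)[k].2.child.eval '' poly (V (ch j)[k].1) =
        (fun z => (lam : ℂ)⁻¹ * z) '' childTile ch V j k := fun j k => by
    rw [Code.child_eval_image, Code.image_poly, childTile]
  refine ⟨?_, ?_, ?_, ⟨fun j => ⟨isCompact_poly _, (hint j).mono interior_subset⟩, fun j => ?_⟩,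
    fun j => closure_interior_poly (hint j), ?_⟩
  · rw [hqn, norm_lam]
    have : (0 : ℝ) < √2 := by positivity
    linarith
  · intro i j
    rw [hF]
    refine ((List.finite_toSet (ch j)).image fun t => t.2.child).subset ?_
    rintro f ⟨c, hc, rfl⟩
    exact ⟨(i, c), hc, rfl⟩
  · intro i j f hf
    rw [hF] at hf
    obtain ⟨c, -, rfl⟩ := hf
    have : ((c.child.lin : K) : ℂ) = (lam : ℂ)⁻¹ * xi ^ c.k := rfl
    rw [norm_mul, this, norm_mul, norm_inv, norm_xi_pow, hqn, mul_one,
      mul_inv_cancel₀ norm_lam_pos.ne']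
  · have h1 := h.iUnion_eq j (hint j) (hsum j)
    rw [← lam_image_poly] at h1
    have h2 := congrArg (fun A => (fun z => (lam : ℂ)⁻¹ * z) '' A) h1
    simp only [hinv, Set.image_iUnion] at h2
    change poly (V j) = _
    rw [← h2]
    ext z
    simp only [Set.mem_iUnion, ← hchild]
    constructor
    · rintro ⟨k, hk⟩
      exact ⟨_, _, hF _ _ ▸ ⟨_, List.getElem_mem k.2, rfl⟩, hk⟩
    · rintro ⟨i, f, hf, hz⟩
      rw [hF] at hf
      obtain ⟨c, hc, rfl⟩ := hf
      obtain ⟨n, hn, hnc⟩ := List.getElem_of_mem hc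
      refine ⟨⟨n, hn⟩, ?_⟩
      change z ∈ (ch j)[n].2.child.eval '' poly (V (ch j)[n].1)
      rw [hnc]
      exact hz
  · intro j i i' f f' hf hf' hne
    rw [hF] at hf hf'
    obtain ⟨c, hc, rfl⟩ := hf
    obtain ⟨c', hc', rfl⟩ := hf'
    obtain ⟨n, hn, hnc⟩ := List.getElem_of_mem hc
    obtain ⟨n', hn', hnc'⟩ := List.getElem_of_mem hc'
    have hd := h.disjoint j ⟨n, hn⟩ ⟨n', hn'⟩ (fun e => hne (by
      have e' : n = n' := congrArg Fin.val e
      subst e'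
      rw [hnc] at hnc'
      obtain ⟨rfl, rfl⟩ := Prod.mk.inj hnc'
      rfl))
    have e1 := hchild j ⟨n, hn⟩
    have e2 := hchild j ⟨n', hn'⟩
    change (ch j)[n].2.child.eval '' poly (V (ch j)[n].1) = _ at e1
    change (ch j)[n'].2.child.eval '' poly (V (ch j)[n'].1) = _ at e2
    rw [hnc] at e1
    rw [hnc'] at e2
    rw [e1, e2]
    have hp : 0 < ‖(lam : ℂ)‖⁻¹ := inv_pos.2 norm_lam_pos
    rw [← isSimilarity_lam_inv.image_interior hp, ← isSimilarity_lam_inv.image_interior hp,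
      Set.disjoint_image_iff (isSimilarity_lam_inv.injective hp)]
    exact hd

/-! ### The Ammann–Beenker substitution and its star-dual -/

instance : DecidableEq Proto := fun a b =>
  match a, b with
  | .S, .S => isTrue rfl
  | .L, .L => isTrue rfl
  | .S, .L => isFalse (by simp)
  | .L, .S => isFalse (by simp)

theorem forall_proto {p : Proto → Prop} : (∀ j, p j) ↔ p .S ∧ p .L :=
  ⟨fun h => ⟨h _, h _⟩, fun h j => by cases j; exacts [h.1, h.2]⟩

instance {p : Proto → Prop} [DecidablePred p] : Decidable (∀ j, p j) :=
  decidable_of_iff _ forall_proto.symm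

/-- The vertices of `S` and `L`, in positive orientation. -/
def corners : Proto → List Cyc
  | .S => [⟨0, 0, 0, 0⟩, ⟨2, 0, 2, 0⟩, ⟨0, 0, 2, 0⟩]
  | .L => [⟨0, 0, 0, 0⟩, ⟨2, 0, 0, 0⟩, ⟨2, 2, 0, 0⟩, ⟨0, 2, 0, 0⟩]

/-- The vertices of the prototiles of the star-dual substitution, in positive orientation; the last
vertex is the right angle. -/
def dualCorners : Proto → List Cyc
  | .S => [⟨1, -1, -1, -1⟩, ⟨1, 1, -1, -1⟩, ⟨1, 0, -1, 0⟩]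
  | .L => [⟨1, 1, -1, 1⟩, ⟨1, 1, 1, 1⟩, ⟨1, 0, 0, 1⟩]

/-- The prototiles of the star-dual substitution. -/
def dualTile (j : Proto) : Set ℂ := poly (dualCorners j)

/-- The maps `gᵢ` of the Ammann–Beenker substitution. -/
def children : ChildList
  | .L => [(.L, ⟨false, 4, ⟨2, 2, 0, 0⟩⟩), (.L, ⟨true, 1, ⟨2, 2, 2, -2⟩⟩),
      (.L, ⟨true, 7, ⟨2, 2, 2, 0⟩⟩), (.S, ⟨true, 2, ⟨0, 2, 0, 0⟩⟩),
      (.S, ⟨false, 3, ⟨2, 4, 2, -2⟩⟩), (.S, ⟨true, 6, ⟨4, 2, 2, -2⟩⟩),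
      (.S, ⟨false, 7, ⟨2, 0, 0, 0⟩⟩)]
  | .S => [(.L, ⟨false, 0, ⟨0, 2, 2, 0⟩⟩), (.L, ⟨false, 2, ⟨0, 2, 0, 0⟩⟩),
      (.S, ⟨false, 5, ⟨0, 2, 0, 2⟩⟩), (.S, ⟨true, 6, ⟨2, 2, 2, 0⟩⟩),
      (.S, ⟨false, 3, ⟨0, 4, 2, 0⟩⟩)]

/-- The list for the star-dual of the system given by `ch`: the motions `λ f♯`. -/
def dualList (ch : ChildList) : ChildList := fun j =>
  [Proto.S, Proto.L].flatMap fun i =>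
    ((ch i).filter fun t => t.1 = j).map fun t => (i, t.2.flat)

/-- If a system consists of contractions by motions with coefficients in `½ ℤ[ξ]`, so does its
star-dual. -/
theorem encodes_dualList {ch : ChildList} {F : MatrixSystem Proto} (h : Encodes ch F) :
    Encodes (dualList ch) F.starDual := by
  intro i j
  have h1 : F.starDual i j = SimMap.sharp '' F j i := rfl
  rw [h1, h]
  ext f
  have hi : ∀ i : Proto, i = .S ∨ i = .L := by intro i; cases i <;> simp
  constructor
  · rintro ⟨f, ⟨c, hc, rfl⟩, rfl⟩
    refine ⟨c.flat, ?_, c.sharp_child⟩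
    simp only [dualList, List.mem_flatMap, List.mem_map, List.mem_filter, decide_eq_true_eq]
    exact ⟨i, by simpa using hi i, (j, c), ⟨hc, rfl⟩, rfl⟩
  · rintro ⟨c, hc, rfl⟩
    simp only [dualList, List.mem_flatMap, List.mem_map, List.mem_filter, decide_eq_true_eq] at hc
    obtain ⟨i', -, ⟨j', d⟩, ⟨hd, rfl⟩, e⟩ := hc
    obtain ⟨rfl, rfl⟩ := Prod.mk.inj e
    exact ⟨d.child, ⟨d, hd, rfl⟩, d.sharp_child⟩

theorem rot_eq_child {k : ℕ} {d : K} {b : Cyc} (h : b.toK = 2 * d) :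
    rot k d = Code.child ⟨false, k, b⟩ := by
  simp [rot, Code.child, h]

theorem ref_eq_child {k : ℕ} {d : K} {b : Cyc} (h : b.toK = 2 * d) :
    ref k d = Code.child ⟨true, k, b⟩ := by
  simp [ref, Code.child, h]

theorem encodes_children : Encodes children system := by
  have h7 : xiK ^ 7 = -xiK ^ 3 := by linear_combination xiK ^ 3 * xiK_pow_four
  intro i j
  have key : ∀ (A : Set SimMap) (l : List (Proto × Code)),
      A = {f | f ∈ (l.filter fun t => t.1 = i).map fun t => t.2.child} →
      A = {f | ∃ c, (i, c) ∈ l ∧ f = c.child} := by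
    rintro A l rfl
    ext f
    simp only [Set.mem_ofPred_eq, List.mem_map, List.mem_filter, decide_eq_true_eq]
    constructor
    · rintro ⟨⟨i', c⟩, ⟨hc, rfl⟩, rfl⟩
      exact ⟨c, hc, rfl⟩
    · rintro ⟨c, hc, rfl⟩
      exact ⟨(i, c), ⟨hc, rfl⟩, rfl⟩
  apply key
  cases i <;> cases j
  · rw [system, rot_eq_child (b := ⟨0, 2, 0, 2⟩) (by simp [Cyc.toK]; ring),
      ref_eq_child (b := ⟨2, 2, 2, 0⟩) (by simp [Cyc.toK]; ring),
      rot_eq_child (b := ⟨0, 4, 2, 0⟩) (by simp [Cyc.toK]; ring)]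
    ext f
    simp [children]
  · rw [system, ref_eq_child (b := ⟨0, 2, 0, 0⟩) (by simp [Cyc.toK]),
      rot_eq_child (b := ⟨2, 4, 2, -2⟩) (by simp [Cyc.toK, h7]; ring),
      ref_eq_child (b := ⟨4, 2, 2, -2⟩) (by simp [Cyc.toK, h7]; ring),
      rot_eq_child (b := ⟨2, 0, 0, 0⟩) (by simp [Cyc.toK])]
    ext f
    simp [children]
  · rw [system, rot_eq_child (b := ⟨0, 2, 2, 0⟩) (by simp [Cyc.toK]; ring),
      rot_eq_child (b := ⟨0, 2, 0, 0⟩) (by simp [Cyc.toK])]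
    ext f
    simp [children]
  · rw [system, rot_eq_child (b := ⟨2, 2, 0, 0⟩) (by simp [Cyc.toK]; ring),
      ref_eq_child (b := ⟨2, 2, 2, -2⟩) (by simp [Cyc.toK, h7]; ring),
      ref_eq_child (b := ⟨2, 2, 2, 0⟩) (by simp [Cyc.toK]; ring)]
    ext f
    simp [children]

theorem isPacking_children : IsPacking children corners :=
  ⟨by decide +kernel, by decide +kernel⟩

theorem isPacking_dualList : IsPacking (dualList children) dualCorners :=
  ⟨by decide +kernel, by decide +kernel⟩

theorem pt_eq (a b c d : ℤ) : Cyc.pt ⟨a, b, c, d⟩ =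
    ⟨(a + (b - d) * (√2 / 2)) / 2, (c + (b + d) * (√2 / 2)) / 2⟩ := by
  apply Complex.ext
  · simp [Cyc.pt, Cyc.toC_re]
  · simp [Cyc.pt, Cyc.toC_im]

theorem xi_eq_mk : xi = ⟨√2 / 2, √2 / 2⟩ := by
  rw [xi_eq]
  apply Complex.ext <;> simp

theorem tile_eq (j : Proto) : tile j = poly (corners j) := by
  cases j
  · rw [poly, tile]
    congr 1
    ext z
    simp only [corners, List.mem_cons, List.not_mem_nil, or_false, Set.mem_image,
      Set.mem_ofPred_eq, exists_eq_or_imp, exists_eq_left, pt_eq, Set.mem_insert_iff,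
      Set.mem_singleton_iff]
    have h0 : (0 : ℂ) = ⟨0, 0⟩ := rfl
    have h1 : Complex.I = ⟨0, 1⟩ := rfl
    have h2 : 1 + Complex.I = ⟨1, 1⟩ := by apply Complex.ext <;> simp
    rw [h2, h0, h1]
    norm_num
    grind
  · rw [poly, tile]
    congr 1
    ext z
    simp only [corners, List.mem_cons, List.not_mem_nil, or_false, Set.mem_image,
      Set.mem_ofPred_eq, exists_eq_or_imp, exists_eq_left, pt_eq, Set.mem_insert_iff,
      Set.mem_singleton_iff]
    have h0 : (0 : ℂ) = ⟨0, 0⟩ := rfl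
    have h1 : (1 : ℂ) = ⟨1, 0⟩ := rfl
    have h2 : 1 + xi = ⟨1 + √2 / 2, √2 / 2⟩ := by
      rw [xi_eq_mk]; apply Complex.ext <;> simp
    have e1 : (2 + 2 * (√2 / 2)) / 2 = 1 + √2 / 2 := by ring
    have e2 : (2 * (√2 / 2)) / 2 = √2 / 2 := by ring
    rw [h2, h0, h1, xi_eq_mk]
    norm_num [e1, e2]
    grind

theorem interior_corners_nonempty (j : Proto) : (interior (poly (corners j))).Nonempty := by
  cases j
  · rw [corners, poly_triangle]
    apply interior_triangle_nonempty
    simp only [pt_eq]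
    norm_num
  · refine (?_ : (interior (poly [⟨0, 0, 0, 0⟩, ⟨2, 0, 0, 0⟩, ⟨2, 2, 0, 0⟩])).Nonempty).mono
      (interior_mono (poly_subset (convex_poly _) fun x hx => pt_mem_poly ?_))
    · rw [poly_triangle]
      apply interior_triangle_nonempty
      simp only [pt_eq]
      norm_num
    · simp only [corners, List.mem_cons, List.not_mem_nil, or_false] at hx ⊢
      tauto

theorem interior_dualCorners_nonempty (j : Proto) :
    (interior (poly (dualCorners j))).Nonempty := by
  cases j
  · rw [dualCorners, poly_triangle]
    apply interior_triangle_nonempty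
    simp only [pt_eq]
    norm_num
    have : (√2 : ℝ) * √2 = 2 := Real.mul_self_sqrt (by norm_num)
    nlinarith
  · rw [dualCorners, poly_triangle]
    apply interior_triangle_nonempty
    simp only [pt_eq]
    have : (√2 : ℝ) * √2 = 2 := Real.mul_self_sqrt (by norm_num)
    have : (0 : ℝ) < √2 := by positivity
    norm_num
    nlinarith

theorem norm_lam_sq : ‖(lam : ℂ)‖ ^ 2 = 3 + 2 * √2 := by
  rw [norm_lam]
  have : (√2 : ℝ) ^ 2 = 2 := Real.sq_sqrt (by norm_num)
  linear_combination this

/-- The factor `λ²` is the Perron eigenvalue of the substitution matrix, so the two inequalities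
are equalities. -/
theorem perron {a b : ℝ} (h1 : 2 * b + 3 * a ≤ (3 + 2 * √2) * a)
    (h2 : 3 * b + 4 * a ≤ (3 + 2 * √2) * b) :
    (3 + 2 * √2) * a ≤ 2 * b + 3 * a ∧ (3 + 2 * √2) * b ≤ 3 * b + 4 * a := by
  have hr : (√2 : ℝ) * √2 = 2 := Real.mul_self_sqrt (by norm_num)
  have h3 : √2 * (2 * a) ≤ √2 * (√2 * b) :=
    mul_le_mul_of_nonneg_left (by linarith) (Real.sqrt_nonneg 2)
  rw [← mul_assoc √2 √2, hr] at h3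
  have hb : b = √2 * a := by linarith
  subst hb
  have h4 : (3 + 2 * √2) * (√2 * a) = 3 * (√2 * a) + 4 * a := by linear_combination 2 * a * hr
  constructor <;> linarith

theorem isTileSubstitution_system : IsTileSubstitution system (lam : ℂ) tile := by
  have hS := isPacking_children.sum_area_le .S
  have hL := isPacking_children.sum_area_le .L
  have e : tile = fun j => poly (corners j) := funext tile_eq
  rw [e]
  refine isPacking_children.isTileSubstitution encodes_children (Or.inl rfl)
    interior_corners_nonempty ?_
  rw [norm_lam_sq] at *
  simp only [children, List.map_cons, List.map_nil, List.sum_cons, List.sum_nil] at hS hL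
  have h := perron (a := area (corners .S)) (b := area (corners .L)) (by linarith) (by linarith)
  rintro (_ | _) <;>
    simp only [children, List.map_cons, List.map_nil, List.sum_cons, List.sum_nil] <;>
    linarith [h.1, h.2]

theorem isTileSubstitution_starDual :
    IsTileSubstitution system.starDual dualFactor dualTile := by
  have hS := isPacking_dualList.sum_area_le .S
  have hL := isPacking_dualList.sum_area_le .L
  refine isPacking_dualList.isTileSubstitution (encodes_dualList encodes_children)
    (Or.inr dualFactor_eq) interior_dualCorners_nonempty ?_
  rw [norm_lam_sq] at *
  have eS : ∀ m : Proto → ℝ, ((dualList children .S).map fun t => m t.1).sum =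
      m .S + (m .S + (m .S + (m .L + (m .L + (m .L + (m .L + 0)))))) := fun m => rfl
  have eL : ∀ m : Proto → ℝ, ((dualList children .L).map fun t => m t.1).sum =
      m .S + (m .S + (m .L + (m .L + (m .L + 0)))) := fun m => rfl
  rw [eS fun i => area (dualCorners i)] at hS
  rw [eL fun i => area (dualCorners i)] at hL
  have h := perron (a := area (dualCorners .L)) (b := area (dualCorners .S)) (by linarith)
    (by linarith)
  rintro (_ | _)
  · rw [eS fun i => area (dualCorners i)]
    linarith [h.2]
  · rw [eL fun i => area (dualCorners i)]
    linarith [h.1]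

/-! ### Uniqueness of the solution of an iterated function system -/

/-- The distance of a point of `T j` from `T' j` is at most `r` times such a distance for some other
point, so it is zero. -/
theorem IsSolution.subset {ι : Type} [Finite ι] {F : MatrixSystem ι} {r : ℝ} (hr : r < 1)
    (hF : ∀ i j, ∀ f ∈ F i j, ‖(f.lin : ℂ)‖ = r) {T T' : ι → Set ℂ} (hT : IsSolution F T)
    (hT' : IsSolution F T') (j : ι) : T j ⊆ T' j := by
  obtain ⟨C, hC⟩ : ∃ C : ℝ, ∀ j, ∀ x ∈ T j, Metric.infDist x (T' j) ≤ C := by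
    have h1 : ∀ j, ∃ C : ℝ, ∀ x ∈ T j, Metric.infDist x (T' j) ≤ C := fun j => by
      obtain ⟨C, hC⟩ := ((hT.1 j).1.image (Metric.continuous_infDist_pt (T' j))).bddAbove
      exact ⟨C, fun x hx => hC ⟨x, hx, rfl⟩⟩
    choose C hC using h1
    obtain ⟨M, hM⟩ := Set.Finite.bddAbove (Set.finite_range C)
    exact ⟨M, fun j x hx => (hC j x hx).trans (hM ⟨j, rfl⟩)⟩
  have key : ∀ n : ℕ, ∀ j, ∀ x ∈ T j, Metric.infDist x (T' j) ≤ r ^ n * C := by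
    intro n
    induction n with
    | zero => simpa using hC
    | succ n ih =>
      intro j x hx
      rw [hT.2 j] at hx
      simp only [Set.mem_iUnion] at hx
      obtain ⟨i, f, hf, y, hy, rfl⟩ := hx
      obtain ⟨y', hy', hyy⟩ := (hT'.1 i).1.exists_infDist_eq_dist (hT'.1 i).2 y
      have h1 : f.eval y' ∈ T' j := by
        rw [hT'.2 j]
        simp only [Set.mem_iUnion]
        exact ⟨i, f, hf, y', hy', rfl⟩
      calc Metric.infDist (f.eval y) (T' j) ≤ dist (f.eval y) (f.eval y') :=
            Metric.infDist_le_dist_of_mem h1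
        _ = r * dist y y' := by rw [f.isSimilarity.dist_map, hF i j f hf]
        _ ≤ r * (r ^ n * C) := by
            rw [← hyy]
            exact mul_le_mul_of_nonneg_left (ih i y hy) (hF i j f hf ▸ norm_nonneg _)
        _ = r ^ (n + 1) * C := by ring
  intro x hx
  rcases lt_or_ge r 0 with hr0 | hr0
  · rw [hT.2 j] at hx
    simp only [Set.mem_iUnion] at hx
    obtain ⟨i, f, hf, -⟩ := hx
    exact absurd (hF i j f hf ▸ norm_nonneg _) (not_le.2 hr0)
  · have h1 : Filter.Tendsto (fun n : ℕ => r ^ n * C) Filter.atTop (nhds 0) := by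
      simpa using (tendsto_pow_atTop_nhds_zero_of_lt_one hr0 hr).mul_const C
    have h2 : Metric.infDist x (T' j) ≤ 0 := ge_of_tendsto' h1 fun n => key n j x hx
    have h3 : Metric.infDist x (T' j) = 0 := le_antisymm h2 Metric.infDist_nonneg
    rwa [← (hT'.1 j).1.isClosed.mem_iff_infDist_zero (hT'.1 j).2] at h3

/-- The prototiles of a tile-substitution are the only solution of its function system. -/
theorem IsTileSubstitution.isSolution_iff {ι : Type} [Finite ι] {F : MatrixSystem ι} {q : ℂ}
    {T : ι → Set ℂ} (h : IsTileSubstitution F q T) (T' : ι → Set ℂ) :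
    IsSolution F T' ↔ T' = T := by
  constructor
  · intro hT'
    have hF : ∀ i j, ∀ f ∈ F i j, ‖(f.lin : ℂ)‖ = ‖q‖⁻¹ := fun i j f hf => by
      have := h.isometric i j f hf
      rw [norm_mul] at this
      exact eq_inv_of_mul_eq_one_right this
    have hr := inv_lt_one_of_one_lt₀ h.expanding
    exact funext fun j => subset_antisymm (hT'.subset hr hF h.solution j)
      (h.solution.subset hr hF hT' j)
  · rintro rfl
    exact h.solution

instance : Finite Proto :=
  Finite.of_surjective (fun b : Bool => if b then Proto.S else Proto.L) fun j => by
    cases j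
    · exact ⟨true, rfl⟩
    · exact ⟨false, rfl⟩

/-! ### The shape of the dual prototiles -/

theorem isRightTriangle_of {a b c : ℂ} {p q : ℝ} (hp : 0 ≤ p) (hq : 0 ≤ q)
    (h : (a.re - c.re) * (b.re - c.re) + (a.im - c.im) * (b.im - c.im) = 0)
    (ha : (a.re - c.re) ^ 2 + (a.im - c.im) ^ 2 = p ^ 2)
    (hb : (b.re - c.re) ^ 2 + (b.im - c.im) ^ 2 = q ^ 2) :
    IsRightTriangle (convexHull ℝ {a, b, c}) p q := by
  refine ⟨a, b, c, ?_, ?_, ?_, rfl⟩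
  · rw [EuclideanGeometry.angle, ← InnerProductGeometry.inner_eq_zero_iff_angle_eq_pi_div_two]
    simp only [vsub_eq_sub, Complex.inner, Complex.mul_re, Complex.conj_re, Complex.conj_im,
      Complex.sub_re, Complex.sub_im]
    linarith
  · rw [Complex.dist_eq_re_im, ha, Real.sqrt_sq hp]
  · rw [Complex.dist_eq_re_im, hb, Real.sqrt_sq hq]

theorem isRightTriangle_dualTile_S : IsRightTriangle (dualTile .S) (√2 / 2) (√2 / 2) := by
  rw [dualTile, dualCorners, poly_triangle]
  have h2 : (√2 : ℝ) ^ 2 = 2 := Real.sq_sqrt (by norm_num)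
  apply isRightTriangle_of (by positivity) (by positivity) <;> simp only [pt_eq] <;>
    push_cast <;> ring_nf

theorem isRightTriangle_dualTile_L :
    IsRightTriangle (dualTile .L) (Real.cos (Real.pi / 8)) (Real.sin (Real.pi / 8)) := by
  have h2 : (√2 : ℝ) ^ 2 = 2 := Real.sq_sqrt (by norm_num)
  have hc : Real.cos (Real.pi / 8) ^ 2 = (2 + √2) / 4 := by
    rw [Real.cos_pi_div_eight, div_pow, Real.sq_sqrt (by positivity)]
    norm_num
  have hs : Real.sin (Real.pi / 8) ^ 2 = (2 - √2) / 4 := by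
    rw [Real.sin_sq, hc]; ring
  have hs2 : √2 ≤ 2 := by nlinarith [Real.sqrt_nonneg 2]
  have e : ({Cyc.pt ⟨1, 1, -1, 1⟩, Cyc.pt ⟨1, 1, 1, 1⟩, Cyc.pt ⟨1, 0, 0, 1⟩} : Set ℂ) =
      {Cyc.pt ⟨1, 1, 1, 1⟩, Cyc.pt ⟨1, 1, -1, 1⟩, Cyc.pt ⟨1, 0, 0, 1⟩} := Set.insert_comm _ _ _
  rw [dualTile, dualCorners, poly_triangle, e]
  have hpi := Real.pi_pos
  refine isRightTriangle_of (Real.cos_nonneg_of_neg_pi_div_two_le_of_le (by linarith)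
    (by linarith)) (Real.sin_nonneg_of_nonneg_of_le_pi (by linarith) (by linarith)) ?_ ?_ ?_ <;>
    (try rw [hc]) <;> (try rw [hs]) <;> simp only [pt_eq] <;> push_cast <;> ring_nf <;>
    rw [h2] <;> ring

/-! ### Patches of a substitution -/

theorem exists_inverse_mem_motions {g : ℂ → ℂ} (hg : g ∈ motions) :
    ∃ h ∈ motions, (∀ z, g (h z) = z) ∧ ∀ z, h (g z) = z := by
  obtain ⟨r, k, b, rfl⟩ := mem_motions_iff.1 hg
  have h8 : xi ^ k * xi ^ (7 * k) = 1 := by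
    rw [← pow_add, show k + 7 * k = 8 * k by ring, pow_mul, xi_primitive.pow_eq_one, one_pow]
  cases r
  · refine ⟨similarity false (xi ^ (7 * k)) (-(xi ^ (7 * k) * b)), mem_motions_iff.2 ⟨_, _, _, rfl⟩,
      fun z => ?_, fun z => ?_⟩ <;> simp only [similarity, Bool.false_eq_true, if_false]
    · linear_combination (z - b) * h8
    · linear_combination z * h8
  · have hc : (starRingEnd ℂ) (xi ^ k) = xi ^ (7 * k) := conj_xi_pow k
    have hc' : (starRingEnd ℂ) (xi ^ (7 * k)) = xi ^ k := by rw [← hc, Complex.conj_conj]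
    refine ⟨similarity true (xi ^ k) (-(xi ^ k * (starRingEnd ℂ) b)),
      mem_motions_iff.2 ⟨_, _, _, rfl⟩, fun z => ?_, fun z => ?_⟩ <;>
      simp only [similarity, if_true, map_add, map_neg, map_mul, Complex.conj_conj, hc]
    · linear_combination (z - b) * h8
    · linear_combination z * h8

/-- Conjugating a motion by a homothety gives a motion. -/
theorem conj_homothety_mem_motions {g : ℂ → ℂ} (hg : g ∈ motions) {a : ℂ} (ha : a ≠ 0)
    (ha' : (starRingEnd ℂ) a = a) : (fun z => a⁻¹ * g (a * z)) ∈ motions := by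
  obtain ⟨r, k, b, rfl⟩ := mem_motions_iff.1 hg
  refine mem_motions_iff.2 ⟨r, k, a⁻¹ * b, ?_⟩
  funext z
  cases r <;> simp [similarity, ha'] <;> field_simp

section generic

variable {ι : Type} {F : MatrixSystem ι} {q : ℂ} {T : ι → Set ℂ}

theorem substitute_mono {P P' : Set (PlacedTile ι)} (h : P ⊆ P') :
    substitute F q P ⊆ substitute F q P' := fun _ ⟨s, hs, hf⟩ => ⟨s, h hs, hf⟩

theorem substitute_iterate_mono (k : ℕ) {P P' : Set (PlacedTile ι)} (h : P ⊆ P') :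
    (substitute F q)^[k] P ⊆ (substitute F q)^[k] P' := by
  induction k with
  | zero => exact h
  | succ k ih =>
    rw [Function.iterate_succ_apply', Function.iterate_succ_apply']
    exact substitute_mono ih

theorem mem_substitute_iterate {k : ℕ} {P : Set (PlacedTile ι)} {t : PlacedTile ι} :
    t ∈ (substitute F q)^[k] P ↔ ∃ s ∈ P, t ∈ (substitute F q)^[k] {s} := by
  induction k generalizing t with
  | zero => simp
  | succ k ih =>
    simp only [Function.iterate_succ_apply']
    constructor
    · rintro ⟨s, hs, hf⟩
      obtain ⟨s', hs', h⟩ := ih.1 hs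
      exact ⟨s', hs', s, h, hf⟩
    · rintro ⟨s', hs', s, h, hf⟩
      exact ⟨s, ih.2 ⟨s', hs', h⟩, hf⟩

/-- The images of placed tiles under a map of the plane. -/
def post (h : ℂ → ℂ) (P : Set (PlacedTile ι)) : Set (PlacedTile ι) :=
  (fun t => (t.1, fun z => h (t.2 z))) '' P

theorem substitute_post {h h' : ℂ → ℂ} (hq : ∀ z, q * h z = h' (q * z))
    (P : Set (PlacedTile ι)) :
    substitute F q (post h P) = post h' (substitute F q P) := by
  ext ⟨i, g⟩
  constructor
  · rintro ⟨_, ⟨s, hs, rfl⟩, f, hf, hg⟩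
    refine ⟨(i, fun z => q * s.2 (f.eval z)), ⟨s, hs, f, hf, rfl⟩, ?_⟩
    change g = _ at hg
    rw [hg]
    simp only [hq]
  · rintro ⟨_, ⟨s, hs, f, hf, hg⟩, e⟩
    obtain ⟨rfl, rfl⟩ := Prod.mk.inj e
    refine ⟨_, ⟨s, hs, rfl⟩, f, hf, ?_⟩
    simp only [hg, hq]

theorem substitute_iterate_post {h : ℂ → ℂ} (hq : ∀ z, q * h z = h (q * z)) (k : ℕ)
    (P : Set (PlacedTile ι)) :
    (substitute F q)^[k] (post h P) = post h ((substitute F q)^[k] P) := by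
  induction k with
  | zero => rfl
  | succ k ih =>
    rw [Function.iterate_succ_apply', Function.iterate_succ_apply', ih, substitute_post hq]

theorem substitute_iterate_add (k : ℕ) (b : ℂ) (P : Set (PlacedTile ι)) :
    (substitute F q)^[k] (post (fun z => z + b) P) =
      post (fun z => z + q ^ k * b) ((substitute F q)^[k] P) := by
  induction k with
  | zero => simp
  | succ k ih =>
    rw [Function.iterate_succ_apply', Function.iterate_succ_apply', ih,
      substitute_post (h' := fun z => z + q ^ (k + 1) * b) (fun z => by ring)]

/-- The sets of points that placed tiles occupy. -/
def tiles (T : ι → Set ℂ) (P : Set (PlacedTile ι)) : Set (Set ℂ) :=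
  (fun t : PlacedTile ι => t.2 '' T t.1) '' P

theorem tiles_mono {P P' : Set (PlacedTile ι)} (h : P ⊆ P') : tiles T P ⊆ tiles T P' :=
  Set.image_mono h

theorem tiles_post (h : ℂ → ℂ) (P : Set (PlacedTile ι)) :
    tiles T (post h P) = (fun A => h '' A) '' tiles T P := by
  simp only [tiles, post, Set.image_image]

/-- The patch `σᵏ (g (T j))` for a motion `g`. -/
def patch (F : MatrixSystem ι) (q : ℂ) (T : ι → Set ℂ) (k : ℕ) (j : ι) (g : ℂ → ℂ) :
    Set (Set ℂ) :=
  tiles T ((substitute F q)^[k] {(j, g)})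

theorem translate_superPatch (k : ℕ) (j : ι) (ρ : ℂ → ℂ) (v : ℂ) (hq : q ≠ 0) :
    translate v (superPatch F q T k j ρ) = patch F q T k j (fun z => ρ z + (q ^ k)⁻¹ * v) := by
  have h1 : ({(j, fun z => ρ z + (q ^ k)⁻¹ * v)} : Set (PlacedTile ι)) =
      post (fun z => z + (q ^ k)⁻¹ * v) {(j, ρ)} := by
    simp [post]
  rw [patch, h1, substitute_iterate_add, tiles_post, mul_inv_cancel_left₀ (pow_ne_zero k hq),
    translate, superPatch, tiles]
  refine Set.image_congr fun A _ => ?_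
  ext z
  constructor <;> rintro ⟨y, hy, rfl⟩ <;> exact ⟨y, hy, add_comm _ _⟩

/-- Translates of patches `σᵏ (ρ (T j))` are the patches `σᵏ (g (T j))` for motions `g`. -/
theorem exists_superPatch_iff (P : Set (Set ℂ)) (hq : q ≠ 0) :
    (∃ (k : ℕ) (j : ι), ∃ ρ ∈ orientations, ∃ v : ℂ, P ⊆ translate v (superPatch F q T k j ρ)) ↔
      ∃ (k : ℕ) (j : ι), ∃ g ∈ motions, P ⊆ patch F q T k j g := by
  constructor
  · rintro ⟨k, j, ρ, hρ, v, h⟩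
    rw [translate_superPatch k j ρ v hq] at h
    exact ⟨k, j, _, ⟨ρ, hρ, _, rfl⟩, h⟩
  · rintro ⟨k, j, _, ⟨ρ, hρ, b, rfl⟩, h⟩
    refine ⟨k, j, ρ, hρ, q ^ k * b, ?_⟩
    rwa [translate_superPatch k j ρ _ hq, inv_mul_cancel_left₀ (pow_ne_zero k hq)]

theorem translate_patch (k : ℕ) (j : ι) (g : ℂ → ℂ) (v : ℂ) (hq : q ≠ 0) :
    translate v (patch F q T k j g) = patch F q T k j (fun z => g z + (q ^ k)⁻¹ * v) :=
  translate_superPatch k j g v hq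

/-- All tiles are placed by isometries, and different tiles do not overlap. -/
def IsPlacement (T : ι → Set ℂ) (P : Set (PlacedTile ι)) : Prop :=
  (∀ t ∈ P, IsSimilarity 1 t.2) ∧ ∀ t ∈ P, ∀ t' ∈ P, t ≠ t' →
    Disjoint (interior (t.2 '' T t.1)) (interior (t'.2 '' T t'.1))

theorem child_isSimilarity (h : IsTileSubstitution F q T) {i j : ι} {f : SimMap}
    (hf : f ∈ F i j) {g : ℂ → ℂ} (hg : IsSimilarity 1 g) :
    IsSimilarity 1 fun z => q * g (f.eval z) := by
  have h1 := h.isometric i j f hf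
  have hq : IsSimilarity ‖q‖ fun z => q * z :=
    ⟨false, q, 0, rfl, by funext z; simp [similarity]⟩
  have h2 := (hq.comp hg).comp f.isSimilarity
  rwa [mul_one, ← norm_mul, h1] at h2

theorem child_image_subset (h : IsTileSubstitution F q T) {i j : ι} {f : SimMap}
    (hf : f ∈ F i j) (g : ℂ → ℂ) :
    (fun z => q * g (f.eval z)) '' T i ⊆ (fun z => q * g z) '' T j := by
  rintro _ ⟨z, hz, rfl⟩
  refine ⟨f.eval z, ?_, rfl⟩
  rw [h.solution.2 j]
  simp only [Set.mem_iUnion]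
  exact ⟨i, f, hf, z, hz, rfl⟩

theorem isPlacement_substitute (h : IsTileSubstitution F q T) {P : Set (PlacedTile ι)}
    (hP : IsPlacement T P) : IsPlacement T (substitute F q P) := by
  refine ⟨?_, ?_⟩
  · rintro ⟨i, g⟩ ⟨s, hs, f, hf, hg⟩
    change g = _ at hg
    subst hg
    exact child_isSimilarity h hf (hP.1 s hs)
  · rintro ⟨i, g⟩ ⟨s, hs, f, hf, hg⟩ ⟨i', g'⟩ ⟨s', hs', f', hf', hg'⟩ hne
    change g = _ at hg
    change g' = _ at hg'
    have hq0 : 0 < ‖q‖ := one_pos.trans h.expanding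
    have hq : IsSimilarity ‖q‖ fun z => q * z :=
      ⟨false, q, 0, rfl, by funext z; simp [similarity]⟩
    by_cases hss : s = s'
    · subst hss
      have hif : (i, f) ≠ (i', f') := by
        intro e
        obtain ⟨rfl, rfl⟩ := Prod.mk.inj e
        exact hne (by rw [hg, hg'])
      have h1 := h.nonoverlapping _ i i' f f' hf hf' hif
      have hsim : IsSimilarity (‖q‖ * 1) fun z => q * s.2 z := hq.comp (hP.1 s hs)
      rw [mul_one] at hsim
      have e : ∀ (i : ι) (f : SimMap), (fun z => q * s.2 (f.eval z)) '' T i =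
          (fun z => q * s.2 z) '' (f.eval '' T i) := fun i f => by rw [Set.image_image]
      subst hg hg'
      rw [e i f, e i' f', ← hsim.image_interior hq0, ← hsim.image_interior hq0,
        Set.disjoint_image_iff (hsim.injective hq0)]
      exact h1
    · have h1 := hP.2 s hs s' hs' hss
      subst hg hg'
      refine Disjoint.mono (interior_mono (child_image_subset h hf _))
        (interior_mono (child_image_subset h hf' _)) ?_
      have e : ∀ s : PlacedTile ι, (fun z => q * s.2 z) '' T s.1 =
          (fun z => q * z) '' (s.2 '' T s.1) := fun s => by rw [Set.image_image]
      rw [e s, e s', ← hq.image_interior hq0, ← hq.image_interior hq0,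
        Set.disjoint_image_iff (hq.injective hq0)]
      exact h1

theorem isPlacement_iterate (h : IsTileSubstitution F q T) (k : ℕ) (j : ι) {g : ℂ → ℂ}
    (hg : g ∈ motions) : IsPlacement T ((substitute F q)^[k] {(j, g)}) := by
  induction k with
  | zero =>
    refine ⟨?_, ?_⟩
    · rintro _ rfl
      exact isSimilarity_of_mem_motions hg
    · rintro _ rfl _ rfl hne
      exact absurd rfl hne
  | succ k ih =>
    rw [Function.iterate_succ_apply']
    exact isPlacement_substitute h ih

/-- A set of tiles (closures of open sets) that do not overlap. -/
def NonOverlapping (E : Set (Set ℂ)) : Prop :=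
  (∀ t ∈ E, closure (interior t) = t ∧ t.Nonempty) ∧ ∀ t ∈ E, ∀ t' ∈ E, t ≠ t' →
    Disjoint (interior t) (interior t')

theorem IsPlacement.nonOverlapping (h : IsTileSubstitution F q T) {P : Set (PlacedTile ι)}
    (hP : IsPlacement T P) : NonOverlapping (tiles T P) := by
  refine ⟨?_, ?_⟩
  · rintro _ ⟨t, ht, rfl⟩
    have hs := hP.1 t ht
    refine ⟨?_, (h.solution.1 t.1).2.image _⟩
    change closure (interior (t.2 '' T t.1)) = t.2 '' T t.1
    rw [← hs.image_interior one_pos, ← hs.image_closure one_pos, h.regular]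
  · rintro _ ⟨t, ht, rfl⟩ _ ⟨t', ht', rfl⟩ hne
    refine hP.2 t ht t' ht' ?_
    rintro rfl
    exact hne rfl

/-- The tile that a placed descendant occupies lies in the inflated ancestor. -/
theorem image_subset_of_mem_iterate (h : IsTileSubstitution F q T) {k : ℕ} {s t : PlacedTile ι}
    (ht : t ∈ (substitute F q)^[k] {s}) :
    t.2 '' T t.1 ⊆ (fun z => q ^ k * s.2 z) '' T s.1 := by
  induction k generalizing t with
  | zero =>
    rw [Function.iterate_zero, id, Set.mem_singleton_iff] at ht
    subst ht
    simp
  | succ k ih =>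
    rw [Function.iterate_succ_apply'] at ht
    obtain ⟨s', hs', f, hf, hg⟩ := ht
    obtain ⟨i, g⟩ := t
    change g = _ at hg
    subst hg
    refine (child_image_subset h hf _).trans ?_
    rintro _ ⟨z, hz, rfl⟩
    obtain ⟨w, hw, e⟩ := ih hs' ⟨z, hz, rfl⟩
    refine ⟨w, hw, ?_⟩
    change q ^ (k + 1) * s.2 w = q * s'.2 z
    rw [← e]
    ring

end generic

/-- A motion is the composition of a motion with a given motion. -/
theorem exists_eq_comp {g h : ℂ → ℂ} (hg : g ∈ motions) (hh : h ∈ motions) :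
    ∃ g' ∈ motions, g = fun z => g' (h z) := by
  obtain ⟨h', hh', -, h2⟩ := exists_inverse_mem_motions hh
  refine ⟨_, comp_mem_motions hg hh', ?_⟩
  funext z
  simp [h2]

/-- Every placed tile is a child of some placed tile, in each position that the dissection of `λ T
j` offers. -/
theorem exists_mem_substitute {ch : ChildList} {F : MatrixSystem Proto} {q : ℂ}
    (hF : Encodes ch F) (hq : q = lam ∨ q = -lam) {i j : Proto} {c : Code}
    (hc : (i, c) ∈ ch j) {g : ℂ → ℂ} (hg : g ∈ motions) :
    ∃ g' ∈ motions, ((i, g) : PlacedTile Proto) ∈ substitute F q {(j, g')} := by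
  obtain ⟨g0, hg0, rfl⟩ := exists_eq_comp hg c.sim_eval_mem_motions
  have hl := Code.lam_coe_ne_zero
  have hneg : (fun z : ℂ => -z) ∈ motions :=
    mem_motions_iff.2 ⟨false, 4, 0, by funext z; simp [similarity, xi_pow_four]⟩
  have h1 := conj_homothety_mem_motions hg0 hl Code.conj_lam
  rcases hq with rfl | rfl
  · refine ⟨_, h1, _, rfl, c.child, hF _ _ ▸ ⟨c, hc, rfl⟩, ?_⟩
    funext z
    simp [c.child_eval, hl]
  · refine ⟨_, comp_mem_motions hneg h1, _, rfl, c.child, hF _ _ ▸ ⟨c, hc, rfl⟩, ?_⟩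
    funext z
    simp [c.child_eval, hl]

theorem mem_motions_of_mem_iterate {ch : ChildList} {F : MatrixSystem Proto} {q : ℂ}
    (hF : Encodes ch F) (hq : q = lam) {k : ℕ} {j : Proto} {g : ℂ → ℂ}
    (hg : g ∈ motions) {t : PlacedTile Proto} (ht : t ∈ (substitute F q)^[k] {(j, g)}) :
    t.2 ∈ motions := by
  subst hq
  induction k generalizing t with
  | zero =>
    rw [Function.iterate_zero, id, Set.mem_singleton_iff] at ht
    subst ht
    exact hg
  | succ k ih =>
    rw [Function.iterate_succ_apply'] at ht
    obtain ⟨s, hs, f, hf, e⟩ := ht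
    rw [hF] at hf
    obtain ⟨c, -, rfl⟩ := hf
    rw [e]
    have hl := Code.lam_coe_ne_zero
    have h1 := conj_homothety_mem_motions (ih hs) (inv_ne_zero hl)
      (by rw [map_inv₀, Code.conj_lam])
    have h2 := comp_mem_motions h1 c.sim_eval_mem_motions
    convert! h2 using 1
    funext z
    simp [c.child_eval]

/-- Patches extend to patches of higher order, because both tiles occur in the dissection of `λ L`.
-/
theorem patch_subset_patch_add (n k : ℕ) (j : Proto) {g : ℂ → ℂ} (hg : g ∈ motions) :
    ∃ j', ∃ g' ∈ motions, patch system lam tile k j g ⊆ patch system lam tile (k + n) j' g' := by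
  induction n with
  | zero => exact ⟨j, g, hg, subset_rfl⟩
  | succ n ih =>
    obtain ⟨j', g', hg', h⟩ := ih
    have hc : ∀ j' : Proto, ∃ c, (j', c) ∈ children .L := by
      rintro (_ | _)
      · exact ⟨_, .tail _ (.tail _ (.tail _ (.head _)))⟩
      · exact ⟨_, .head _⟩
    obtain ⟨c, hc⟩ := hc j'
    obtain ⟨g'', hg'', hm⟩ := exists_mem_substitute encodes_children (Or.inl rfl) hc hg'
    refine ⟨.L, g'', hg'', h.trans (tiles_mono ?_)⟩
    rw [← add_assoc, Function.iterate_succ_apply]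
    exact substitute_iterate_mono _ (Set.singleton_subset_iff.2 hm)

/-! ### The pieces of the prototiles -/

/-- The motions that carry the dual prototile `dualTile j` to the pieces of `tile j`. For `S`, the
two choices for each piece differ by a symmetry of the isosceles triangle; the chosen ones make
the dissection commute with the substitutions. -/
def pieceList : Proto → List Code
  | .S => [⟨true, 3, ⟨1, 1, 1, -1⟩⟩, ⟨true, 1, ⟨1, -1, 1, -1⟩⟩]
  | .L => [⟨true, 6, ⟨1, 1, 1, -1⟩⟩, ⟨false, 7, ⟨1, 1, -1, 1⟩⟩, ⟨true, 2, ⟨1, 1, -1, 1⟩⟩,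
      ⟨false, 3, ⟨1, 1, 1, -1⟩⟩]

theorem pt_zero : Cyc.pt ⟨0, 0, 0, 0⟩ = 0 := by simp [Cyc.pt, Cyc.toC_eq]

theorem pt_one : Cyc.pt ⟨2, 0, 0, 0⟩ = 1 := by simp [Cyc.pt, Cyc.toC_eq]

theorem pt_xi : Cyc.pt ⟨0, 2, 0, 0⟩ = xi := by simp [Cyc.pt, Cyc.toC_eq]

theorem pt_one_add_xi : Cyc.pt ⟨2, 2, 0, 0⟩ = 1 + xi := by
  simp [Cyc.pt, Cyc.toC_eq]; ring

theorem pt_center : Cyc.pt ⟨1, 1, 0, 0⟩ = (1 + xi) / 2 := by simp [Cyc.pt, Cyc.toC_eq]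

theorem pt_I : Cyc.pt ⟨0, 0, 2, 0⟩ = Complex.I := by simp [Cyc.pt, Cyc.toC_eq, xi_sq]

theorem pt_one_add_I : Cyc.pt ⟨2, 0, 2, 0⟩ = 1 + Complex.I := by
  simp [Cyc.pt, Cyc.toC_eq, xi_sq]; ring

theorem pt_midpoint : Cyc.pt ⟨1, 0, 1, 0⟩ = (1 + Complex.I) / 2 := by
  simp [Cyc.pt, Cyc.toC_eq, xi_sq]

/-- A piece of a prototile in terms of the dual prototile. -/
def piece (j : Proto) (c : Code) : Set ℂ := c.sim.eval '' dualTile j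

theorem piece_eq (j : Proto) (c : Code) : piece j c = poly ((dualCorners j).map c.act) :=
  c.image_poly _

theorem pieces_eq (j : Proto) : pieces j = {A | ∃ c ∈ pieceList j, A = piece j c} := by
  cases j
  · have h1 : piece .S ⟨true, 3, ⟨1, 1, 1, -1⟩⟩ =
        convexHull ℝ {0, Complex.I, (1 + Complex.I) / 2} := by
      rw [piece_eq]
      change poly [⟨0, 0, 0, 0⟩, ⟨0, 0, 2, 0⟩, ⟨1, 0, 1, 0⟩] = _
      rw [poly_triangle, pt_I, pt_zero, pt_midpoint]
    have h2 : piece .S ⟨true, 1, ⟨1, -1, 1, -1⟩⟩ =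
        convexHull ℝ {Complex.I, 1 + Complex.I, (1 + Complex.I) / 2} := by
      rw [piece_eq]
      change poly [⟨0, 0, 2, 0⟩, ⟨2, 0, 2, 0⟩, ⟨1, 0, 1, 0⟩] = _
      rw [poly_triangle, pt_I, pt_one_add_I, pt_midpoint]
    ext A
    simp only [pieces, pieceList, List.mem_cons, List.not_mem_nil, or_false, exists_eq_or_imp,
      exists_eq_left, h1, h2, Set.mem_insert_iff, Set.mem_singleton_iff, Set.mem_ofPred_eq]
  · have h1 : piece .L ⟨true, 6, ⟨1, 1, 1, -1⟩⟩ = convexHull ℝ {0, 1, (1 + xi) / 2} := by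
      rw [piece_eq]
      change poly [⟨2, 0, 0, 0⟩, ⟨0, 0, 0, 0⟩, ⟨1, 1, 0, 0⟩] = _
      rw [poly_triangle, pt_one, pt_zero, pt_center, Set.insert_comm]
    have h2 : piece .L ⟨false, 7, ⟨1, 1, -1, 1⟩⟩ = convexHull ℝ {1, 1 + xi, (1 + xi) / 2} := by
      rw [piece_eq]
      change poly [⟨2, 0, 0, 0⟩, ⟨2, 2, 0, 0⟩, ⟨1, 1, 0, 0⟩] = _
      rw [poly_triangle, pt_one, pt_one_add_xi, pt_center]
    have h3 : piece .L ⟨true, 2, ⟨1, 1, -1, 1⟩⟩ = convexHull ℝ {1 + xi, xi, (1 + xi) / 2} := by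
      rw [piece_eq]
      change poly [⟨0, 2, 0, 0⟩, ⟨2, 2, 0, 0⟩, ⟨1, 1, 0, 0⟩] = _
      rw [poly_triangle, pt_xi, pt_one_add_xi, pt_center, Set.insert_comm]
    have h4 : piece .L ⟨false, 3, ⟨1, 1, 1, -1⟩⟩ = convexHull ℝ {xi, 0, (1 + xi) / 2} := by
      rw [piece_eq]
      change poly [⟨0, 2, 0, 0⟩, ⟨0, 0, 0, 0⟩, ⟨1, 1, 0, 0⟩] = _
      rw [poly_triangle, pt_xi, pt_zero, pt_center]
    ext A
    simp only [pieces, pieceList, List.mem_cons, List.not_mem_nil, or_false, exists_eq_or_imp,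
      exists_eq_left, h1, h2, h3, h4, Set.mem_insert_iff, Set.mem_singleton_iff,
      Set.mem_ofPred_eq]

theorem piece_subset {j : Proto} {c : Code} (hc : c ∈ pieceList j) : piece j c ⊆ tile j := by
  have h : ∀ j, ∀ c ∈ pieceList j, ∀ v ∈ dualCorners j, InPoly (corners j) (c.act v) := by
    decide +kernel
  rw [piece_eq, tile_eq]
  refine poly_subset (convex_poly _) fun x hx => ?_
  obtain ⟨v, hv, rfl⟩ := List.mem_map.1 hx
  exact (h j c hc v hv).mem

theorem disjoint_piece {j : Proto} {c c' : Code} (hc : c ∈ pieceList j) (hc' : c' ∈ pieceList j)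
    (hne : c ≠ c') : Disjoint (interior (piece j c)) (interior (piece j c')) := by
  have h : ∀ j, ∀ c ∈ pieceList j, ∀ c' ∈ pieceList j, c ≠ c' →
      Separated ((dualCorners j).map c.act) ((dualCorners j).map c'.act) := by
    decide +kernel
  rw [piece_eq, piece_eq]
  exact (h j c hc c' hc' hne).disjoint

theorem interior_piece_nonempty (j : Proto) (c : Code) : (interior (piece j c)).Nonempty := by
  rw [piece, ← c.isSimilarity.image_interior one_pos]
  exact (interior_dualCorners_nonempty j).image _

/-- The lines from a point `m` to four points around it dissect a quadrilateral whose diagonals are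
both bisected by `m`. -/
theorem subset_union_of_midpoint {a b c d m : ℂ} (h1 : a + c = 2 * m) (h2 : b + d = 2 * m) :
    convexHull ℝ {a, b, c, d} ⊆ convexHull ℝ {a, b, m} ∪ convexHull ℝ {b, c, m} ∪
      convexHull ℝ {c, d, m} ∪ convexHull ℝ {d, a, m} := by
  intro z hz
  rw [convexHull_insert (by simp), convexHull_insert (by simp), convexHull_pair] at hz
  simp only [convexJoin_singleton_left, Set.mem_iUnion] at hz
  obtain ⟨y, ⟨x, ⟨s, s', hs, hs', hss, rfl⟩, ⟨r, r', hr, hr', hrr, rfl⟩⟩, p, p', hp, hp', hpp,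
    rfl⟩ := hz
  have e : p • a + p' • (r • b + r' • (s • c + s' • d)) =
      (p : ℂ) * a + (p' * r : ℝ) * b + (p' * r' * s : ℝ) * c + (p' * r' * s' : ℝ) * d := by
    simp only [Complex.real_smul]
    push_cast
    ring
  have hsum : p + p' * r + p' * r' * s + p' * r' * s' = 1 := by
    linear_combination hpp + p' * hrr + p' * r' * hss
  rw [e]
  have h0b : 0 ≤ p' * r := by positivity
  have h0c : 0 ≤ p' * r' * s := by positivity
  have h0d : 0 ≤ p' * r' * s' := by positivity
  generalize p' * r = β at *
  generalize p' * r' * s = γ at *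
  generalize p' * r' * s' = δ at *
  rcases le_total γ p with hac | hac <;> rcases le_total δ β with hbd | hbd
  · left; left; left
    convert! combination_mem_triangle a b m (p - γ) (β - δ) (2 * (γ + δ)) (by linarith)
      (by linarith) (by linarith) (by linarith) using 1
    push_cast
    linear_combination γ * h1 + δ * h2
  · right
    convert! combination_mem_triangle d a m (δ - β) (p - γ) (2 * (γ + β)) (by linarith)
      (by linarith) (by linarith) (by linarith) using 1
    push_cast
    linear_combination γ * h1 + β * h2
  · left; left; right
    convert! combination_mem_triangle b c m (β - δ) (γ - p) (2 * (p + δ)) (by linarith)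
      (by linarith) (by linarith) (by linarith) using 1
    push_cast
    linear_combination p * h1 + δ * h2
  · left; right
    convert! combination_mem_triangle c d m (γ - p) (δ - β) (2 * (p + β)) (by linarith)
      (by linarith) (by linarith) (by linarith) using 1
    push_cast
    linear_combination p * h1 + β * h2

theorem subset_union_of_midpoint' {a b c m : ℂ} (h1 : a + c = 2 * m) :
    convexHull ℝ {a, b, c} ⊆ convexHull ℝ {a, b, m} ∪ convexHull ℝ {b, c, m} := by
  intro z hz
  rw [convexHull_insert (by simp), convexHull_pair] at hz
  simp only [convexJoin_singleton_left, Set.mem_iUnion] at hz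
  obtain ⟨x, ⟨s, s', hs, hs', hss, rfl⟩, p, p', hp, hp', hpp, rfl⟩ := hz
  have e : p • a + p' • (s • b + s' • c) =
      (p : ℂ) * a + (p' * s : ℝ) * b + (p' * s' : ℝ) * c := by
    simp only [Complex.real_smul]
    push_cast
    ring
  have hsum : p + p' * s + p' * s' = 1 := by linear_combination hpp + p' * hss
  rw [e]
  have h0b : 0 ≤ p' * s := by positivity
  have h0c : 0 ≤ p' * s' := by positivity
  generalize p' * s = β at *
  generalize p' * s' = γ at *
  rcases le_total γ p with hac | hac
  · left
    convert! combination_mem_triangle a b m (p - γ) β (2 * γ) (by linarith)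
      (by linarith) (by linarith) (by linarith) using 1
    push_cast
    linear_combination γ * h1
  · right
    convert! combination_mem_triangle b c m β (γ - p) (2 * p) (by linarith)
      (by linarith) (by linarith) (by linarith) using 1
    push_cast
    linear_combination p * h1

theorem sUnion_pieces (j : Proto) : ⋃₀ pieces j = tile j := by
  refine subset_antisymm (Set.sUnion_subset fun A hA => ?_) ?_
  · rw [pieces_eq] at hA
    obtain ⟨c, hc, rfl⟩ := hA
    exact piece_subset hc
  · cases j
    · have h := subset_union_of_midpoint' (a := 0) (b := Complex.I) (c := 1 + Complex.I)
        (m := (1 + Complex.I) / 2) (by ring)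
      simpa [tile, pieces] using h
    · have h := subset_union_of_midpoint (a := 0) (b := 1) (c := 1 + xi) (d := xi)
        (m := (1 + xi) / 2) (by ring) (by ring)
      simpa [tile, pieces, Set.union_assoc] using h

theorem isDissection_pieces (j : Proto) :
    IsDissection (tile j) (pieces j) (pieceList j).length (dualTile j) := by
  have hinj : Set.InjOn (piece j) {c | c ∈ pieceList j} := by
    intro c hc c' hc' e
    by_contra hne
    have h := disjoint_piece hc hc' hne
    rw [e, disjoint_self] at h
    exact (interior_piece_nonempty j c').ne_empty h
  have hnd : (pieceList j).Nodup := by cases j <;> decide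
  refine ⟨?_, ?_, sUnion_pieces j, ?_⟩
  · have e : pieces j = piece j '' ((pieceList j).toFinset : Set Code) := by
      rw [pieces_eq]
      ext A
      simp [eq_comm]
    rw [e, Set.InjOn.ncard_image (by simpa using hinj), Set.ncard_coe_finset,
      List.toFinset_card_of_nodup hnd]
  · intro p hp
    rw [pieces_eq] at hp
    obtain ⟨c, -, rfl⟩ := hp
    exact ⟨_, c.sim_eval_mem_motions, rfl⟩
  · intro p hp p' hp' hne
    rw [pieces_eq] at hp hp'
    obtain ⟨c, hc, rfl⟩ := hp
    obtain ⟨c', hc', rfl⟩ := hp'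
    exact disjoint_piece hc hc' fun e => hne (by rw [e])

/-! ### The dissection commutes with the substitutions -/

/-- Replace each placed tile by its placed pieces. -/
def splitPlaced (P : Set (PlacedTile Proto)) : Set (PlacedTile Proto) :=
  {t | ∃ s ∈ P, ∃ c ∈ pieceList s.1, t = (s.1, fun z => s.2 (c.sim.eval z))}

theorem splitPlaced_post (h : ℂ → ℂ) (P : Set (PlacedTile Proto)) :
    splitPlaced (post h P) = post h (splitPlaced P) := by
  ext t
  constructor
  · rintro ⟨_, ⟨s, hs, rfl⟩, c, hc, rfl⟩
    exact ⟨_, ⟨s, hs, c, hc, rfl⟩, rfl⟩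
  · rintro ⟨_, ⟨s, hs, c, hc, rfl⟩, rfl⟩
    exact ⟨_, ⟨s, hs, rfl⟩, c, hc, rfl⟩

/-- The pieces of the children of `j` (left) are the dual children of the pieces of `j` (right). -/
theorem pieces_children_eq : ∀ i j : Proto,
    (∀ t ∈ children j, t.1 = i → ∀ p ∈ pieceList i, ∃ p' ∈ pieceList j,
      ∃ t' ∈ dualList children j, t'.1 = i ∧ t.2.comp p = p'.scale.comp t'.2) ∧
    ∀ t' ∈ dualList children j, t'.1 = i → ∀ p' ∈ pieceList j, ∃ p ∈ pieceList i,
      ∃ t ∈ children j, t.1 = i ∧ t.2.comp p = p'.scale.comp t'.2 := by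
  decide +kernel

theorem Code.comp_child_eval (c p : Code) (z : ℂ) :
    (lam : ℂ) * c.child.eval (p.sim.eval z) = (c.comp p).sim.eval z := by
  rw [child_eval, mul_inv_cancel_left₀ lam_coe_ne_zero, sim_comp, SimMap.eval_comp]

/-- The dissection conjugates the substitution to the dual one, up to the rotation by `π` that is
due to the sign in `dualFactor = -λ`. -/
theorem substitute_splitPlaced (P : Set (PlacedTile Proto)) :
    substitute system.starDual dualFactor (splitPlaced P) =
      post (fun z => -z) (splitPlaced (substitute system lam P)) := by
  have hl := Code.lam_coe_ne_zero
  have key : ∀ {c p c' p' : Code}, c.comp p = p'.scale.comp c' → ∀ z,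
      c.child.eval (p.sim.eval z) = p'.sim.eval (c'.child.eval z) := by
    intro c p c' p' h z
    refine mul_left_cancel₀ hl ?_
    rw [Code.comp_child_eval, h, Code.scale_comp_sim_eval]
  ext ⟨i, g⟩
  constructor
  · rintro ⟨_, ⟨⟨j, g0⟩, hs, p', hp', rfl⟩, f, hf, hg⟩
    change g = _ at hg
    subst hg
    rw [encodes_dualList encodes_children] at hf
    obtain ⟨c', hc', rfl⟩ := hf
    obtain ⟨p, hp, ⟨i', c⟩, hc, rfl, e⟩ := (pieces_children_eq i j).2 _ hc' rfl p' hp'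
    refine ⟨(i', fun z => lam * g0 (c.child.eval (p.sim.eval z))),
      ⟨(i', fun z => lam * g0 (c.child.eval z)),
        ⟨_, hs, c.child, encodes_children _ _ ▸ ⟨c, hc, rfl⟩, rfl⟩, p, hp, rfl⟩, ?_⟩
    simp only [key e, dualFactor_eq, neg_mul]
  · rintro ⟨_, ⟨⟨i', g1⟩, ⟨⟨j, g0⟩, hs, f, hf, hg⟩, p, hp, rfl⟩, e⟩
    change g1 = _ at hg
    subst hg
    obtain ⟨rfl, rfl⟩ := Prod.mk.inj e
    rw [encodes_children] at hf
    obtain ⟨c, hc, rfl⟩ := hf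
    obtain ⟨p', hp', ⟨i'', c'⟩, hc', rfl, e⟩ := (pieces_children_eq _ j).1 _ hc rfl p hp
    refine ⟨(j, fun z => g0 (p'.sim.eval z)), ⟨_, hs, p', hp', rfl⟩, c'.child,
      encodes_dualList encodes_children _ _ ▸ ⟨c', hc', rfl⟩, ?_⟩
    simp only [key e, dualFactor_eq, neg_mul]

theorem neg_mem_motions {g : ℂ → ℂ} (hg : g ∈ motions) : (fun z => -g z) ∈ motions := by
  obtain ⟨r, k, b, rfl⟩ := mem_motions_iff.1 hg
  exact mem_motions_iff.2 ⟨r, 4 + k, -b, by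
    funext z
    simp only [similarity, pow_add, xi_pow_four]
    ring⟩

/-- Up to a rotation by `π`, iterating the dual substitution on the pieces of a tile gives the
pieces of the iterated substitution. -/
theorem substitute_iterate_splitPlaced (k : ℕ) (j : Proto) {g : ℂ → ℂ} (hg : g ∈ motions) :
    ∃ g' ∈ motions, (substitute system.starDual dualFactor)^[k] (splitPlaced {(j, g)}) =
      splitPlaced ((substitute system lam)^[k] {(j, g')}) := by
  induction k with
  | zero => exact ⟨g, hg, rfl⟩
  | succ k ih =>
    obtain ⟨g', hg', h⟩ := ih
    refine ⟨_, neg_mem_motions hg', ?_⟩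
    have e : ({(j, fun z => -g' z)} : Set (PlacedTile Proto)) = post (fun z => -z) {(j, g')} := by
      simp [post]
    rw [Function.iterate_succ_apply', h, substitute_splitPlaced, e,
      substitute_iterate_post (fun z => by ring), splitPlaced_post, Function.iterate_succ_apply']

theorem substitute_iterate_splitPlaced' (k : ℕ) (j : Proto) {g : ℂ → ℂ} (hg : g ∈ motions) :
    ∃ g' ∈ motions, splitPlaced ((substitute system lam)^[k] {(j, g)}) =
      (substitute system.starDual dualFactor)^[k] (splitPlaced {(j, g')}) := by
  induction k with
  | zero => exact ⟨g, hg, rfl⟩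
  | succ k ih =>
    obtain ⟨g', hg', h⟩ := ih
    refine ⟨_, neg_mem_motions hg', ?_⟩
    have e : ({(j, fun z => -g' z)} : Set (PlacedTile Proto)) = post (fun z => -z) {(j, g')} := by
      simp [post]
    have hneg : ∀ P : Set (PlacedTile Proto), post (fun z => -z) (post (fun z => -z) P) = P :=
      fun P => by simp [post, Set.image_image]
    rw [e, splitPlaced_post, substitute_iterate_post (fun z => by ring),
      Function.iterate_succ_apply' (substitute system.starDual dualFactor), ← h,
      substitute_splitPlaced, hneg, Function.iterate_succ_apply']

/-! ### Symmetries of the tiles -/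

/-- The symmetries of the prototiles. -/
def symmetries : Proto → List Code
  | .S => [⟨false, 0, ⟨0, 0, 0, 0⟩⟩, ⟨true, 6, ⟨2, 0, 2, 0⟩⟩]
  | .L => [⟨false, 0, ⟨0, 0, 0, 0⟩⟩, ⟨true, 1, ⟨0, 0, 0, 0⟩⟩, ⟨false, 4, ⟨2, 2, 0, 0⟩⟩,
      ⟨true, 5, ⟨2, 2, 0, 0⟩⟩]

/-- The symmetries of the dual prototiles. -/
def dualSymmetries : Proto → List Code
  | .S => [⟨false, 0, ⟨0, 0, 0, 0⟩⟩, ⟨true, 6, ⟨0, 0, 0, 0⟩⟩]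
  | .L => [⟨false, 0, ⟨0, 0, 0, 0⟩⟩]

theorem poly_congr {V W : List Cyc} (h : ∀ x, x ∈ V ↔ x ∈ W) : poly V = poly W := by
  have : {x | x ∈ V} = {x | x ∈ W} := Set.ext h
  rw [poly, this, poly]

theorem poly_eq_of_subset {V W : List Cyc} (h : (∀ x ∈ V, x ∈ W) ∧ ∀ x ∈ W, x ∈ V) :
    poly V = poly W := poly_congr fun x => ⟨h.1 x, h.2 x⟩

theorem symmetries_image {j : Proto} {s : Code} (hs : s ∈ symmetries j) :
    s.sim.eval '' tile j = tile j := by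
  have h : ∀ j, ∀ s ∈ symmetries j, (∀ x ∈ (corners j).map s.act, x ∈ corners j) ∧
      ∀ x ∈ corners j, x ∈ (corners j).map s.act := by decide +kernel
  rw [tile_eq, s.image_poly]
  exact poly_eq_of_subset (h j s hs)

theorem symmetries_piece {j : Proto} {s c : Code} (hs : s ∈ symmetries j)
    (hc : c ∈ pieceList j) : ∃ c' ∈ pieceList j, s.sim.eval '' piece j c = piece j c' := by
  have h : ∀ j, ∀ s ∈ symmetries j, ∀ c ∈ pieceList j, ∃ c' ∈ pieceList j,
      (∀ x ∈ ((dualCorners j).map c.act).map s.act, x ∈ (dualCorners j).map c'.act) ∧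
      ∀ x ∈ (dualCorners j).map c'.act, x ∈ ((dualCorners j).map c.act).map s.act := by
    decide +kernel
  obtain ⟨c', hc', h'⟩ := h j s hs c hc
  refine ⟨c', hc', ?_⟩
  rw [piece_eq, piece_eq, s.image_poly]
  exact poly_eq_of_subset h'

theorem IsSimilarity.re_mul_conj {s : ℝ} {g : ℂ → ℂ} (hg : IsSimilarity s g) (a b c : ℂ) :
    ((g a - g c) * (starRingEnd ℂ) (g b - g c)).re =
      s ^ 2 * ((a - c) * (starRingEnd ℂ) (b - c)).re := by
  obtain ⟨r, u, v, rfl, rfl⟩ := hg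
  have h : ‖u‖ ^ 2 = u.re * u.re + u.im * u.im := by
    rw [← Complex.normSq_eq_norm_sq, Complex.normSq_apply]
  rw [h]
  cases r <;> simp [similarity] <;> ring

theorem image_convexHull_triple {s : ℝ} {g : ℂ → ℂ} (hg : IsSimilarity s g) (a b c : ℂ) :
    g '' convexHull ℝ {a, b, c} = convexHull ℝ {g a, g b, g c} := by
  rw [hg.image_convexHull, Set.image_insert_eq, Set.image_pair]

/-- A motion that carries one right triangle to another carries vertices to vertices. -/
theorem motion_right_triangle {h : ℂ → ℂ} (hh : IsSimilarity 1 h) {a b c a' b' c' : ℂ}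
    (hr : ((a - c) * (starRingEnd ℂ) (b - c)).re = 0) (hac : a ≠ c) (hbc : b ≠ c)
    (hr' : ((a' - c') * (starRingEnd ℂ) (b' - c')).re = 0) (hac' : a' ≠ c') (hbc' : b' ≠ c')
    (hT : h '' convexHull ℝ {a, b, c} = convexHull ℝ {a', b', c'}) :
    h c = c' ∧ (h a = a' ∧ h b = b' ∨ h a = b' ∧ h b = a') := by
  rw [image_convexHull_triple hh] at hT
  have hi := hh.injective one_pos
  refine right_triangle_vertices ?_ (hi.ne hac) (hi.ne hbc) hr' hac' hbc' hT
  rw [hh.re_mul_conj, hr, mul_zero]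

theorem code_one_eval (z : ℂ) : (Code.sim ⟨false, 0, ⟨0, 0, 0, 0⟩⟩).eval z = z := by
  have : Cyc.toK ⟨0, 0, 0, 0⟩ = 0 := Cyc.toK_zero
  simp [Code.sim, SimMap.eval, this]

/-- The vertices `0` and `1 + ξ` of the rhomb have a distance that no other pair of vertices of a
prototile reaches. -/
theorem dist_corners_lt : ∀ j : Proto, ∀ x ∈ corners j, ∀ y ∈ corners j,
    (j = .L ∧ (x = ⟨0, 0, 0, 0⟩ ∧ y = ⟨2, 2, 0, 0⟩ ∨ x = ⟨2, 2, 0, 0⟩ ∧ y = ⟨0, 0, 0, 0⟩)) ∨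
      (⟨7, 4, 0, -4⟩ - (x - y) * (x - y).conj : Cyc).ReNonneg := by
  decide +kernel

/-- The long diagonal of the rhomb is determined by the rhomb, as the largest distance of two
points. -/
theorem eq_of_motion_rhomb {h : ℂ → ℂ} (hh : IsSimilarity 1 h) {j : Proto}
    (hT : h '' tile j = tile .L) :
    j = .L ∧ (h 0 = 0 ∧ h (1 + xi) = 1 + xi ∨ h 0 = 1 + xi ∧ h (1 + xi) = 0) := by
  have hs : (0 : ℝ) < √2 := by positivity
  rw [tile_eq j, poly, hh.image_convexHull, tile] at hT
  have h0 : (0 : ℂ) ∈ h '' (Cyc.pt '' {x | x ∈ corners j}) := by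
    refine mem_of_convexHull_eq (-1 - (starRingEnd ℂ) xi) (by simp) ?_ hT.symm
    rintro x (rfl | rfl | rfl | rfl)
    · exact Or.inl rfl
    all_goals
      right
      rw [xi_eq_mk]
      simp
      nlinarith
  have h1 : (1 + xi : ℂ) ∈ h '' (Cyc.pt '' {x | x ∈ corners j}) := by
    refine mem_of_convexHull_eq (1 + (starRingEnd ℂ) xi) (by simp) ?_ hT.symm
    rintro x (rfl | rfl | rfl | rfl)
    · right
      rw [xi_eq_mk]
      simp
      nlinarith
    · right
      rw [xi_eq_mk]
      simp
      nlinarith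
    · exact Or.inl rfl
    · right
      rw [xi_eq_mk]
      simp
      nlinarith
  obtain ⟨_, ⟨x, hx, rfl⟩, e0⟩ := h0
  obtain ⟨_, ⟨y, hy, rfl⟩, e1⟩ := h1
  rcases dist_corners_lt j x hx y hy with ⟨rfl, ⟨rfl, rfl⟩ | ⟨rfl, rfl⟩⟩ | hlt
  · rw [pt_zero] at e0
    rw [pt_one_add_xi] at e1
    exact ⟨rfl, Or.inl ⟨e0, e1⟩⟩
  · rw [pt_one_add_xi] at e0
    rw [pt_zero] at e1
    exact ⟨rfl, Or.inr ⟨e1, e0⟩⟩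
  · exfalso
    have h2 := hlt.re_nonneg
    have h3 := hh.dist_map x.pt y.pt
    rw [e0, e1, one_mul, dist_comm, dist_eq_norm, dist_eq_norm, sub_zero] at h3
    have h4 : ‖(1 + xi : ℂ)‖ ^ 2 = 2 + √2 := by
      rw [← Complex.normSq_eq_norm_sq, Complex.normSq_apply, xi_eq_mk]
      have := Real.mul_self_sqrt (show (0 : ℝ) ≤ 2 by norm_num)
      simp
      linear_combination (1 / 2 : ℝ) * this
    have h5 : x.pt - y.pt = (x - y).toC / 2 := by
      rw [Cyc.toC_sub]; simp only [Cyc.pt]; ring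
    have h6 : ((x - y) * (x - y).conj).toC = ((‖(x - y).toC‖ ^ 2 : ℝ) : ℂ) := by
      rw [Cyc.toC_mul, toC_conj, Complex.mul_conj, Complex.normSq_eq_norm_sq]
    have h7 : ‖(x - y).toC‖ = 2 * ‖(1 + xi : ℂ)‖ := by
      rw [h3, h5, norm_div, Complex.norm_ofNat]
      ring
    rw [Cyc.toC_sub, h6, h7, mul_pow, h4, Complex.sub_re, Complex.ofReal_re, Cyc.toC_re] at h2
    push_cast at h2
    linarith

/-- A motion that carries one prototile to another is a symmetry. -/
theorem mem_symmetries {h : ℂ → ℂ} (hh : h ∈ motions) {j j' : Proto}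
    (hT : h '' tile j = tile j') : j = j' ∧ ∃ s ∈ symmetries j, h = s.sim.eval := by
  have hsim := isSimilarity_of_mem_motions hh
  cases j'
  · cases j
    · refine ⟨rfl, ?_⟩
      have e : tile .S = convexHull ℝ {0, 1 + Complex.I, Complex.I} := by
        rw [tile, Set.pair_comm]
      rw [e] at hT
      have hr : (((0 : ℂ) - Complex.I) * (starRingEnd ℂ) (1 + Complex.I - Complex.I)).re = 0 := by
        simp
      have hac : (0 : ℂ) ≠ Complex.I := Complex.I_ne_zero.symm
      have hbc : 1 + Complex.I ≠ Complex.I := by simp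
      have hnc : ((1 + Complex.I - 0) * (starRingEnd ℂ) (Complex.I - 0)).im ≠ 0 := by simp
      obtain ⟨hc, ⟨ha, hb⟩ | ⟨ha, hb⟩⟩ := motion_right_triangle hsim hr hac hbc hr hac hbc hT
      · refine ⟨⟨false, 0, ⟨0, 0, 0, 0⟩⟩, by decide, ?_⟩
        refine hsim.ext (Code.isSimilarity _) one_pos hnc ?_ ?_ ?_ <;>
          simp only [code_one_eval, ha, hb, hc]
      · refine ⟨⟨true, 6, ⟨2, 0, 2, 0⟩⟩, by decide, ?_⟩
        refine hsim.ext (Code.isSimilarity _) one_pos hnc ?_ ?_ ?_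
        · rw [ha, ← pt_one_add_I, ← pt_zero, Code.sim_eval_pt]
          rfl
        · rw [hb, ← pt_one_add_I, ← pt_zero, Code.sim_eval_pt]
          rfl
        · rw [hc, ← pt_I, Code.sim_eval_pt]
          rfl
    · exfalso
      obtain ⟨h', hh', h1, h2⟩ := exists_inverse_mem_motions hh
      have h3 : h' '' tile .S = tile .L := by
        rw [← hT, Set.image_image]
        simp [h2]
      have := (eq_of_motion_rhomb (isSimilarity_of_mem_motions hh') h3).1
      cases this
  · obtain ⟨rfl, h1⟩ := eq_of_motion_rhomb hsim hT
    refine ⟨rfl, ?_⟩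
    obtain ⟨r, k, b, rfl⟩ := mem_motions_iff.1 hh
    have hne : (1 + xi : ℂ) ≠ 0 := by
      rw [← pt_one_add_xi]
      intro h
      have := congrArg Complex.im h
      rw [pt_eq] at this
      norm_num at this
    have hconj : 1 + xi = xi * (1 + (starRingEnd ℂ) xi) := by
      have : xi * (starRingEnd ℂ) xi = 1 := by
        rw [Complex.mul_conj, Complex.normSq_eq_norm_sq, xi_primitive.norm'_eq_one (by norm_num)]
        norm_num
      linear_combination -this
    have hne' : (1 + (starRingEnd ℂ) xi : ℂ) ≠ 0 := fun h => hne (by rw [hconj, h, mul_zero])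
    have hb : ((Cyc.toK ⟨2, 2, 0, 0⟩ / 2 : K) : ℂ) = 1 + xi := pt_one_add_xi
    have hz : Cyc.toK ⟨0, 0, 0, 0⟩ = 0 := Cyc.toK_zero
    have h5 : xi ^ 5 = -xi := by linear_combination xi * xi_pow_four
    cases r <;> simp only [similarity, map_zero, ite_self, mul_zero, zero_add, if_true, if_false,
      Bool.false_eq_true, map_add, map_one] at h1 <;> rcases h1 with ⟨rfl, h1⟩ | ⟨rfl, h1⟩
    · have hk : xi ^ k = 1 := mul_right_cancel₀ hne (by linear_combination h1)
      refine ⟨⟨false, 0, ⟨0, 0, 0, 0⟩⟩, by decide, ?_⟩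
      funext z
      rw [code_one_eval, hk]
      simp [similarity]
    · have hk : xi ^ k = -1 := mul_right_cancel₀ hne (by linear_combination h1)
      refine ⟨⟨false, 4, ⟨2, 2, 0, 0⟩⟩, by decide, ?_⟩
      funext z
      simp only [SimMap.eval, Code.sim, hb, hk, similarity]
      simp [xiK, xi_pow_four]
    · have hk : xi ^ k = xi := mul_right_cancel₀ hne' (by rw [← hconj]; linear_combination h1)
      refine ⟨⟨true, 1, ⟨0, 0, 0, 0⟩⟩, by decide, ?_⟩
      funext z
      simp [SimMap.eval, Code.sim, hk, similarity, hz, xiK]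
    · have hk : xi ^ k = -xi := mul_right_cancel₀ hne' (by linear_combination h1 - hconj)
      refine ⟨⟨true, 5, ⟨2, 2, 0, 0⟩⟩, by decide, ?_⟩
      funext z
      simp only [SimMap.eval, Code.sim, hb, hk, similarity]
      simp [xiK, h5]

theorem dualTile_eq_triangle (j : Proto) : ∃ a b c : Cyc, dualCorners j = [a, b, c] ∧
    dualTile j = convexHull ℝ {a.pt, b.pt, c.pt} ∧
    ((a.pt - c.pt) * (starRingEnd ℂ) (b.pt - c.pt)).re = 0 ∧ a.pt ≠ c.pt ∧ b.pt ≠ c.pt ∧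
    ((b.pt - a.pt) * (starRingEnd ℂ) (c.pt - a.pt)).im ≠ 0 ∧
    (dist a.pt c.pt = dist b.pt c.pt ↔ j = .S) := by
  have h2 : (√2 : ℝ) * √2 = 2 := Real.mul_self_sqrt (by norm_num)
  have hs : (0 : ℝ) < √2 := by positivity
  have hre : ∀ {z w : ℂ}, z.re ≠ w.re → z ≠ w := fun h e => h (e ▸ rfl)
  cases j
  · refine ⟨_, _, _, rfl, poly_triangle _ _ _, ?_, fun h => ?_, hre fun h => ?_, fun h => ?_, ?_⟩
    · simp only [pt_eq]; simp
    · have := congrArg Complex.im h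
      simp only [pt_eq] at this
      push_cast at this
      linarith
    · simp only [pt_eq] at h
      push_cast at h
      linarith
    · simp only [pt_eq, Complex.mul_im, Complex.sub_re, Complex.sub_im, Complex.conj_re,
        Complex.conj_im] at h
      push_cast at h
      nlinarith
    · simp only [iff_true, Complex.dist_eq_re_im, pt_eq]
      congr 1
      push_cast
      ring
  · refine ⟨_, _, _, rfl, poly_triangle _ _ _, ?_, hre fun h => ?_, hre fun h => ?_, fun h => ?_,
      ?_⟩
    · simp only [pt_eq]; simp; nlinarith
    · simp only [pt_eq] at h
      push_cast at h
      linarith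
    · simp only [pt_eq] at h
      push_cast at h
      linarith
    · simp only [pt_eq, Complex.mul_im, Complex.sub_re, Complex.sub_im, Complex.conj_re,
        Complex.conj_im] at h
      push_cast at h
      nlinarith
    · simp only [Complex.dist_eq_re_im, pt_eq, reduceCtorEq, iff_false]
      intro h
      rw [Real.sqrt_inj (by positivity) (by positivity)] at h
      push_cast at h
      nlinarith

/-- A motion that carries one dual prototile to another is a symmetry. -/
theorem mem_dualSymmetries {h : ℂ → ℂ} (hh : h ∈ motions) {j j' : Proto}
    (hT : h '' dualTile j = dualTile j') : j = j' ∧ ∃ s ∈ dualSymmetries j, h = s.sim.eval := by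
  have hsim := isSimilarity_of_mem_motions hh
  obtain ⟨a, b, c, hl, e, hr, hac, hbc, hnc, hd⟩ := dualTile_eq_triangle j
  obtain ⟨a', b', c', hl', e', hr', hac', hbc', -, hd'⟩ := dualTile_eq_triangle j'
  rw [e, e'] at hT
  obtain ⟨h3, h12⟩ := motion_right_triangle hsim hr hac hbc hr' hac' hbc' hT
  have da := hsim.dist_map a.pt c.pt
  have db := hsim.dist_map b.pt c.pt
  rw [one_mul] at da db
  have hjj : j = .S ↔ j' = .S := by
    rw [← hd, ← hd', ← da, ← db, ← h3]
    rcases h12 with ⟨h1, h2⟩ | ⟨h1, h2⟩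
    · rw [h1, h2]
    · rw [h1, h2, eq_comm]
  have hj : j = j' := by
    cases j <;> cases j' <;> simp at hjj ⊢
  subst hj
  refine ⟨rfl, ?_⟩
  rw [hl] at hl'
  simp only [List.cons.injEq, and_true] at hl'
  obtain ⟨rfl, rfl, rfl⟩ := hl'
  rcases h12 with ⟨h1, h2⟩ | ⟨h1, h2⟩
  · refine ⟨⟨false, 0, ⟨0, 0, 0, 0⟩⟩, by cases j <;> decide, ?_⟩
    refine hsim.ext (Code.isSimilarity _) one_pos hnc ?_ ?_ ?_ <;>
      simp only [code_one_eval, h1, h2, h3]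
  · have hS : j = .S := by
      rw [← hd, ← da, h1, h3]
    subst hS
    refine ⟨⟨true, 6, ⟨0, 0, 0, 0⟩⟩, by decide, ?_⟩
    simp only [dualCorners, List.cons.injEq, and_true] at hl
    obtain ⟨rfl, rfl, rfl⟩ := hl
    refine hsim.ext (Code.isSimilarity _) one_pos hnc ?_ ?_ ?_
    · rw [h1, Code.sim_eval_pt]
      rfl
    · rw [h2, Code.sim_eval_pt]
      rfl
    · rw [h3, Code.sim_eval_pt]
      rfl

/-- The relative motion of two placed tiles that occupy the same set is a symmetry. -/
theorem exists_symmetry {T : Proto → Set ℂ} {L : Proto → List Code}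
    (hT : ∀ {h : ℂ → ℂ}, h ∈ motions → ∀ {j j' : Proto}, h '' T j = T j' →
      j = j' ∧ ∃ s ∈ L j, h = s.sim.eval)
    {g g' : ℂ → ℂ} (hg : g ∈ motions) (hg' : g' ∈ motions) {j j' : Proto}
    (h : g '' T j = g' '' T j') : j = j' ∧ ∃ s ∈ L j, ∀ z, g z = g' (s.sim.eval z) := by
  obtain ⟨g'', hg'', h1, h2⟩ := exists_inverse_mem_motions hg'
  have h3 : (g'' ∘ g) '' T j = T j' := by
    rw [Set.image_comp, h, Set.image_image]
    simp [h2]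
  obtain ⟨rfl, s, hs, e⟩ := hT (comp_mem_motions hg'' hg) h3
  refine ⟨rfl, s, hs, fun z => ?_⟩
  rw [← e, Function.comp_apply, h1]

/-- The pieces of a tile do not depend on the way the tile is placed. -/
theorem split_tiles {P : Set (PlacedTile Proto)} (hP : ∀ t ∈ P, t.2 ∈ motions) :
    split (tiles tile P) = tiles dualTile (splitPlaced P) := by
  ext A
  constructor
  · rintro ⟨j, g, hg, ⟨⟨j', g'⟩, ht, e⟩, p, hp, rfl⟩
    obtain ⟨rfl, s, hs, e'⟩ := exists_symmetry mem_symmetries hg (hP _ ht) e.symm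
    rw [pieces_eq] at hp
    obtain ⟨c, hc, rfl⟩ := hp
    obtain ⟨c', hc', e''⟩ := symmetries_piece hs hc
    refine ⟨_, ⟨_, ht, c', hc', rfl⟩, ?_⟩
    have h1 : g '' piece j c = g' '' piece j c' := by
      rw [← e'', Set.image_image]
      exact Set.image_congr fun z _ => e' z
    change (fun z => g' (c'.sim.eval z)) '' dualTile j = _
    rw [h1, piece, Set.image_image]
  · rintro ⟨_, ⟨⟨j, g⟩, ht, c, hc, rfl⟩, rfl⟩
    refine ⟨j, g, hP _ ht, ⟨_, ht, rfl⟩, piece j c, ?_, ?_⟩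
    · rw [pieces_eq]
      exact ⟨c, hc, rfl⟩
    · change (fun z => g (c.sim.eval z)) '' dualTile j = _
      rw [piece, Set.image_image]

/-! ### Windows -/

theorem SimMap.comp_lin_ne_zero {f g : SimMap} (hf : f.lin ≠ 0) (hg : g.lin ≠ 0) :
    (f.comp g).lin ≠ 0 := by
  refine mul_ne_zero hf ?_
  split_ifs
  · simpa using hg
  · exact hg

/-- The similarity `f♯` maps the interior of a dual prototile into the interior of another one. -/
theorem sharp_mem_interior {i j : Proto} {f : SimMap} (hf : f ∈ system i j) {x : ℂ}
    (hx : x ∈ interior (dualTile j)) : f.sharp.eval x ∈ interior (dualTile i) := by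
  have hsub : f.sharp.eval '' dualTile j ⊆ dualTile i := by
    rw [isTileSubstitution_starDual.solution.2 i]
    intro z hz
    simp only [Set.mem_iUnion]
    exact ⟨j, f.sharp, ⟨f, hf, rfl⟩, hz⟩
  have hpos : 0 < ‖((f.sharp.lin : K) : ℂ)‖ := by
    have := isTileSubstitution_starDual.isometric j i f.sharp ⟨f, hf, rfl⟩
    rw [norm_mul] at this
    refine (norm_nonneg _).lt_of_ne fun h => ?_
    rw [← h, mul_zero] at this
    exact zero_ne_one this
  have h1 := interior_mono hsub
  rw [← f.sharp.isSimilarity.image_interior hpos] at h1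
  exact h1 ⟨x, hx, rfl⟩

/-- All tiles `G (T i)` of the patch `σᵏ (g (T j))`, up to a common translation, have a point `w` in
common in the interiors of their windows `G⋆ (dualTile i)`. This passes from a tile to its children
because `f♯` maps `dualTile j` into `dualTile i` for `f ∈ system i j`, and `(G ∘ f)⋆ ∘ f♯ = G⋆`. -/
theorem exists_window (k : ℕ) (j : Proto) {g : ℂ → ℂ} (hg : g ∈ motions) :
    ∃ w β : ℂ, ∀ t ∈ (substitute system lam)^[k] {(j, g)}, ∃ G : SimMap, G.lin ≠ 0 ∧
      (∀ z, t.2 z = G.eval z + β) ∧ w ∈ G.star.eval '' interior (dualTile t.1) := by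
  induction k with
  | zero =>
    obtain ⟨r, m, b, rfl⟩ := mem_motions_iff.1 hg
    let G : SimMap := ⟨r, xiK ^ m, 0⟩
    obtain ⟨x, hx⟩ : (interior (dualTile j)).Nonempty := interior_dualCorners_nonempty j
    refine ⟨G.star.eval x, b, ?_⟩
    rintro _ rfl
    refine ⟨G, pow_ne_zero _ xiK_ne_zero, fun z => ?_, x, hx, rfl⟩
    simp [G, similarity, SimMap.eval, xiK]
  | succ k ih =>
    obtain ⟨w, β, h⟩ := ih
    refine ⟨((starMap lam : K) : ℂ) * w, lam * β, ?_⟩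
    rintro ⟨i, g'⟩ ht
    rw [Function.iterate_succ_apply'] at ht
    obtain ⟨s, hs, f, hf, e⟩ := ht
    change g' = _ at e
    subst e
    obtain ⟨G, hG, hGz, x, hx, rfl⟩ := h s hs
    have hf0 : f.lin ≠ 0 := by
      have hf' := hf
      rw [encodes_children] at hf'
      obtain ⟨c, -, rfl⟩ := hf'
      exact c.child_lin_ne_zero
    refine ⟨SimMap.comp ⟨false, lam, 0⟩ (G.comp f),
      SimMap.comp_lin_ne_zero Cyc.lam_ne_zero (SimMap.comp_lin_ne_zero hG hf0), fun z => ?_,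
      f.sharp.eval x, sharp_mem_interior hf hx, ?_⟩
    · simp only [SimMap.eval_comp, hGz]
      simp [SimMap.eval]
      ring
    · rw [SimMap.star_comp, SimMap.star_comp, SimMap.eval_comp, SimMap.eval_comp,
        f.star_eval_sharp_eval hf0]
      simp [SimMap.star, SimMap.eval]

/-! ### Recognising the tiles from their pieces -/

/-- The tiles of the dissection of `λ² T j`. -/
def grandchildren (j : Proto) : List (Proto × Code) :=
  (children j).flatMap fun s => (children s.1).map fun t => (t.1, s.2.scale.comp t.2)

theorem mem_substitute_twice {j : Proto} {g : ℂ → ℂ} {t : PlacedTile Proto} :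
    t ∈ (substitute system lam)^[2] {(j, g)} ↔ ∃ d ∈ grandchildren j, t =
      (d.1, fun z => (lam : ℂ) ^ 2 * g (((lam : ℂ) ^ 2)⁻¹ * d.2.sim.eval z)) := by
  have hl := Code.lam_coe_ne_zero
  have key : ∀ (c c' : Code) z, c.child.eval (c'.child.eval z) =
      ((lam : ℂ) ^ 2)⁻¹ * (c.scale.comp c').sim.eval z := fun c c' z => by
    rw [Code.scale_comp_sim_eval, c.child_eval]
    field_simp
  have hit : (substitute system lam)^[2] {(j, g)} =
    substitute system lam (substitute system lam {(j, g)}) := rfl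
  rw [hit]
  obtain ⟨i, g'⟩ := t
  constructor
  · rintro ⟨⟨i', g1⟩, ⟨_, rfl, f, hf, e⟩, f', hf', e'⟩
    change g1 = _ at e
    change g' = _ at e'
    subst e e'
    rw [encodes_children] at hf hf'
    obtain ⟨c, hc, rfl⟩ := hf
    obtain ⟨c', hc', rfl⟩ := hf'
    refine ⟨(i, c.scale.comp c'), ?_, ?_⟩
    · simp only [grandchildren, List.mem_flatMap, List.mem_map]
      exact ⟨_, hc, _, hc', rfl⟩
    · simp only [← key]
      congr 1
      funext z
      ring
  · rintro ⟨d, hd, e⟩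
    simp only [grandchildren, List.mem_flatMap, List.mem_map] at hd
    obtain ⟨⟨i', c⟩, hc, ⟨i'', c'⟩, hc', rfl⟩ := hd
    obtain ⟨rfl, rfl⟩ := Prod.mk.inj e
    refine ⟨(i', fun z => lam * g (c.child.eval z)), ⟨_, rfl, c.child,
      encodes_children _ _ ▸ ⟨c, hc, rfl⟩, rfl⟩, c'.child,
      encodes_children _ _ ▸ ⟨c', hc', rfl⟩, ?_⟩
    simp only [← key]
    funext z
    ring

/-- The motions that carry `S` to a different triangle which also has the first piece of `S` as one
of its pieces. -/
def flips : Proto → List Code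
  | .S => [⟨false, 2, ⟨2, 0, 0, 0⟩⟩, ⟨true, 0, ⟨0, 0, 2, 0⟩⟩]
  | .L => []

/-- If two prototiles of the same kind are placed so that a piece of one occupies the same set as
the piece `p₀` of the other, then they occupy the same set or are flipped versions of each other. -/
theorem exists_relative_motion : ∀ j : Proto, ∃ p₀ ∈ pieceList j, ∀ p ∈ pieceList j,
    ∀ s ∈ dualSymmetries j, ∃ h ∈ symmetries j ++ flips j, p₀ = h.comp (p.comp s) := by
  decide +kernel

/-- Flipping a triangle in `λ² T j` gives a triangle whose window is separated from the window of
some rhomb in `λ² T j`. -/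
theorem separated_flip : ∀ j, ∀ d ∈ grandchildren j, ∀ h ∈ flips d.1,
    ∃ d' ∈ grandchildren j, d'.1 = .L ∧ ∀ s ∈ symmetries .L,
      Separated ((dualCorners .L).map (d'.2.comp s).star.act)
        ((dualCorners d.1).map (d.2.comp h).star.act) := by
  decide +kernel

theorem surjective_of_mem_motions {g : ℂ → ℂ} (hg : g ∈ motions) : Function.Surjective g := by
  obtain ⟨h, -, h1, -⟩ := exists_inverse_mem_motions hg
  exact fun z => ⟨h z, h1 z⟩

/-- The windows of two tiles of one patch overlap. The motion `γ` need not have coefficients in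
`ℚ(ξ)`, but up to a translation by `β` it does, so the windows can be compared with those of the
tiles before applying `γ`. -/
theorem not_separated_window {k : ℕ} {j i i' : Proto} {g γ : ℂ → ℂ} (hg : g ∈ motions)
    (hγ : γ ∈ motions) {c c' : Code}
    (h : ((i, fun z => γ (c.sim.eval z)) : PlacedTile Proto) ∈ (substitute system lam)^[k] {(j, g)})
    (h' : ((i', fun z => γ (c'.sim.eval z)) : PlacedTile Proto) ∈
      (substitute system lam)^[k] {(j, g)}) :
    ¬ Separated ((dualCorners i).map c.star.act) ((dualCorners i').map c'.star.act) := by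
  intro hsep
  obtain ⟨w, β, H⟩ := exists_window k j hg
  obtain ⟨G, hG, hGz, hw⟩ := H _ h
  obtain ⟨G', hG', hGz', hw'⟩ := H _ h'
  obtain ⟨r, m, b, rfl⟩ := mem_motions_iff.1 hγ
  simp only at hGz hGz' hw hw'
  let Γ : SimMap := ⟨r, xiK ^ m, G.trans - xiK ^ m * (if r then conjK (c.b.toK / 2)
    else c.b.toK / 2)⟩
  have hΓ : ∀ z, similarity r (xi ^ m) b z = Γ.eval z + β := by
    intro z
    have h0 := hGz 0
    cases r <;> simp [similarity, SimMap.eval, Code.sim, Γ, xiK, coe_conjK] at h0 ⊢ <;>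
      linear_combination h0
  have e : G = Γ.comp c.sim := SimMap.eval_injective hG (funext fun z => by
    rw [SimMap.eval_comp]
    exact add_right_cancel ((hGz z).symm.trans (hΓ _)))
  have e' : G' = Γ.comp c'.sim := SimMap.eval_injective hG' (funext fun z => by
    rw [SimMap.eval_comp]
    exact add_right_cancel ((hGz' z).symm.trans (hΓ _)))
  have hpos : 0 < ‖((Γ.star.lin : K) : ℂ)‖ := by
    rw [norm_pos_iff]
    intro h0
    have h1 : starMap (xiK ^ m) = 0 := Subtype.ext h0
    rw [map_pow, starMap_xiK] at h1
    exact pow_ne_zero _ (pow_ne_zero _ xiK_ne_zero) h1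
  obtain ⟨x, hx, rfl⟩ := hw
  obtain ⟨x', hx', hxx⟩ := hw'
  rw [e, e', SimMap.star_comp, SimMap.star_comp, SimMap.eval_comp, SimMap.eval_comp, Code.star_sim,
    Code.star_sim] at hxx
  have hxx' := Γ.star.isSimilarity.injective hpos hxx
  refine Set.disjoint_left.1 hsep.disjoint (show c.star.sim.eval x ∈ _ from ?_) ?_
  · rw [← Code.image_poly, ← c.star.isSimilarity.image_interior one_pos]
    exact ⟨x, hx, rfl⟩
  · rw [← Code.image_poly, ← c'.star.isSimilarity.image_interior one_pos]
    exact ⟨x', hx', hxx'⟩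

/-- If all pieces of the tile `δ (T j)` occur in the dissection of a patch, then the patch has the
tile `δ (T j)` or, if `j = S`, one of its flipped versions. -/
theorem exists_mem_of_pieces_mem {P : Set (PlacedTile Proto)} (hP : ∀ t ∈ P, t.2 ∈ motions)
    {j : Proto} {δ : ℂ → ℂ} (hδ : δ ∈ motions)
    (h : ∀ p ∈ pieceList j, (fun z => δ (p.sim.eval z)) '' dualTile j ∈
      tiles dualTile (splitPlaced P)) :
    ∃ c ∈ symmetries j ++ flips j, ((j, fun z => δ (c.sim.eval z)) : PlacedTile Proto) ∈ P := by
  obtain ⟨p₀, hp₀, H⟩ := exists_relative_motion j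
  obtain ⟨_, ⟨⟨j', g'⟩, ht, p, hp, rfl⟩, e⟩ := h p₀ hp₀
  have hg' : g' ∈ motions := hP _ ht
  obtain ⟨rfl, s, hs, e'⟩ := exists_symmetry mem_dualSymmetries
    (comp_mem_motions hδ p₀.sim_eval_mem_motions)
    (comp_mem_motions hg' p.sim_eval_mem_motions) e.symm
  obtain ⟨c, hc, rfl⟩ := H p hp s hs
  refine ⟨c, hc, ?_⟩
  convert! ht using 2
  funext z
  obtain ⟨y, rfl⟩ := surjective_of_mem_motions (p.comp s).sim_eval_mem_motions z
  have := e' y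
  simpa [Code.sim_comp, SimMap.eval_comp] using this

theorem mem_splitPlaced_tiles {P : Set (PlacedTile Proto)} {t : PlacedTile Proto} (ht : t ∈ P)
    {p : Code} (hp : p ∈ pieceList t.1) :
    (fun z => t.2 (p.sim.eval z)) '' dualTile t.1 ∈ tiles dualTile (splitPlaced P) :=
  ⟨_, ⟨t, ht, p, hp, rfl⟩, rfl⟩

theorem split_patch (k : ℕ) (j : Proto) {g : ℂ → ℂ} (hg : g ∈ motions) :
    split (patch system lam tile k j g) =
      tiles dualTile (splitPlaced ((substitute system lam)^[k] {(j, g)})) :=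
  split_tiles fun _ ht => mem_motions_of_mem_iterate encodes_children rfl hg ht

/-- Recognisability: the dissection of `σ² (g (T j))` determines the tiles, within any patch of the
substitution. -/
theorem patch_subset_of_split_subset {k : ℕ} {j₁ j₂ : Proto} {g₁ g₂ : ℂ → ℂ} (hg₁ : g₁ ∈ motions)
    (hg₂ : g₂ ∈ motions)
    (h : split (patch system lam tile 2 j₁ g₁) ⊆ split (patch system lam tile k j₂ g₂)) :
    patch system lam tile 2 j₁ g₁ ⊆ patch system lam tile k j₂ g₂ := by
  rw [split_patch _ _ hg₁, split_patch _ _ hg₂] at h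
  have hl := Code.lam_coe_ne_zero
  let γ : ℂ → ℂ := fun z => (lam : ℂ) ^ 2 * g₁ (((lam : ℂ) ^ 2)⁻¹ * z)
  have hγ : γ ∈ motions := by
    have := conj_homothety_mem_motions hg₁ (a := ((lam : ℂ) ^ 2)⁻¹) (inv_ne_zero (pow_ne_zero 2 hl))
      (by rw [map_inv₀, map_pow, Code.conj_lam])
    rwa [inv_inv] at this
  have hmem : ∀ d ∈ grandchildren j₁, ∃ c ∈ symmetries d.1 ++ flips d.1,
      ((d.1, fun z => γ (d.2.sim.eval (c.sim.eval z))) : PlacedTile Proto) ∈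
        (substitute system lam)^[k] {(j₂, g₂)} := fun d hd =>
    exists_mem_of_pieces_mem
      (fun t ht => mem_motions_of_mem_iterate encodes_children rfl hg₂ ht)
      (comp_mem_motions hγ d.2.sim_eval_mem_motions)
      fun p hp => h (mem_splitPlaced_tiles (mem_substitute_twice.2 ⟨d, hd, rfl⟩) hp)
  have hcomp : ∀ c c' : Code, (fun z => γ (c.sim.eval (c'.sim.eval z))) =
      fun z => γ ((c.comp c').sim.eval z) := fun c c' => by
    simp only [Code.sim_comp, SimMap.eval_comp]
  rintro _ ⟨t, ht, rfl⟩
  obtain ⟨d, hd, rfl⟩ := mem_substitute_twice.1 ht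
  obtain ⟨c, hc, hP⟩ := hmem d hd
  rcases List.mem_append.1 hc with hc | hc
  · refine ⟨_, hP, ?_⟩
    change (fun z => γ (d.2.sim.eval (c.sim.eval z))) '' tile d.1 =
      (fun z => γ (d.2.sim.eval z)) '' tile d.1
    conv_rhs => rw [← symmetries_image hc, Set.image_image]
  · exfalso
    obtain ⟨⟨_, d'⟩, hd', rfl, hsep⟩ := separated_flip j₁ d hd c hc
    obtain ⟨s, hs, hP'⟩ := hmem _ hd'
    simp only [flips, List.append_nil] at hs
    rw [hcomp] at hP hP'
    exact not_separated_window hg₂ hγ hP' hP (hsep s hs)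

/-! ### Patches of the dual substitution -/

/-- Patches of the dual substitution extend to dissected patches, because each dual prototile is a
piece of a prototile. -/
theorem exists_dualPatch_subset (k : ℕ) (i : Proto) {g : ℂ → ℂ} (hg : g ∈ motions) :
    ∃ g' ∈ motions, patch system.starDual dualFactor dualTile k i g ⊆
      split (patch system lam tile k i g') := by
  obtain ⟨p, hp⟩ : ∃ p, p ∈ pieceList i := ⟨_, List.getElem_mem (n := 0) (by cases i <;> decide)⟩
  obtain ⟨g₀, hg₀, rfl⟩ := exists_eq_comp hg p.sim_eval_mem_motions
  obtain ⟨g', hg', h⟩ := substitute_iterate_splitPlaced k i hg₀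
  refine ⟨g', hg', ?_⟩
  rw [split_patch _ _ hg', ← h]
  exact tiles_mono (substitute_iterate_mono _ (Set.singleton_subset_iff.2 ⟨_, rfl, p, hp, rfl⟩))

/-- The dual substitution of `S` contains all pieces of a triangle and of a rhomb, placed by the
motions in this list. -/
def dualPlacement : Proto → Code
  | .S => ⟨true, 6, ⟨3, -1, -1, -3⟩⟩
  | .L => ⟨false, 0, ⟨1, -1, -1, -3⟩⟩

theorem dualPlacement_comp_mem : ∀ j, ∀ p ∈ pieceList j,
    (j, (dualPlacement j).comp p) ∈ dualList children .S := by
  decide +kernel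

/-- Dissected patches extend to patches of the dual substitution. -/
theorem exists_split_subset_dualPatch (k : ℕ) (j : Proto) {g : ℂ → ℂ} (hg : g ∈ motions) :
    ∃ g' ∈ motions, split (patch system lam tile k j g) ⊆
      patch system.starDual dualFactor dualTile (k + 1) .S g' := by
  obtain ⟨g₀, hg₀, h⟩ := substitute_iterate_splitPlaced' k j hg
  obtain ⟨g₁, hg₁, rfl⟩ := exists_eq_comp hg₀ (dualPlacement j).sim_eval_mem_motions
  have hl := Code.lam_coe_ne_zero
  refine ⟨_, neg_mem_motions (conj_homothety_mem_motions hg₁ hl Code.conj_lam), ?_⟩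
  rw [split_patch _ _ hg, h, patch, Function.iterate_succ_apply]
  refine tiles_mono (substitute_iterate_mono _ ?_)
  rintro _ ⟨_, rfl, p, hp, rfl⟩
  refine ⟨_, rfl, ((dualPlacement j).comp p).child,
    encodes_dualList encodes_children _ _ ▸ ⟨_, dualPlacement_comp_mem j p hp, rfl⟩, ?_⟩
  funext z
  simp [dualFactor_eq, Code.child_eval, Code.sim_comp, SimMap.eval_comp, hl]

/-! ### Tilings -/

theorem mem_tilingSpace_iff {ι : Type} {F : MatrixSystem ι} {q : ℂ} {T : ι → Set ℂ} (hq : q ≠ 0)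
    {𝒯 : Set (Set ℂ)} : 𝒯 ∈ tilingSpace F q T ↔ IsTiling 𝒯 ∧ ∀ P ⊆ 𝒯, P.Finite →
      ∃ (k : ℕ) (j : ι), ∃ g ∈ motions, P ⊆ patch F q T k j g := by
  simp only [tilingSpace, Set.mem_ofPred_eq, exists_superPatch_iff _ hq]

theorem dualFactor_ne_zero : dualFactor ≠ 0 := by
  rw [dualFactor_eq]
  exact neg_ne_zero.2 Code.lam_coe_ne_zero

section generic

variable {ι : Type} {F : MatrixSystem ι} {q : ℂ} {T : ι → Set ℂ}

theorem exists_eq_image_of_mem_patch (h : IsTileSubstitution F q T) {k : ℕ} {j : ι} {g : ℂ → ℂ}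
    (hg : g ∈ motions) {t : Set ℂ} (ht : t ∈ patch F q T k j g) :
    ∃ i h, IsSimilarity 1 h ∧ t = h '' T i := by
  obtain ⟨s, hs, rfl⟩ := ht
  exact ⟨s.1, s.2, (isPlacement_iterate h k j hg).1 s hs, rfl⟩

theorem nonOverlapping_patch (h : IsTileSubstitution F q T) (k : ℕ) (j : ι) {g : ℂ → ℂ}
    (hg : g ∈ motions) : NonOverlapping (patch F q T k j g) :=
  (isPlacement_iterate h k j hg).nonOverlapping h

theorem mem_tilingSpace_of_cover (h : IsTileSubstitution F q T) {𝒯 : Set (Set ℂ)}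
    (hcover : ⋃₀ 𝒯 = Set.univ) (hfin : ∀ P ⊆ 𝒯, P.Finite →
      ∃ (k : ℕ) (j : ι), ∃ g ∈ motions, P ⊆ patch F q T k j g) :
    𝒯 ∈ tilingSpace F q T := by
  have hq : q ≠ 0 := norm_pos_iff.1 (one_pos.trans h.expanding)
  refine (mem_tilingSpace_iff hq).2 ⟨⟨fun t ht => ?_, hcover, fun t ht t' ht' hne => ?_⟩, hfin⟩
  · obtain ⟨k, j, g, hg, hP⟩ := hfin {t} (Set.singleton_subset_iff.2 ht) (Set.finite_singleton t)
    rw [Set.singleton_subset_iff] at hP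
    have h1 := (nonOverlapping_patch h k j hg).1 t hP
    obtain ⟨i, g', hg', rfl⟩ := exists_eq_image_of_mem_patch h hg hP
    exact ⟨h1.2, (h.solution.1 i).1.image hg'.continuous, h1.1⟩
  · obtain ⟨k, j, g, hg, hP⟩ := hfin {t, t'} (Set.pair_subset ht ht') (Set.toFinite _)
    exact (nonOverlapping_patch h k j hg).2 t (hP (Set.mem_insert _ _)) t'
      (hP (Set.mem_insert_of_mem _ rfl)) hne

/-- If the tiles of a tiling near `q` belong to a set of non-overlapping tiles which has `q` as a
member, then `q` is a tile of the tiling. -/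
theorem IsTiling.mem_of_nonOverlapping {𝒯 E : Set (Set ℂ)} (h𝒯 : IsTiling 𝒯)
    (hE : NonOverlapping E) {t : Set ℂ} (ht : t ∈ E)
    (hsub : ∀ s ∈ 𝒯, (s ∩ t).Nonempty → s ∈ E) : t ∈ 𝒯 := by
  obtain ⟨x, hx⟩ : (interior t).Nonempty := by
    rw [← closure_nonempty_iff, (hE.1 t ht).1]
    exact (hE.1 t ht).2
  obtain ⟨s, hs, hxs⟩ : ∃ s ∈ 𝒯, x ∈ s := by
    have : x ∈ ⋃₀ 𝒯 := h𝒯.cover ▸ Set.mem_univ x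
    exact this
  by_contra hne
  have hst : s ≠ t := fun e => hne (e ▸ hs)
  have hsE := hsub s hs ⟨x, hxs, interior_subset hx⟩
  have h1 := (hE.2 t ht s hsE hst.symm).closure_right isOpen_interior
  rw [(hE.1 s hsE).1] at h1
  exact Set.disjoint_left.1 h1 hx hxs

end generic

section finite

variable {F : MatrixSystem Proto} {q : ℂ} {T : Proto → Set ℂ}

/-- A bound for the diameters of the tiles. -/
def diamBound (T : Proto → Set ℂ) : ℝ := Metric.diam (T .S) + Metric.diam (T .L)

theorem dist_le_diamBound (h : IsTileSubstitution F q T) {j : Proto} {x y : ℂ} (hx : x ∈ T j)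
    (hy : y ∈ T j) : dist x y ≤ diamBound T := by
  have h1 := Metric.dist_le_diam_of_mem (h.solution.1 j).1.isBounded hx hy
  have h2 : 0 ≤ Metric.diam (T .S) := Metric.diam_nonneg
  have h3 : 0 ≤ Metric.diam (T .L) := Metric.diam_nonneg
  cases j <;> simp only [diamBound] <;> linarith

theorem image_subset_closedBall (h : IsTileSubstitution F q T) {s : ℝ} {g : ℂ → ℂ}
    (hg : IsSimilarity s g) {j : Proto} {x : ℂ} (hx : x ∈ g '' T j) :
    g '' T j ⊆ Metric.closedBall x (s * diamBound T) := by
  obtain ⟨y, hy, rfl⟩ := hx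
  rintro _ ⟨z, hz, rfl⟩
  rw [Metric.mem_closedBall, hg.dist_map]
  exact mul_le_mul_of_nonneg_left (dist_le_diamBound h hz hy) hg.nonneg

/-- Tilings are locally finite, because the interiors of the tiles have areas that are bounded below
and are disjoint. -/
theorem finite_patchAt_closedBall (h : IsTileSubstitution F q T) {𝒯 : Set (Set ℂ)}
    (h𝒯 : 𝒯 ∈ tilingSpace F q T) (x : ℂ) (R : ℝ) :
    (patchAt 𝒯 (Metric.closedBall x R)).Finite := by
  have hq : q ≠ 0 := norm_pos_iff.1 (one_pos.trans h.expanding)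
  rw [mem_tilingSpace_iff hq] at h𝒯
  have hcopy : ∀ t ∈ 𝒯, ∃ i h, IsSimilarity 1 h ∧ t = h '' T i := fun t ht => by
    obtain ⟨k, j, g, hg, hP⟩ := h𝒯.2 {t} (Set.singleton_subset_iff.2 ht) (Set.finite_singleton t)
    exact exists_eq_image_of_mem_patch h hg (Set.singleton_subset_iff.1 hP)
  let ε := min (MeasureTheory.volume (interior (T .S))) (MeasureTheory.volume (interior (T .L)))
  have hint : ∀ j, (interior (T j)).Nonempty := fun j => by
    rw [← closure_nonempty_iff, h.regular]
    exact (h.solution.1 j).2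
  have hε : 0 < ε := lt_min (isOpen_interior.measure_pos _ (hint _))
    (isOpen_interior.measure_pos _ (hint _))
  have hε' : ∀ j, ε ≤ MeasureTheory.volume (interior (T j)) := fun j => by
    cases j
    · exact min_le_left _ _
    · exact min_le_right _ _
  have hfin := MeasureTheory.Measure.finite_const_le_meas_of_disjoint_iUnion
    MeasureTheory.volume hε
    (As := fun t : patchAt 𝒯 (Metric.closedBall x R) => interior (t : Set ℂ))
    (fun t => isOpen_interior.measurableSet)
    (fun t t' hne => h𝒯.1.nonoverlapping t t.2.1 t' t'.2.1 fun e => hne (Subtype.ext e)) (by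
      refine ((MeasureTheory.measure_mono (Set.iUnion_subset fun t => ?_)).trans_lt
        (isCompact_closedBall x (R + diamBound T)).measure_lt_top).ne
      obtain ⟨t, ht, y, hyt, hy⟩ := t
      obtain ⟨i, g, hg, rfl⟩ := hcopy t ht
      refine interior_subset.trans ((image_subset_closedBall h hg hyt).trans ?_)
      rw [one_mul]
      refine Metric.closedBall_subset_closedBall' ?_
      rw [Metric.mem_closedBall] at hy
      linarith)
  have huniv : {t : patchAt 𝒯 (Metric.closedBall x R) |
      ε ≤ MeasureTheory.volume (interior (t : Set ℂ))} = Set.univ := by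
    refine Set.eq_univ_of_forall fun t => ?_
    obtain ⟨t, ht, -⟩ := t
    obtain ⟨i, g, hg, rfl⟩ := hcopy t ht
    change ε ≤ MeasureTheory.volume (interior (g '' T i))
    rw [← hg.image_interior one_pos, hg.volume_image one_pos]
    simpa using hε' i
  rw [huniv] at hfin
  exact Set.finite_coe_iff.1 (Set.finite_univ_iff.1 hfin)

end finite

/-! ### Dissecting tilings -/

theorem split_mono {P P' : Set (Set ℂ)} (h : P ⊆ P') : split P ⊆ split P' :=
  fun _ ⟨j, g, hg, ht, p, hp, e⟩ => ⟨j, g, hg, h ht, p, hp, e⟩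

theorem exists_subset_of_mem_split {P : Set (Set ℂ)} {A : Set ℂ} (hA : A ∈ split P) :
    ∃ t ∈ P, A ⊆ t := by
  obtain ⟨j, g, -, ht, p, hp, rfl⟩ := hA
  refine ⟨_, ht, Set.image_mono ?_⟩
  rw [← sUnion_pieces j]
  exact Set.subset_sUnion_of_mem hp

theorem exists_finite_parents {P 𝒯 : Set (Set ℂ)} (hP : P ⊆ split 𝒯) (hfin : P.Finite) :
    ∃ P₀ ⊆ 𝒯, P₀.Finite ∧ P ⊆ split P₀ := by
  have : Nonempty Proto := ⟨.S⟩
  have h : ∀ A ∈ P, ∃ j, ∃ g ∈ motions, g '' tile j ∈ 𝒯 ∧ ∃ p ∈ pieces j, A = g '' p :=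
    fun A hA => hP hA
  choose! j g hg ht p hp e using h
  refine ⟨(fun A => g A '' tile (j A)) '' P, ?_, hfin.image _, fun A hA => ?_⟩
  · rintro _ ⟨A, hA, rfl⟩
    exact ht A hA
  · exact ⟨j A, g A, hg A hA, ⟨A, hA, rfl⟩, p A, hp A hA, e A hA⟩

theorem mem_translate {v : ℂ} {P : Set (Set ℂ)} {t : Set ℂ} :
    t ∈ translate v P ↔ -v +ᵥ t ∈ P := by
  constructor
  · rintro ⟨s, hs, rfl⟩
    simpa using hs
  · exact fun h => ⟨_, h, by simp⟩

theorem vadd_image (v : ℂ) (g : ℂ → ℂ) (A : Set ℂ) : v +ᵥ g '' A = (fun z => v + g z) '' A := by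
  change (fun z => v + z) '' (g '' A) = _
  rw [Set.image_image]

theorem split_translate_subset (v : ℂ) (P : Set (Set ℂ)) :
    split (translate v P) ⊆ translate v (split P) := by
  rintro _ ⟨j, g, hg, ht, p, hp, rfl⟩
  rw [mem_translate, vadd_image] at ht
  rw [mem_translate, vadd_image]
  exact ⟨j, _, add_mem_motions _ hg, ht, p, hp, rfl⟩

theorem exists_patch_of_finite {𝒯 P : Set (Set ℂ)} (h : 𝒯 ∈ tilings) (hP : P ⊆ 𝒯)
    (hfin : P.Finite) : ∃ (k : ℕ) (j : Proto), ∃ g ∈ motions, P ⊆ patch system lam tile k j g :=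
  ((mem_tilingSpace_iff Code.lam_coe_ne_zero).1 h).2 P hP hfin

theorem exists_motion_of_mem_patch {k : ℕ} {j : Proto} {g : ℂ → ℂ} (hg : g ∈ motions) {t : Set ℂ}
    (ht : t ∈ patch system lam tile k j g) : ∃ i, ∃ h ∈ motions, t = h '' tile i := by
  obtain ⟨s, hs, rfl⟩ := ht
  exact ⟨s.1, s.2, mem_motions_of_mem_iterate encodes_children rfl hg hs, rfl⟩

theorem exists_motion_of_mem_tilings {𝒯 : Set (Set ℂ)} (h : 𝒯 ∈ tilings) {t : Set ℂ}
    (ht : t ∈ 𝒯) : ∃ i, ∃ h ∈ motions, t = h '' tile i := by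
  obtain ⟨k, j, g, hg, hP⟩ := exists_patch_of_finite h (Set.singleton_subset_iff.2 ht)
    (Set.finite_singleton t)
  exact exists_motion_of_mem_patch hg (Set.singleton_subset_iff.1 hP)

theorem sUnion_split {P : Set (Set ℂ)} (hP : ∀ t ∈ P, ∃ i, ∃ h ∈ motions, t = h '' tile i) :
    ⋃₀ split P = ⋃₀ P := by
  ext x
  constructor
  · rintro ⟨A, hA, hx⟩
    obtain ⟨t, ht, h⟩ := exists_subset_of_mem_split hA
    exact ⟨t, ht, h hx⟩
  · rintro ⟨t, ht, hx⟩
    obtain ⟨i, h, hh, rfl⟩ := hP t ht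
    obtain ⟨y, hy, rfl⟩ := hx
    rw [← sUnion_pieces i] at hy
    obtain ⟨p, hp, hy⟩ := hy
    exact ⟨_, ⟨i, h, hh, ht, p, hp, rfl⟩, y, hy, rfl⟩

theorem finite_split_patch_two (j : Proto) {g : ℂ → ℂ} (hg : g ∈ motions) :
    (split (patch system lam tile 2 j g)).Finite := by
  rw [split_patch _ _ hg]
  have h1 : ((substitute system lam)^[2] {(j, g)}).Finite := by
    refine ((List.finite_toSet (grandchildren j)).image fun d =>
      (d.1, fun z => (lam : ℂ) ^ 2 * g (((lam : ℂ) ^ 2)⁻¹ * d.2.sim.eval z))).subset ?_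
    intro t ht
    obtain ⟨d, hd, rfl⟩ := mem_substitute_twice.1 ht
    exact ⟨d, hd, rfl⟩
  refine Set.Finite.image _ ((h1.biUnion fun s _ => ((List.finite_toSet (pieceList s.1)).image
    fun c => ((s.1, fun z => s.2 (c.sim.eval z)) : PlacedTile Proto))).subset ?_)
  rintro _ ⟨s, hs, c, hc, rfl⟩
  simp only [Set.mem_iUnion]
  exact ⟨s, hs, c, hc, rfl⟩

/-- Every tile of a patch contains a tile of its dissection. -/
theorem exists_mem_split_subset {k : ℕ} {j : Proto} {g : ℂ → ℂ} (hg : g ∈ motions) {t : Set ℂ}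
    (ht : t ∈ patch system lam tile k j g) :
    ∃ A ∈ split (patch system lam tile k j g), A ⊆ t ∧ (interior A).Nonempty := by
  obtain ⟨i, h, hh, rfl⟩ := exists_motion_of_mem_patch hg ht
  obtain ⟨p, hp⟩ : ∃ p, p ∈ pieceList i := ⟨_, List.getElem_mem (n := 0) (by cases i <;> decide)⟩
  refine ⟨h '' piece i p, ⟨i, h, hh, ht, _, ?_, rfl⟩, Set.image_mono (piece_subset hp), ?_⟩
  · rw [pieces_eq]
    exact ⟨p, hp, rfl⟩
  · rw [← (isSimilarity_of_mem_motions hh).image_interior one_pos]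
    exact (interior_piece_nonempty i p).image _

/-- Recognisability of supertiles within a tiling. -/
theorem patch_subset_of_split_subset_split {𝒯 : Set (Set ℂ)} (h𝒯 : 𝒯 ∈ tilings) {j : Proto}
    {g : ℂ → ℂ} (hg : g ∈ motions) (h : split (patch system lam tile 2 j g) ⊆ split 𝒯) :
    patch system lam tile 2 j g ⊆ 𝒯 := by
  obtain ⟨P, hP𝒯, hPfin, hP⟩ := exists_finite_parents h (finite_split_patch_two j hg)
  obtain ⟨k, j', g', hg', hE⟩ := exists_patch_of_finite h𝒯 hP𝒯 hPfin
  have hsub := patch_subset_of_split_subset hg hg' (hP.trans (split_mono hE))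
  intro t ht
  obtain ⟨A, hA, hAt, hne⟩ := exists_mem_split_subset hg ht
  obtain ⟨s, hs, hAs⟩ := exists_subset_of_mem_split (hP hA)
  have hst : s = t := by
    by_contra hst
    have hd := (nonOverlapping_patch isTileSubstitution_system k j' hg').2 s (hE hs) t (hsub ht) hst
    obtain ⟨x, hx⟩ := hne
    exact Set.disjoint_left.1 hd (interior_mono hAs hx) (interior_mono hAt hx)
  exact hst ▸ hP𝒯 hs

/-- A bound for the diameters of the patches `σ² (g (T j))`. -/
def patchRadius : ℝ := ‖(lam : ℂ)‖ ^ 2 * diamBound tile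

/-- Each tile `t` of a patch `σ^(k+2) (g (T j))` belongs to a subpatch `σ² (h (T i))`, all of whose
tiles are close to each point of `t`. -/
theorem exists_subpatch {k : ℕ} {j : Proto} {g : ℂ → ℂ} (hg : g ∈ motions) {t : Set ℂ}
    (ht : t ∈ patch system lam tile (k + 2) j g) : ∃ i, ∃ h ∈ motions,
      t ∈ patch system lam tile 2 i h ∧
      patch system lam tile 2 i h ⊆ patch system lam tile (k + 2) j g ∧
      ∀ x ∈ t, ∀ s ∈ patch system lam tile 2 i h, s ⊆ Metric.closedBall x patchRadius := by
  obtain ⟨u, hu, rfl⟩ := ht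
  rw [add_comm, Function.iterate_add_apply] at hu
  obtain ⟨⟨i, h⟩, hs, hus⟩ := mem_substitute_iterate.1 hu
  have hh : h ∈ motions := mem_motions_of_mem_iterate encodes_children rfl hg hs
  refine ⟨i, h, hh, ⟨u, hus, rfl⟩, ?_, ?_⟩
  · rw [patch, patch, add_comm k, Function.iterate_add_apply]
    exact tiles_mono (substitute_iterate_mono 2 (Set.singleton_subset_iff.2 hs))
  · have hsim : IsSimilarity (‖(lam : ℂ)‖ ^ 2) fun z => (lam : ℂ) ^ 2 * h z := by
      have := IsSimilarity.comp (s := ‖(lam : ℂ) ^ 2‖) (g := fun z => (lam : ℂ) ^ 2 * z)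
        ⟨false, (lam : ℂ) ^ 2, 0, rfl, by funext z; simp [similarity]⟩
        (isSimilarity_of_mem_motions hh)
      rwa [mul_one, norm_pow] at this
    rintro x hx _ ⟨s, hs, rfl⟩
    exact (image_subset_of_mem_iterate isTileSubstitution_system hs).trans
      (image_subset_closedBall isTileSubstitution_system hsim
        (image_subset_of_mem_iterate isTileSubstitution_system hus hx))

/-- Each tile of an Ammann–Beenker tiling belongs to a patch `σ² (g (T j))` of the tiling. -/
theorem exists_patch_subset_tiling {𝒯 : Set (Set ℂ)} (h𝒯 : 𝒯 ∈ tilings) {t : Set ℂ}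
    (ht : t ∈ 𝒯) {x : ℂ} (hx : x ∈ t) : ∃ i, ∃ h ∈ motions, t ∈ patch system lam tile 2 i h ∧
      patch system lam tile 2 i h ⊆ 𝒯 ∧
      ∀ s ∈ patch system lam tile 2 i h, s ⊆ Metric.closedBall x patchRadius := by
  have hT := ((mem_tilingSpace_iff Code.lam_coe_ne_zero).1 h𝒯).1
  obtain ⟨k, j, g, hg, hP⟩ := exists_patch_of_finite h𝒯
    (P := insert t (patchAt 𝒯 (Metric.closedBall x patchRadius)))
    (Set.insert_subset ht fun s hs => hs.1)
    ((finite_patchAt_closedBall isTileSubstitution_system h𝒯 x patchRadius).insert t)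
  obtain ⟨j', g', hg', hsub⟩ := patch_subset_patch_add 2 k j hg
  obtain ⟨i, h, hh, ht', hsub', hball⟩ := exists_subpatch hg' (hsub (hP (Set.mem_insert _ _)))
  refine ⟨i, h, hh, ht', fun s hs => ?_, hball x hx⟩
  refine hT.mem_of_nonOverlapping (nonOverlapping_patch isTileSubstitution_system (k + 2) j' hg')
    (hsub' hs) fun u hu ⟨y, hyu, hys⟩ => hsub (hP (Set.mem_insert_of_mem _ ⟨hu, y, hyu, ?_⟩))
  exact hball x hx s hs hys

theorem nonOverlapping_split_patch (k : ℕ) (j : Proto) {g : ℂ → ℂ} (hg : g ∈ motions) :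
    NonOverlapping (split (patch system lam tile k j g)) := by
  obtain ⟨g', hg', h⟩ := exists_split_subset_dualPatch k j hg
  have hn := nonOverlapping_patch isTileSubstitution_starDual (k + 1) .S hg'
  exact ⟨fun t ht => hn.1 t (h ht), fun t ht t' ht' => hn.2 t (h ht) t' (h ht')⟩

/-- Each tile of a tiling of the dual substitution belongs to the dissection of a patch
`σ² (g (T j))`, all of whose pieces are tiles of the tiling. -/
theorem exists_split_patch_subset_tiling {𝒯 : Set (Set ℂ)}
    (h𝒯 : 𝒯 ∈ tilingSpace system.starDual dualFactor dualTile) {A : Set ℂ} (hA : A ∈ 𝒯) :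
    ∃ i, ∃ h ∈ motions, A ∈ split (patch system lam tile 2 i h) ∧
      split (patch system lam tile 2 i h) ⊆ 𝒯 := by
  have hT := (mem_tilingSpace_iff dualFactor_ne_zero).1 h𝒯
  obtain ⟨x, hx⟩ := (hT.1.tile A hA).1
  obtain ⟨k, j₀, g₀, hg₀, hP⟩ := hT.2
    (insert A (patchAt 𝒯 (Metric.closedBall x patchRadius)))
    (Set.insert_subset hA fun s hs => hs.1)
    ((finite_patchAt_closedBall isTileSubstitution_starDual h𝒯 x patchRadius).insert A)
  obtain ⟨g₁, hg₁, h₁⟩ := exists_dualPatch_subset k j₀ hg₀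
  obtain ⟨j, g, hg, h₂⟩ := patch_subset_patch_add 2 k j₀ hg₁
  have hsub : patch system.starDual dualFactor dualTile k j₀ g₀ ⊆
      split (patch system lam tile (k + 2) j g) := h₁.trans (split_mono h₂)
  obtain ⟨j', g', hg', ht, p, hp, e⟩ := hsub (hP (Set.mem_insert _ _))
  have hAt : A ⊆ g' '' tile j' := by
    rw [e, ← sUnion_pieces j']
    exact Set.image_mono (Set.subset_sUnion_of_mem hp)
  obtain ⟨i, h, hh, ht', hsub', hball⟩ := exists_subpatch hg ht
  refine ⟨i, h, hh, ⟨j', g', hg', ht', p, hp, e⟩, fun B hB => ?_⟩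
  obtain ⟨s, hs, hBs⟩ := exists_subset_of_mem_split hB
  refine hT.1.mem_of_nonOverlapping (nonOverlapping_split_patch (k + 2) j hg)
    (split_mono hsub' hB) fun u hu ⟨y, hyu, hyB⟩ =>
      hsub (hP (Set.mem_insert_of_mem _ ⟨hu, y, hyu, ?_⟩))
  exact hball x (hAt hx) s hs (hBs hyB)

/-! ### The bijection and the local rules -/

theorem split_mem_tilingSpace {𝒯 : Set (Set ℂ)} (h : 𝒯 ∈ tilings) :
    split 𝒯 ∈ tilingSpace system.starDual dualFactor dualTile := by
  refine mem_tilingSpace_of_cover isTileSubstitution_starDual ?_ fun P hP hfin => ?_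
  · rw [sUnion_split fun t => exists_motion_of_mem_tilings h]
    exact ((mem_tilingSpace_iff Code.lam_coe_ne_zero).1 h).1.cover
  · obtain ⟨P₀, hP₀, hfin₀, hsub⟩ := exists_finite_parents hP hfin
    obtain ⟨k, j, g, hg, hE⟩ := exists_patch_of_finite h hP₀ hfin₀
    obtain ⟨g', hg', hD⟩ := exists_split_subset_dualPatch k j hg
    exact ⟨k + 1, .S, g', hg', hsub.trans ((split_mono hE).trans hD)⟩

theorem subset_of_split_eq {𝒯 𝒯' : Set (Set ℂ)} (h : 𝒯 ∈ tilings) (h' : 𝒯' ∈ tilings)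
    (e : split 𝒯 = split 𝒯') : 𝒯 ⊆ 𝒯' := fun t ht => by
  obtain ⟨x, hx⟩ := (((mem_tilingSpace_iff Code.lam_coe_ne_zero).1 h).1.tile t ht).1
  obtain ⟨i, g, hg, htg, hsub, -⟩ := exists_patch_subset_tiling h ht hx
  exact patch_subset_of_split_subset_split h' hg (e ▸ split_mono hsub) htg

/-- The tiling with a given dissection `𝒯` consists of all patches `σ² (g (T j))` whose dissections
belong to `𝒯`. -/
theorem exists_split_eq {𝒯 : Set (Set ℂ)}
    (h : 𝒯 ∈ tilingSpace system.starDual dualFactor dualTile) :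
    ∃ 𝒯₀ ∈ tilings, split 𝒯₀ = 𝒯 := by
  have hT := (mem_tilingSpace_iff dualFactor_ne_zero).1 h
  let 𝒯₀ : Set (Set ℂ) := {t | ∃ j, ∃ g ∈ motions, split (patch system lam tile 2 j g) ⊆ 𝒯 ∧
    t ∈ patch system lam tile 2 j g}
  have hcopy : ∀ t ∈ 𝒯₀, ∃ i, ∃ h ∈ motions, t = h '' tile i := by
    rintro t ⟨j, g, hg, -, ht⟩
    exact exists_motion_of_mem_patch hg ht
  have hsplit : split 𝒯₀ = 𝒯 := by
    refine subset_antisymm ?_ fun A hA => ?_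
    · rintro A ⟨i, h, hh, ⟨j, g, hg, hsub, ht⟩, p, hp, e⟩
      exact hsub ⟨i, h, hh, ht, p, hp, e⟩
    · obtain ⟨j, g, hg, hAg, hsub⟩ := exists_split_patch_subset_tiling h hA
      exact split_mono (show patch system lam tile 2 j g ⊆ 𝒯₀ from
        fun t ht => ⟨j, g, hg, hsub, ht⟩) hAg
  refine ⟨𝒯₀, mem_tilingSpace_of_cover isTileSubstitution_system ?_ fun P hP hfin => ?_, hsplit⟩
  · rw [← sUnion_split hcopy, hsplit]
    exact hT.1.cover
  · have : Nonempty Proto := ⟨.S⟩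
    have h₀ : ∀ t ∈ P, ∃ j, ∃ g ∈ motions, split (patch system lam tile 2 j g) ⊆ 𝒯 ∧
      t ∈ patch system lam tile 2 j g := fun t ht => hP ht
    choose! j g hg hsub ht using h₀
    obtain ⟨k, i, g₁, hg₁, hD⟩ := hT.2 (⋃ t ∈ P, split (patch system lam tile 2 (j t) (g t)))
      (Set.iUnion₂_subset fun t htP => hsub t htP)
      (hfin.biUnion fun t htP => finite_split_patch_two _ (hg t htP))
    obtain ⟨g₂, hg₂, hE⟩ := exists_dualPatch_subset k i hg₁
    refine ⟨k, i, g₂, hg₂, fun t htP => ?_⟩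
    exact patch_subset_of_split_subset (hg t htP) hg₂
      ((Set.subset_biUnion_of_mem (u := fun t => split (patch system lam tile 2 (j t) (g t)))
        htP).trans (hD.trans hE)) (ht t htP)

theorem bijOn_split :
    Set.BijOn split tilings (tilingSpace system.starDual dualFactor dualTile) := by
  refine ⟨fun 𝒯 h => split_mem_tilingSpace h, fun 𝒯 h 𝒯' h' e => ?_, fun 𝒯 h => ?_⟩
  · exact subset_antisymm (subset_of_split_eq h h' e) (subset_of_split_eq h' h e.symm)
  · obtain ⟨𝒯₀, h₀, e⟩ := exists_split_eq h
    exact ⟨𝒯₀, h₀, e⟩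

/-- Local derivability in terms of single tiles: if the tiles of `𝒯` that meet `x + C` are tiles of
another tiling after the translation from `x` to `y`, then so are the derived tiles at `x`. -/
theorem locallyDerivable_of_forall {R : Set (Set (Set ℂ) × Set (Set ℂ))} {C : Set ℂ}
    (hC : IsCompact C) (H : ∀ p ∈ R, ∀ p' ∈ R, ∀ x y : ℂ,
      (∀ t ∈ p.1, (t ∩ (x +ᵥ C)).Nonempty → (y - x) +ᵥ t ∈ p'.1) →
      ∀ t ∈ p.2, x ∈ t → (y - x) +ᵥ t ∈ p'.2) : LocallyDerivable R := by
  have key : ∀ p ∈ R, ∀ p' ∈ R, ∀ x y : ℂ,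
      translate (-x) (patchAt p.1 (x +ᵥ C)) ⊆ translate (-y) (patchAt p'.1 (y +ᵥ C)) →
      translate (-x) (patchAt p.2 {x}) ⊆ translate (-y) (patchAt p'.2 {y}) := by
    rintro p hp p' hp' x y h _ ⟨t, ⟨ht, hxt⟩, rfl⟩
    rw [Set.inter_singleton_nonempty] at hxt
    have h1 := H p hp p' hp' x y (fun s hs hsx => ?_) t ht hxt
    · rw [mem_translate, neg_neg, vadd_vadd, ← sub_eq_add_neg]
      refine ⟨h1, ?_⟩
      rw [Set.inter_singleton_nonempty]
      exact ⟨x, hxt, by simp⟩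
    · have h2 := h ⟨s, ⟨hs, hsx⟩, rfl⟩
      rw [mem_translate, neg_neg, vadd_vadd, ← sub_eq_add_neg] at h2
      exact h2.1
  exact ⟨C, hC, fun p hp p' hp' x y h =>
    subset_antisymm (key p hp p' hp' x y h.subset) (key p' hp' p hp y x h.symm.subset)⟩

theorem setOf_split_eq_image : {p : Set (Set ℂ) × Set (Set ℂ) | p.1 ∈ tilings ∧ p.2 = split p.1} =
    (fun 𝒯 => (𝒯, split 𝒯)) '' tilings := by
  ext ⟨𝒯, 𝒯'⟩
  simp [Set.mem_image, eq_comm]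

theorem locallyDerivable_split :
    LocallyDerivable {p | p.1 ∈ tilings ∧ p.2 = split p.1} := by
  rw [setOf_split_eq_image]
  refine locallyDerivable_of_forall (C := {0}) isCompact_singleton ?_
  rintro _ ⟨𝒯, h𝒯, rfl⟩ _ ⟨𝒯', h𝒯', rfl⟩ x y H A ⟨j, g, hg, ht, p, hp, e⟩ hx
  have hAt : A ⊆ g '' tile j := by
    rw [e, ← sUnion_pieces j]
    exact Set.image_mono (Set.subset_sUnion_of_mem hp)
  have h1 := H _ ht ⟨x, hAt hx, by simp⟩
  rw [vadd_image] at h1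
  refine ⟨j, _, add_mem_motions _ hg, h1, p, hp, ?_⟩
  rw [e, vadd_image]

/-- A tile at `x` is recognised from the pieces of a patch `σ² (g (T j))` around it, which lies
within the distance `patchRadius` of `x`. -/
theorem locallyDerivable_unsplit :
    LocallyDerivable (Prod.swap '' {p | p.1 ∈ tilings ∧ p.2 = split p.1}) := by
  rw [setOf_split_eq_image]
  refine locallyDerivable_of_forall (isCompact_closedBall 0 patchRadius) ?_
  rintro _ ⟨_, ⟨𝒯, h𝒯, rfl⟩, rfl⟩ _ ⟨_, ⟨𝒯', h𝒯', rfl⟩, rfl⟩ x y H t ht hx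
  simp only [Prod.swap_prod_mk] at H ht ⊢
  obtain ⟨i, g, hg, htg, hsub, hball⟩ := exists_patch_subset_tiling h𝒯 ht hx
  have hl := Code.lam_coe_ne_zero
  have hg' : (fun z => g z + ((lam : ℂ) ^ 2)⁻¹ * (y - x)) ∈ motions := by
    have := add_mem_motions (((lam : ℂ) ^ 2)⁻¹ * (y - x)) hg
    simpa only [add_comm] using this
  have h1 : split (patch system lam tile 2 i g) ⊆ split 𝒯 := split_mono hsub
  have h2 : translate (y - x) (patch system lam tile 2 i g) ⊆ 𝒯' := by
    rw [translate_patch 2 i g _ hl]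
    refine patch_subset_of_split_subset_split h𝒯' hg' ?_
    rw [← translate_patch 2 i g _ hl]
    refine (split_translate_subset _ _).trans ?_
    rintro _ ⟨A, hA, rfl⟩
    refine H A (h1 hA) ?_
    obtain ⟨s, hs, hAs⟩ := exists_subset_of_mem_split hA
    obtain ⟨z, hz⟩ := ((nonOverlapping_split_patch 2 i hg).1 A hA).2
    refine ⟨z, hz, ?_⟩
    have hz' := hball s hs (hAs hz)
    exact ⟨z - x, by simpa [dist_eq_norm] using hz', by simp⟩
  exact h2 ⟨t, htg, rfl⟩

end

end AmmannBeenker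

theorem theorem3p2 :
    AmmannBeenker.IsTileSubstitution AmmannBeenker.system (AmmannBeenker.lam : ℂ)
      AmmannBeenker.tile ∧
    ∃ D : AmmannBeenker.Proto → Set ℂ,
      (∀ D' : AmmannBeenker.Proto → Set ℂ,
        AmmannBeenker.IsSolution AmmannBeenker.system.starDual D' ↔ D' = D) ∧
      AmmannBeenker.IsTileSubstitution AmmannBeenker.system.starDual
        AmmannBeenker.dualFactor D ∧
      AmmannBeenker.IsRightTriangle (D .S) (√2 / 2) (√2 / 2) ∧
      AmmannBeenker.IsRightTriangle (D .L) (Real.cos (Real.pi / 8)) (Real.sin (Real.pi / 8)) ∧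
      AmmannBeenker.IsDissection (AmmannBeenker.tile .L) (AmmannBeenker.pieces .L) 4 (D .L) ∧
      AmmannBeenker.IsDissection (AmmannBeenker.tile .S) (AmmannBeenker.pieces .S) 2 (D .S) ∧
      Set.BijOn AmmannBeenker.split AmmannBeenker.tilings
        (AmmannBeenker.tilingSpace AmmannBeenker.system.starDual AmmannBeenker.dualFactor D) ∧
      AmmannBeenker.MutuallyLocallyDerivable
        {p | p.1 ∈ AmmannBeenker.tilings ∧ p.2 = AmmannBeenker.split p.1} :=
  ⟨AmmannBeenker.isTileSubstitution_system, AmmannBeenker.dualTile,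
    AmmannBeenker.isTileSubstitution_starDual.isSolution_iff,
    AmmannBeenker.isTileSubstitution_starDual, AmmannBeenker.isRightTriangle_dualTile_S,
    AmmannBeenker.isRightTriangle_dualTile_L, AmmannBeenker.isDissection_pieces .L,
    AmmannBeenker.isDissection_pieces .S, AmmannBeenker.bijOn_split,
    AmmannBeenker.locallyDerivable_split, AmmannBeenker.locallyDerivable_unsplit⟩
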